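/- Let $\mathbb{T}^2=\mathbb{R}^2/\mathbb{Z}^2$, $K=2\pi\mathbb{Z}^2\setminus\{(0,0)\}$, $e_k(x)=e^{i\langle k,x\rangle}$, and let $V$ be the Hilbert space of complex-valued $f\in L^2(\mathbb{T}^2)$ with $\int_{\mathbb{T}^2} f\,dx=0$, for which $(e_k)_{k\in K}$ is an orthonormal basis. Let $\nu>0$ and $H\in(0,1)$. Let $(\alpha_k)_{k\in K}\subset[c,\infty)$ for some $c>0$, with $\alpha_k=\alpha_{-k}$ and $\alpha_k\to\infty$ as $|k|\to\infty$, and let $(\lambda_k)_{k\in K}\subset[0,\infty)$ be bounded with $\lambda_k=\lambda_{-k}$. Let $A$ and $Q^{1/2}$ be the diagonal operators on $V$ with $Ae_k=-\alpha_ke_k$ and $Q^{1/2}e_k=\sqrt{\lambda_k}\,e_k$, and let $S(t)f=\sum_{k} e^{-t\nu\alpha_k}\langle f,e_k\rangle_V\, e_k$, $t\ge 0$, be the semigroup generated by $\nu A$. On a probability space let $B^H=\sum_{k\in K}\beta_k e_k$ (a formal series), where $\beta_k=(X_k+iY_k)/\sqrt2$ with $X_k,Y_k$ independent normalized real fractional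 Brownian motions on $\mathbb{R}$ with Hurst parameter $H$, and different $\beta_k$ are independent except that $\beta_{-k}=\overline{\beta_k}$. Consider $$d\psi_t=\nu A\psi_t\,dt+\nu^H Q^{1/2}\,dB^H_t. \qquad (*)$$ A jointly measurable process $(\psi(t))_{t\in\mathbb{R}}$ in $V$ is a mild solution of $(*)$ on $\mathbb{R}$ if for all $s\le t$, almost surely, $$\psi(t)=S(t-s)\psi(s)+\sum_{k\in K}\sqrt{\lambda_k}\,\nu^H\int_s^t e^{-(t-u)\nu\alpha_k}\,d\beta_k(u)\;e_k,$$ where the integrals are pathwise Riemann–Stieltjes integrals and the series converges in $L^2$ of the probability space with values in $V$. It is an ergodic mild solution if moreover it is strictly stationary and, for every Borel $\rho:V\to\mathbb{R}$ with $\mathbb{E}|\rho(\psi(0))|<\infty$, almost surely $\frac1T\int_0^T\rho(\psi(t))\,dt\to\mathbb{E}\,\rho(\psi(0))$ as $T\to\infty$. Suppose that for some $m\in\mathbb{N}_0$ and $\gamma\in(0,1)$ $$\sum_{k\in K}\lambda_k\alpha_k^{2\gamma-2H}|k|^{2m}<\infty\quad\text{and}\quad\sum_{k\in K}\lambda_k\alpha_k^{-2H}|k|^{2m+2\gamma}<\infty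 .$$ Let $C^m(\mathbb{T}^2)$ be the space of real-valued $C^m$ functions with norm $|f|_{C^m}=\sum_{|\delta|\le m}\sup_x|D^\delta f(x)|$, and let $\Omega=C(\mathbb{R},C^m(\mathbb{T}^2))$ with the compact-open topology. Then: 1. With $|\psi|_n=\sup_{-n\le t\le n}|\psi(t)|_{C^m}$, the formula $d(\psi,\tilde\psi)=\sum_{n\ge1}\frac{|\psi-\tilde\psi|_n}{2^n(1+|\psi-\tilde\psi|_n)}$ defines a complete metric on $\Omega$ that induces the compact-open topology. 2. The Borel $\sigma$-algebra $\mathcal F$ of $\Omega$ is the trace on $\Omega$ of the product $\sigma$-algebra $\mathcal{B}(C^m(\mathbb{T}^2))^{\otimes\mathbb{R}}$. 3. Equation $(*)$ has an ergodic mild solution; every ergodic mild solution has a version with all paths in $\Omega$; and all such versions of all ergodic mild solutions have one and the same law $\mathbb{P}$ on $(\Omega,\mathcal F)$. With the shifts $(\theta(t)\psi)(s)=\psi(t+s)$, the quadruple $(\Omega,\mathcal F,\mathbb{P},(\theta(t))_{t\in\mathbb{R}})$ is an ergodic metric dynamical system: $(\psi,t)\mapsto\theta(t)\psi$ is $\mathcal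 F\otimes\mathcal B(\mathbb{R})$–$\mathcal F$ measurable, $\theta(0)=\mathrm{id}$, $\theta(t+s)=\theta(t)\circ\theta(s)$, each $\theta(t)$ preserves $\mathbb{P}$, and every $E\in\mathcal F$ with $\theta(t)^{-1}(E)=E$ for all $t\in\mathbb{R}$ has $\mathbb{P}(E)\in\{0,1\}$. -/

import Mathlib

open MeasureTheory ProbabilityTheory Filter Topology BoundedContinuousFunction

noncomputable section

namespace FracField

/-! ### The torus and the space of `C^m` functions on it -/

/-- The two-dimensional torus `ℝ² / ℤ²`. -/
abbrev Torus : Type := UnitAddTorus (Fin 2)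

/-- Lebesgue measure on the torus, of total mass one. -/
abbrev torusMeasure : Measure Torus :=
  Measure.pi fun _ : Fin 2 => (AddCircle.haarAddCircle : Measure UnitAddCircle)

/-- The projection `ℝ² → ℝ² / ℤ²`. -/
def proj (x : Fin 2 → ℝ) : Torus := fun i => (x i : UnitAddCircle)

/-- The partial derivative `∂₁ᵃ ∂₂ᵇ F` of a function `F` on `ℝ²`. -/
def partialDeriv (a b : ℕ) (F : (Fin 2 → ℝ) → ℝ) (x : Fin 2 → ℝ) : ℝ :=
  iteratedFDeriv ℝ (a + b) F x
    (fun i => if (i : ℕ) < a then Pi.single 0 1 else Pi.single 1 1)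

/-- `C^m(𝕋²)`, as a real vector space: the real functions on the torus whose lift to `ℝ²` is `m`
times continuously differentiable. -/
def CmSub (m : ℕ) : Submodule ℝ (Torus → ℝ) where
  carrier := {f | ContDiff ℝ m (f ∘ proj)}
  zero_mem' := (contDiff_const : ContDiff ℝ m fun _ : Fin 2 → ℝ => (0 : ℝ))
  add_mem' := fun {f g} (hf : ContDiff ℝ m (f ∘ proj)) (hg : ContDiff ℝ m (g ∘ proj)) =>
    show ContDiff ℝ m (fun x => (f ∘ proj) x + (g ∘ proj) x) from hf.add hg
  smul_mem' := fun c f (hf : ContDiff ℝ m (f ∘ proj)) =>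
    show ContDiff ℝ m (fun x => c • (f ∘ proj) x) from hf.const_smul c

/-- `C^m(𝕋²)`. -/
def Cm (m : ℕ) : Type := CmSub m

namespace Cm

variable {m : ℕ}

instance : AddCommGroup (Cm m) := inferInstanceAs (AddCommGroup (CmSub m))
instance : Module ℝ (Cm m) := inferInstanceAs (Module ℝ (CmSub m))
instance : CoeFun (Cm m) (fun _ => Torus → ℝ) := ⟨fun f => f.1⟩

/-- The lift of a `C^m` function to `ℝ²`. -/
def lift (f : Cm m) : (Fin 2 → ℝ) → ℝ := f.1 ∘ proj

theorem contDiff_lift (f : Cm m) : ContDiff ℝ m f.lift := f.2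

theorem lift_add (f g : Cm m) : (f + g).lift = f.lift + g.lift := rfl

theorem lift_smul (c : ℝ) (f : Cm m) : (c • f).lift = c • f.lift := rfl

theorem continuous_partialDeriv (f : Cm m) {a b : ℕ} (h : a + b ≤ m) :
    Continuous (partialDeriv a b f.lift) := by
  have h1 : Continuous (iteratedFDeriv ℝ (a + b) f.lift) :=
    f.contDiff_lift.continuous_iteratedFDeriv (by exact_mod_cast h)
  exact (ContinuousMultilinearMap.apply ℝ (fun _ : Fin (a + b) => Fin 2 → ℝ) ℝ _).continuous.comp h1

theorem proj_add_int (x : Fin 2 → ℝ) (n : Fin 2 → ℤ) :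
    proj (x + fun i => (n i : ℝ)) = proj x := by
  funext i
  have h : ((n i : ℝ) : UnitAddCircle) = 0 := by
    rw [AddCircle.coe_eq_zero_iff]
    exact ⟨n i, by simp⟩
  change ((x i + (n i : ℝ) : ℝ) : UnitAddCircle) = (x i : UnitAddCircle)
  rw [AddCircle.coe_add, h, add_zero]

theorem partialDeriv_add_int (f : Cm m) (a b : ℕ) (x : Fin 2 → ℝ) (n : Fin 2 → ℤ) :
    partialDeriv a b f.lift (x + fun i => (n i : ℝ)) = partialDeriv a b f.lift x := by
  have h : (fun z => f.lift (z + fun i => (n i : ℝ))) = f.lift := by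
    funext z
    simp only [lift, Function.comp_apply, proj_add_int]
  unfold partialDeriv
  rw [← iteratedFDeriv_comp_add_right (𝕜 := ℝ) (f := f.lift) (a + b) (fun i => (n i : ℝ)) x, h]

theorem exists_bound (f : Cm m) {a b : ℕ} (h : a + b ≤ m) :
    ∃ C, ∀ x, ‖partialDeriv a b f.lift x‖ ≤ C := by
  obtain ⟨C, hC⟩ := (isCompact_Icc (a := (0 : Fin 2 → ℝ)) (b := 1)).exists_bound_of_continuousOn
    (f.continuous_partialDeriv h).continuousOn
  refine ⟨C, fun x => ?_⟩
  have hx : x = (fun i => Int.fract (x i)) + fun i => ((⌊x i⌋ : ℤ) : ℝ) := by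
    funext i
    exact (Int.fract_add_floor (x i)).symm
  rw [hx, partialDeriv_add_int f a b]
  refine hC _ ⟨fun i => Int.fract_nonneg _, fun i => (Int.fract_lt_one _).le⟩

/-- `D^δ f` for `δ = (a, b)` with `|δ| ≤ m`, as a bounded continuous function on `ℝ²`. -/
def deriv (f : Cm m) (a b : ℕ) (h : a + b ≤ m) : (Fin 2 → ℝ) →ᵇ ℝ :=
  BoundedContinuousFunction.ofNormedAddCommGroup (partialDeriv a b f.lift)
    (f.continuous_partialDeriv h) (f.exists_bound h).choose (f.exists_bound h).choose_spec

theorem deriv_add (f g : Cm m) (a b : ℕ) (h : a + b ≤ m) :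
    (f + g).deriv a b h = f.deriv a b h + g.deriv a b h := by
  ext x
  have hf : ContDiff ℝ (a + b : ℕ) f.lift := f.contDiff_lift.of_le (by exact_mod_cast h)
  have hg : ContDiff ℝ (a + b : ℕ) g.lift := g.contDiff_lift.of_le (by exact_mod_cast h)
  change partialDeriv a b (f + g).lift x = partialDeriv a b f.lift x + partialDeriv a b g.lift x
  unfold partialDeriv
  rw [lift_add, iteratedFDeriv_add_apply hf.contDiffAt hg.contDiffAt]
  rfl

theorem deriv_smul (c : ℝ) (f : Cm m) (a b : ℕ) (h : a + b ≤ m) :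
    (c • f).deriv a b h = c • f.deriv a b h := by
  ext x
  have hf : ContDiff ℝ (a + b : ℕ) f.lift := f.contDiff_lift.of_le (by exact_mod_cast h)
  change partialDeriv a b (c • f).lift x = c • partialDeriv a b f.lift x
  unfold partialDeriv
  rw [lift_smul, iteratedFDeriv_const_smul_apply hf.contDiffAt]
  rfl

theorem index_le (p : (Finset.range (m + 1) ×ˢ Finset.range (m + 1)).filter
    (fun p : ℕ × ℕ => p.1 + p.2 ≤ m)) : p.1.1 + p.1.2 ≤ m :=
  (Finset.mem_filter.1 p.2).2

/-- `|f|_{C^m} = ∑_{|δ| ≤ m} sup_x |D^δ f(x)|`. -/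
instance : Norm (Cm m) :=
  ⟨fun f => ∑ p : (Finset.range (m + 1) ×ˢ Finset.range (m + 1)).filter
    (fun p : ℕ × ℕ => p.1 + p.2 ≤ m), ‖f.deriv p.1.1 p.1.2 (index_le p)‖⟩

theorem norm_def (f : Cm m) :
    ‖f‖ = ∑ p : (Finset.range (m + 1) ×ˢ Finset.range (m + 1)).filter
      (fun p : ℕ × ℕ => p.1 + p.2 ≤ m), ‖f.deriv p.1.1 p.1.2 (index_le p)‖ := rfl

theorem normCore : NormedSpace.Core ℝ (Cm m) where
  norm_nonneg f := Finset.sum_nonneg fun _ _ => norm_nonneg _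
  norm_smul c f := by
    simp only [norm_def, deriv_smul, norm_smul, Finset.mul_sum]
  norm_triangle f g := by
    simp only [norm_def, deriv_add, ← Finset.sum_add_distrib]
    exact Finset.sum_le_sum fun _ _ => norm_add_le _ _
  norm_eq_zero_iff f := by
    constructor
    · intro h
      rw [norm_def, Finset.sum_eq_zero_iff_of_nonneg fun _ _ => norm_nonneg _] at h
      have h0 := h ⟨(0, 0), by simp⟩ (Finset.mem_univ _)
      rw [norm_eq_zero] at h0
      refine Subtype.ext (funext fun y => ?_)
      obtain ⟨x, rfl⟩ : ∃ x, proj x = y :=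
        ⟨fun i => (y i).out, funext fun i => Quotient.out_eq _⟩
      have := congrArg (fun F : (Fin 2 → ℝ) →ᵇ ℝ => F x) h0
      exact this
    · rintro rfl
      have h0 : (0 : Cm m) = (0 : ℝ) • (0 : Cm m) := by simp
      rw [norm_def]
      refine Finset.sum_eq_zero fun p _ => ?_
      rw [h0, deriv_smul, zero_smul, norm_zero]

instance : NormedAddCommGroup (Cm m) := NormedAddCommGroup.ofCore normCore
instance : NormedSpace ℝ (Cm m) := NormedSpace.ofCore normCore
instance : MeasurableSpace (Cm m) := borel _
instance : BorelSpace (Cm m) := ⟨rfl⟩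

end Cm

/-! ### The path space and the shifts -/

/-- `Ω = C(ℝ, C^m(𝕋²))`; as a `ContinuousMap` space it carries the compact-open topology. -/
abbrev PathSpace (m : ℕ) : Type := C(ℝ, Cm m)

/-- The Borel `σ`-algebra of the compact-open topology. -/
instance (m : ℕ) : MeasurableSpace (PathSpace m) := borel _

instance (m : ℕ) : BorelSpace (PathSpace m) := ⟨rfl⟩

/-- `|ψ|_r = sup_{-r ≤ t ≤ r} |ψ(t)|_{C^m}`. -/
def supNorm {m : ℕ} (r : ℝ) (ψ : PathSpace m) : ℝ := ⨆ t : Set.Icc (-r) r, ‖ψ t‖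

/-- `d(ψ, φ) = ∑_{n ≥ 1} |ψ - φ|_n / (2^n (1 + |ψ - φ|_n))`. -/
def pathDist {m : ℕ} (ψ φ : PathSpace m) : ℝ :=
  ∑' n : ℕ, supNorm (n + 1) (ψ - φ) / (2 ^ (n + 1) * (1 + supNorm (n + 1) (ψ - φ)))

/-- The shift `(θ(t)ψ)(s) = ψ(t + s)`. -/
def shift {m : ℕ} (t : ℝ) (ψ : PathSpace m) : PathSpace m :=
  ψ.comp ⟨fun s => t + s, by fun_prop⟩

/-- `(X, P, θ)` is a metric dynamical system (with time `ℝ`). -/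
structure IsMetricDynamicalSystem {X : Type*} [MeasurableSpace X] (P : Measure X)
    (θ : ℝ → X → X) : Prop where
  prob : IsProbabilityMeasure P
  measurable : Measurable fun p : X × ℝ => θ p.2 p.1
  zero : θ 0 = id
  flow : ∀ s t, θ (t + s) = θ t ∘ θ s
  invariant : ∀ t A, MeasurableSet A → P (θ t ⁻¹' A) = P A

/-- An ergodic metric dynamical system. -/
structure IsErgodicMDS {X : Type*} [MeasurableSpace X] (P : Measure X)
    (θ : ℝ → X → X) : Prop extends IsMetricDynamicalSystem P θ where
  ergodic : ∀ A, MeasurableSet A → (∀ t, θ t ⁻¹' A = A) → P A = 0 ∨ P A = 1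

/-! ### The Hilbert space `V` and its orthonormal basis -/

/-- `V`: the complex `L²` functions on the torus with mean zero. -/
def V : Submodule ℂ (Lp ℂ 2 torusMeasure) where
  carrier := {f | ∫ x, f x ∂torusMeasure = 0}
  zero_mem' := by
    change ∫ x, (0 : Lp ℂ 2 torusMeasure) x ∂torusMeasure = 0
    rw [integral_congr_ae (Lp.coeFn_zero ℂ 2 torusMeasure)]
    simp
  add_mem' := fun {f g} hf hg => by
    have hfi : Integrable f torusMeasure := (Lp.memLp f).integrable (by norm_num)
    have hgi : Integrable g torusMeasure := (Lp.memLp g).integrable (by norm_num)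
    change ∫ x, (f + g : Lp ℂ 2 torusMeasure) x ∂torusMeasure = 0
    rw [integral_congr_ae (Lp.coeFn_add f g)]
    change ∫ x, f x + g x ∂torusMeasure = 0
    rw [integral_add hfi hgi, hf, hg, add_zero]
  smul_mem' := fun c f hf => by
    change ∫ x, (c • f : Lp ℂ 2 torusMeasure) x ∂torusMeasure = 0
    rw [integral_congr_ae (Lp.coeFn_smul c f)]
    change ∫ x, c • f x ∂torusMeasure = 0
    rw [integral_smul, hf, smul_zero]

instance : MeasurableSpace V := borel _
instance : BorelSpace V := ⟨rfl⟩

/-- The index set: `n ∈ ℤ² \ {0}` stands for the wave vector `k = 2πn ∈ K = 2πℤ² \ {0}`. -/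
abbrev Mode : Type := {n : Fin 2 → ℤ // n ≠ 0}

/-- The mode `-k`. -/
def Mode.neg (k : Mode) : Mode := ⟨-k.1, neg_ne_zero.2 k.2⟩

/-- The Euclidean length `|k|` of the wave vector `k = 2πn`. -/
def Mode.length (k : Mode) : ℝ :=
  2 * Real.pi * Real.sqrt ((k.1 0 : ℝ) ^ 2 + (k.1 1 : ℝ) ^ 2)

theorem integral_mFourier_eq_zero (k : Mode) :
    ∫ x, UnitAddTorus.mFourier k.1 x ∂torusMeasure = 0 := by
  obtain ⟨i, hi⟩ := Function.ne_iff.1 k.2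
  have h : ∀ x : Torus, UnitAddTorus.mFourier k.1 x = ∏ i, fourier (k.1 i) (x i) := fun x => rfl
  simp only [h]
  rw [integral_fintype_prod_eq_prod (fun (i : Fin 2) (y : UnitAddCircle) => fourier (k.1 i) y)]
  refine Finset.prod_eq_zero (Finset.mem_univ i) ?_
  exact integral_eq_zero_of_add_right_eq_neg (fourier_add_half_inv_index hi (by norm_num))

/-- The basis function `e_k(x) = exp(i⟨k, x⟩) = exp(2πi⟨n, x⟩)` of `V`. -/
def e (k : Mode) : V :=
  ⟨ContinuousMap.toLp 2 torusMeasure ℂ (UnitAddTorus.mFourier k.1), by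
    change ∫ x, (ContinuousMap.toLp 2 torusMeasure ℂ (UnitAddTorus.mFourier k.1)) x
      ∂torusMeasure = 0
    rw [integral_congr_ae (ContinuousMap.coeFn_toLp torusMeasure _)]
    exact integral_mFourier_eq_zero k⟩

/-- The semigroup `S(t)` on `V` generated by `νA`, where `A e_k = -α_k e_k`:
`S(t) f = ∑_k exp(-tνα_k) ⟨f, e_k⟩ e_k`. -/
def semigroup (ν : ℝ) (α : Mode → ℝ) (t : ℝ) (f : V) : V :=
  ∑' k, ((Real.exp (-(t * ν * α k)) : ℂ) * inner ℂ (e k) f) • e k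

/-! ### The driving noise -/

section Noise

variable {S : Type*} [MeasurableSpace S]

/-- `X` is a normalized real fractional Brownian motion on `ℝ` with Hurst parameter `H`. -/
structure IsFBM (μ : Measure S) (H : ℝ) (X : ℝ → S → ℝ) : Prop where
  measurable : ∀ t, Measurable (X t)
  gaussian : IsGaussianProcess X μ
  start : ∀ᵐ ω ∂μ, X 0 ω = 0
  mean : ∀ t, ∫ ω, X t ω ∂μ = 0
  cov : ∀ s t, ∫ ω, X t ω * X s ω ∂μ =
    1 / 2 * (|t| ^ (2 * H) + |s| ^ (2 * H) - |t - s| ^ (2 * H))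
  continuous : ∀ᵐ ω ∂μ, Continuous fun t => X t ω

/-- The coefficients `β_k`, `k ∈ K`, of an infinite-dimensional fractional Brownian motion
`∑_k β_k e_k` in `V`: `β_k = (X_k + i Y_k) / √2` with independent normalized real fractional
Brownian motions `X_k`, `Y_k`, different `β_k` being independent except that
`β_{-k}` is the complex conjugate of `β_k`. -/
structure IsNoise (μ : Measure S) (H : ℝ) (β : Mode → ℝ → S → ℂ) : Prop where
  fbm_re : ∀ k, IsFBM μ H fun t ω => Real.sqrt 2 * (β k t ω).re
  fbm_im : ∀ k, IsFBM μ H fun t ω => Real.sqrt 2 * (β k t ω).im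
  indep_re_im : ∀ k, IndepFun (fun ω t => (β k t ω).re) (fun ω t => (β k t ω).im) μ
  conj : ∀ k t, ∀ᵐ ω ∂μ, β k.neg t ω = (starRingEnd ℂ) (β k t ω)
  indep : ∀ J : Set Mode, (∀ k ∈ J, k.neg ∉ J) → iIndepFun (fun (k : J) ω t => β k t ω) μ

/-- The pathwise integral `∫_s^t f db` of a continuously differentiable `f` against a continuous
path `b`, i.e. the Riemann-Stieltjes integral, which is given by integration by parts. -/
def wienerIntegral (f : ℝ → ℝ) (b : ℝ → ℂ) (s t : ℝ) : ℂ :=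
  f t * b t - f s * b s - ∫ u in s..t, ((_root_.deriv f u : ℝ) : ℂ) * b u

/-- `Z` is the stochastic convolution `∫_s^t S(t-u) Q^{1/2} dB(u)` with the factor `ν^H`, i.e. the
sum of the series `∑_k √λ_k ν^H (∫_s^t exp(-(t-u)να_k) dβ_k(u)) e_k`, convergent in `L²(μ; V)`. -/
def IsStochConv (μ : Measure S) (H ν : ℝ) (α lam : Mode → ℝ) (β : Mode → ℝ → S → ℂ)
    (s t : ℝ) (Z : S → V) : Prop :=
  MemLp Z 2 μ ∧
  Tendsto (fun F : Finset Mode => eLpNorm (fun ω =>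
      (∑ k ∈ F, (((Real.sqrt (lam k) * ν ^ H : ℝ) : ℂ) *
        wienerIntegral (fun u => Real.exp (-((t - u) * ν * α k))) (fun u => β k u ω) s t) • e k)
      - Z ω) 2 μ)
    atTop (𝓝 0)

/-- `ψ` is a mild solution on the whole line of `dψ = νAψ dt + ν^H Q^{1/2} dB^H`, where
`A e_k = -α_k e_k` and `Q^{1/2} e_k = √λ_k e_k`. -/
structure IsMildSolution (μ : Measure S) (H ν : ℝ) (α lam : Mode → ℝ) (β : Mode → ℝ → S → ℂ)
    (ψ : ℝ → S → V) : Prop where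
  measurable : Measurable fun p : ℝ × S => ψ p.1 p.2
  mild : ∀ s t, s ≤ t → ∃ Z : S → V, IsStochConv μ H ν α lam β s t Z ∧
    ∀ᵐ ω ∂μ, ψ t ω = semigroup ν α (t - s) (ψ s ω) + Z ω

/-- Strict stationarity of a `V`-valued process. -/
def IsStrictlyStationary (μ : Measure S) (ψ : ℝ → S → V) : Prop :=
  ∀ (n : ℕ) (t : Fin n → ℝ) (r : ℝ),
    μ.map (fun ω i => ψ (t i + r) ω) = μ.map (fun ω i => ψ (t i) ω)

/-- Ergodicity of a stationary process: time averages converge to the expectation. -/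
def IsErgodicProcess (μ : Measure S) (ψ : ℝ → S → V) : Prop :=
  ∀ ρ : V → ℝ, Measurable ρ → Integrable (fun ω => ρ (ψ 0 ω)) μ →
    ∀ᵐ ω ∂μ, (∀ T, 0 ≤ T → IntervalIntegrable (fun t => ρ (ψ t ω)) volume 0 T) ∧
      Tendsto (fun T : ℝ => 1 / T * ∫ t in (0 : ℝ)..T, ρ (ψ t ω)) atTop
        (𝓝 (∫ ω, ρ (ψ 0 ω) ∂μ))

/-- `ψ` is an ergodic (strictly stationary) mild solution. -/
structure IsErgodicMildSolution (μ : Measure S) (H ν : ℝ) (α lam : Mode → ℝ)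
    (β : Mode → ℝ → S → ℂ) (ψ : ℝ → S → V) : Prop
    extends IsMildSolution μ H ν α lam β ψ where
  stationary : IsStrictlyStationary μ ψ
  ergodic : IsErgodicProcess μ ψ

/-- `Ψ` is a version of the `V`-valued process `ψ` all of whose paths lie in `C(ℝ, C^m(𝕋²))`. -/
structure IsPathVersion {m : ℕ} (μ : Measure S) (ψ : ℝ → S → V) (Ψ : S → PathSpace m) :
    Prop where
  measurable : Measurable Ψ
  version : ∀ t, ∀ᵐ ω ∂μ,
    ((ψ t ω : Lp ℂ 2 torusMeasure) : Torus → ℂ) =ᵐ[torusMeasure] fun x => ((Ψ ω t x : ℝ) : ℂ)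

/-- `P` is the distribution on `C(ℝ, C^m(𝕋²))` of the ergodic mild solution: such a solution
exists, each has a version with paths in `C(ℝ, C^m(𝕋²))`, and every such version has the
law `P`. -/
structure IsLawOfErgodicMildSolution {m : ℕ} (μ : Measure S) (H ν : ℝ) (α lam : Mode → ℝ)
    (β : Mode → ℝ → S → ℂ) (P : Measure (PathSpace m)) : Prop where
  exists_solution : ∃ ψ, IsErgodicMildSolution μ H ν α lam β ψ
  exists_version : ∀ ψ, IsErgodicMildSolution μ H ν α lam β ψ →
    ∃ Ψ : S → PathSpace m, IsPathVersion μ ψ Ψ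
  law : ∀ ψ, IsErgodicMildSolution μ H ν α lam β ψ →
    ∀ Ψ : S → PathSpace m, IsPathVersion μ ψ Ψ → μ.map Ψ = P

end Noise

end FracField

end

/-! The equation decouples into Fourier modes. Mode `k` is driven by a fractional Brownian motion
with damping rate `ν α_k`, and its stationary solution is `∫_{-∞}^t exp(-ν α_k (t-u)) dβ_k(u)`.
Integration by parts turns this into an average of increments of the driving path against an
exponential density (`fou`), a Bochner integral in `L²(μ)` that stays in the closed linear span of
the noise. Everything in that span is centered Gaussian, so norms and inner products in `L²(μ)`
determine laws and moments.

Regularity. The averaged double increments satisfy `‖fou(t) - fou(s)‖ ≤ C a^(d-H) |t-s|^d` for `0 ≤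
d ≤ H` (`IsFBMCurve.norm_fou_sub_le`), so smoothness in time is paid for with powers of `α_k`; the
two summability conditions give, by interpolation, a small exponent `δ` of smoothness in time and
space at once. Inside a dyadic shell of frequencies the `C^m` norm is bounded by `L^{2p}` norms of
derivatives with a loss polynomial in the frequency (Nikolskii), while Gaussian moments of order
`2p` are controlled by second moments. For large `p` the gain from `δ` beats the loss, the shells
sum geometrically in `L^{2p}(μ; C^m)`, and Kolmogorov's theorem for the Hölder curve so obtained
gives a field with paths in `C(ℝ, C^m)` (`exists_field`).

Ergodicity. Covariances of distant increments are second differences of `|τ|^{2H}`, which tend to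
zero because `H < 1`; hence the covariances of the field decay. For Gaussian variables this makes
the observables `exp(i l(ψ))`, with `l` a finite combination of evaluations, decorrelate along the
shift. Such observables are then uncorrelated with every set invariant under the unit shift, and as
they determine measures, every such set has probability zero or one (`measure_eq_zero_or_one`).
Birkhoff's theorem, derived from the maximal ergodic inequality, turns this into convergence of time
averages.

Uniqueness. The difference of two mild solutions is transported by the semigroup, which contracts at
rate `exp(-ν c t)`. Starting from ever earlier times, stationarity keeps the initial values bounded
in probability, so the difference vanishes almost surely (`IsStationaryField.ae_eq`). Every
stationary mild solution is therefore a modification of the constructed field, and continuous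
versions of one process have one law.

The claims on the path space rest on comparing the metric with the uniformity of compact convergence
and on the Lusin–Souslin theorem: evaluations at a countable dense set of times and points form an
injective continuous map on a Polish space, hence a measurable embedding. -/

noncomputable section

namespace FracField

/-! ### `C^m(𝕋²)` is a separable Banach space -/

/-! ### Symmetry of iterated derivatives -/

section Symmetry

variable {E : Type*} [NormedAddCommGroup E] [NormedSpace ℝ E]

/-- Iterated directional derivatives along a list of directions. -/
def dirDeriv (F : E → ℝ) : List E → E → ℝ
  | [] => F
  | v :: l => fun x => fderiv ℝ (dirDeriv F l) x v

theorem contDiff_dirDeriv {F : E → ℝ} (n : ℕ) (l : List E)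
    (hF : ContDiff ℝ (n + l.length : ℕ) F) : ContDiff ℝ n (dirDeriv F l) := by
  induction l generalizing n with
  | nil => simpa [dirDeriv] using hF
  | cons v l ih =>
    have h : ContDiff ℝ (n + 1 : ℕ) (dirDeriv F l) := ih (n + 1) (by
      convert hF using 2
      simp only [List.length_cons]
      omega)
    exact (h.fderiv_right (m := n) (by norm_cast)).clm_apply contDiff_const

/-- Adjacent swaps generate all permutations, and a swap of the two outermost directions is the
symmetry of the second derivative of `dirDeriv F l`, which is still `C²` because the two directions
are counted in the length of the list. -/
theorem dirDeriv_eq_of_perm {F : E → ℝ} {l l' : List E} (hl : l.Perm l')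
    (hF : ContDiff ℝ (l.length : ℕ) F) : dirDeriv F l = dirDeriv F l' := by
  induction hl with
  | nil => rfl
  | cons v _ ih =>
    funext x
    simp only [dirDeriv, ih (hF.of_le (by simp only [List.length_cons]; norm_cast; omega))]
  | swap u v l =>
    have h2 : ContDiff ℝ (2 : ℕ) (dirDeriv F l) := contDiff_dirDeriv 2 l (by
      convert hF using 2
      simp only [List.length_cons]
      omega)
    have hd : Differentiable ℝ (fderiv ℝ (dirDeriv F l)) :=
      (h2.fderiv_right (m := 1) (by norm_num)).differentiable (by norm_num)
    funext x
    have key (w z : E) : fderiv ℝ (fun y => fderiv ℝ (dirDeriv F l) y w) x z =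
        fderiv ℝ (fderiv ℝ (dirDeriv F l)) x z w := by
      rw [fderiv_clm_apply hd.differentiableAt (differentiableAt_const w)]
      simp
    simp only [dirDeriv, key]
    exact (h2.contDiffAt.isSymmSndFDerivAt (by simp)).eq _ _
  | trans h1 _ ih1 ih2 => exact (ih1 hF).trans (ih2 (h1.length_eq ▸ hF))

theorem iteratedFDeriv_eq_dirDeriv {F : E → ℝ} (n : ℕ) (hF : ContDiff ℝ n F) (x : E)
    (v : Fin n → E) : iteratedFDeriv ℝ n F x v = dirDeriv F (List.ofFn v) x := by
  induction n generalizing x with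
  | zero => simp [dirDeriv]
  | succ n ih =>
    have hd : Differentiable ℝ (iteratedFDeriv ℝ n F) :=
      hF.differentiable_iteratedFDeriv (by norm_cast; omega)
    rw [iteratedFDeriv_succ_apply_left, List.ofFn_succ, dirDeriv]
    have : dirDeriv F (List.ofFn fun i => v i.succ) =
        fun y => ContinuousMultilinearMap.apply ℝ (fun _ : Fin n => E) ℝ (Fin.tail v)
          (iteratedFDeriv ℝ n F y) := by
      funext y
      exact (ih (hF.of_le (by norm_cast; omega)) y (Fin.tail v)).symm
    rw [this]
    have h := ((ContinuousMultilinearMap.apply ℝ (fun _ : Fin n => E) ℝ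
      (Fin.tail v)).hasFDerivAt.comp x hd.differentiableAt.hasFDerivAt).fderiv
    exact (congrArg (fun L : E →L[ℝ] ℝ => L (v 0)) h).symm

/-- The norm of `Cm m` only sees mixed partials in one fixed order of directions; symmetry carries
its bounds over to all orders. -/
theorem iteratedFDeriv_comp_perm_of_contDiff {F : E → ℝ} {n : ℕ} (hF : ContDiff ℝ n F) (x : E)
    (v : Fin n → E) (σ : Equiv.Perm (Fin n)) :
    iteratedFDeriv ℝ n F x (v ∘ σ) = iteratedFDeriv ℝ n F x v := by
  rw [iteratedFDeriv_eq_dirDeriv n hF, iteratedFDeriv_eq_dirDeriv n hF]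
  exact congrFun (dirDeriv_eq_of_perm (σ.ofFn_comp_perm v) (by simpa using hF)) x

end Symmetry
-- Sorting a word in the letters `0`, `1` puts the zeros first; `a` is the position of the first
-- `1`, or `k` if there is none. This is the pattern of directions used in `partialDeriv`.
theorem exists_perm_comp_eq_ite {k : ℕ} (r : Fin k → Fin 2) :
    ∃ a ≤ k, ∃ σ : Equiv.Perm (Fin k), ∀ j, r (σ j) = if (j : ℕ) < a then 0 else 1 := by
  have hmono : Monotone (r ∘ Tuple.sort r) := Tuple.monotone_sort r
  suffices ∃ a ≤ k, ∀ j : Fin k, (r ∘ Tuple.sort r) j = if (j : ℕ) < a then 0 else 1 by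
    obtain ⟨a, ha, h⟩ := this
    exact ⟨a, ha, _, h⟩
  generalize r ∘ Tuple.sort r = g at hmono
  by_cases h : ∃ j, g j = 1
  · let j₀ := (Set.univ.toFinset.filter fun j => g j = 1).min' (by
      obtain ⟨j, hj⟩ := h
      exact ⟨j, by simp [hj]⟩)
    have hj₀ : g j₀ = 1 := (Finset.mem_filter.1 (Finset.min'_mem (Set.univ.toFinset.filter fun j => g j = 1) _)).2
    refine ⟨j₀, j₀.2.le, fun j => ?_⟩
    split_ifs with hj
    · by_contra h0
      have h1 : g j = 1 := by omega
      exact absurd (Finset.min'_le _ j (by simp [h1] : j ∈ Set.univ.toFinset.filter fun j => g j = 1))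
        (not_le.2 hj)
    · have := hmono (show j₀ ≤ j from not_lt.1 hj)
      rw [hj₀] at this
      omega
  · refine ⟨k, le_rfl, fun j => ?_⟩
    rw [if_pos j.2]
    by_contra h0
    exact h ⟨j, by omega⟩

namespace Cm

variable {m : ℕ}

theorem norm_deriv_le (f : Cm m) (p : (Finset.range (m + 1) ×ˢ Finset.range (m + 1)).filter
      (fun p : ℕ × ℕ => p.1 + p.2 ≤ m)) :
    ‖f.deriv p.1.1 p.1.2 (index_le p)‖ ≤ ‖f‖ := by
  rw [norm_def]
  exact Finset.single_le_sum
    (f := fun p : (Finset.range (m + 1) ×ˢ Finset.range (m + 1)).filter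
      (fun p : ℕ × ℕ => p.1 + p.2 ≤ m) => ‖f.deriv p.1.1 p.1.2 (index_le p)‖)
    (fun _ _ => norm_nonneg _) (Finset.mem_univ p)

theorem norm_partialDeriv_le (f : Cm m) {a b : ℕ} (h : a + b ≤ m) (x : Fin 2 → ℝ) :
    ‖partialDeriv a b f.lift x‖ ≤ ‖f‖ := by
  have hm : (a, b) ∈ (Finset.range (m + 1) ×ˢ Finset.range (m + 1)).filter
      (fun p : ℕ × ℕ => p.1 + p.2 ≤ m) := by
    simp only [Finset.mem_filter, Finset.mem_product, Finset.mem_range]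
    omega
  exact ((f.deriv a b h).norm_coe_le_norm x).trans (f.norm_deriv_le ⟨(a, b), hm⟩)

theorem partialDeriv_zero (F : (Fin 2 → ℝ) → ℝ) (x : Fin 2 → ℝ) : partialDeriv 0 0 F x = F x := by
  simp [partialDeriv]

theorem norm_lift_le (f : Cm m) (x : Fin 2 → ℝ) : ‖f.lift x‖ ≤ ‖f‖ := by
  simpa [partialDeriv_zero] using f.norm_partialDeriv_le (a := 0) (b := 0) (Nat.zero_le m) x

theorem proj_surjective : Function.Surjective proj := fun y =>
  ⟨fun i => (y i).out, funext fun _ => Quotient.out_eq _⟩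

theorem norm_apply_le (f : Cm m) (x : Torus) : ‖f x‖ ≤ ‖f‖ := by
  obtain ⟨x, rfl⟩ := proj_surjective x
  exact f.norm_lift_le x

@[ext] theorem ext_apply {f g : Cm m} (h : ∀ x, f x = g x) : f = g := Subtype.ext (funext h)

@[simp] theorem add_apply (f g : Cm m) (x : Torus) : (f + g) x = f x + g x := rfl
@[simp] theorem smul_apply (c : ℝ) (f : Cm m) (x : Torus) : (c • f) x = c * f x := rfl

/-- Evaluation at a point, as a continuous linear functional. -/
def evalCLM (x : Torus) : Cm m →L[ℝ] ℝ :=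
  LinearMap.mkContinuous
    { toFun := fun f => f x
      map_add' := fun _ _ => rfl
      map_smul' := fun _ _ => rfl } 1 fun f => (f.norm_apply_le x).trans_eq (one_mul _).symm

theorem isOpenQuotientMap_proj : IsOpenQuotientMap proj :=
  IsOpenQuotientMap.piMap fun _ => QuotientAddGroup.isOpenQuotientMap_mk

theorem continuous_coe (f : Cm m) : Continuous (f : Torus → ℝ) := by
  have h : Continuous ((f : Torus → ℝ) ∘ proj) := f.contDiff_lift.continuous
  exact isOpenQuotientMap_proj.isQuotientMap.continuous_iff.2 h

/-- Expanding each argument in the standard basis yields one term for each word of directions, and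
each term becomes a `partialDeriv` after sorting. Bounds on the full derivative are what
differentiation of a series term by term requires. -/
theorem norm_iteratedFDeriv_le (f : Cm m) {k : ℕ} (hk : k ≤ m) (x : Fin 2 → ℝ) :
    ‖iteratedFDeriv ℝ k f.lift x‖ ≤ Fintype.card (Fin k → Fin 2) * ‖f‖ := by
  have key (r : Fin k → Fin 2) :
      ‖iteratedFDeriv ℝ k f.lift x (fun j => Pi.single (r j) 1)‖ ≤ ‖f‖ := by
    obtain ⟨a, ha, σ, hσ⟩ := exists_perm_comp_eq_ite r
    obtain ⟨b, rfl⟩ := Nat.exists_eq_add_of_le ha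
    rw [← iteratedFDeriv_comp_perm_of_contDiff
      (f.contDiff_lift.of_le (by exact_mod_cast hk)) x _ σ]
    have : (fun j => (Pi.single (r j) 1 : Fin 2 → ℝ)) ∘ σ =
        (fun i : Fin (a + b) => if (i : ℕ) < a then Pi.single 0 1
          else Pi.single 1 1) := by
      funext j
      simp only [Function.comp_apply, hσ]
      split_ifs <;> rfl
    rw [this]
    exact f.norm_partialDeriv_le hk x
  refine ContinuousMultilinearMap.opNorm_le_bound (by positivity) fun v => ?_
  have hv : v = fun j => ∑ i : Fin 2, v j i • (Pi.single i (1 : ℝ) : Fin 2 → ℝ) := by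
    funext j
    exact pi_eq_sum_univ' (v j) |>.trans (by
      refine Finset.sum_congr rfl fun i _ => ?_
      congr 1)
  conv_lhs => rw [hv]
  rw [ContinuousMultilinearMap.map_sum]
  refine (norm_sum_le _ _).trans ?_
  rw [mul_assoc, ← nsmul_eq_mul, ← Finset.card_univ]
  refine Finset.sum_le_card_nsmul _ _ _ fun r _ => ?_
  rw [ContinuousMultilinearMap.map_smul_univ, norm_smul, mul_comm]
  refine mul_le_mul (key r) ?_ (norm_nonneg _) (norm_nonneg _)
  rw [norm_prod]
  exact Finset.prod_le_prod (fun _ _ => norm_nonneg _) fun j _ => norm_le_pi_norm (v j) (r j)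

theorem norm_le_card_mul (f : Cm m) {C : ℝ}
    (h : ∀ a b (h : a + b ≤ m), ‖f.deriv a b h‖ ≤ C) :
    ‖f‖ ≤ ((Finset.range (m + 1) ×ˢ Finset.range (m + 1)).filter
      (fun p : ℕ × ℕ => p.1 + p.2 ≤ m)).card * C := by
  rw [norm_def]
  refine (Finset.sum_le_card_nsmul _ _ C fun p _ => h _ _ (index_le p)).trans ?_
  simp

/-- Evaluation of a partial derivative, as a linear functional. -/
def partialDerivLM (a b : ℕ) (h : a + b ≤ m) (x : Fin 2 → ℝ) : Cm m →ₗ[ℝ] ℝ where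
  toFun g := partialDeriv a b g.lift x
  map_add' g g' := congrArg (fun F : (Fin 2 → ℝ) →ᵇ ℝ => F x) (deriv_add g g' a b h)
  map_smul' c g := congrArg (fun F : (Fin 2 → ℝ) →ᵇ ℝ => F x) (deriv_smul c g a b h)

theorem partialDerivLM_apply (a b : ℕ) (h : a + b ≤ m) (x : Fin 2 → ℝ) (g : Cm m) :
    partialDerivLM a b h x g = partialDeriv a b g.lift x := rfl

theorem norm_deriv_le_of_forall {f : Cm m} {a b : ℕ} (h : a + b ≤ m) {C : ℝ} (hC : 0 ≤ C)
    (hf : ∀ x, ‖partialDeriv a b f.lift x‖ ≤ C) : ‖f.deriv a b h‖ ≤ C :=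
  (BoundedContinuousFunction.norm_le hC).2 hf

/-- Since `norm_iteratedFDeriv_le` makes the series of derivatives of every order up to `m` converge
uniformly, the pointwise sum is `C^m` and may be differentiated term by term. Completeness then
follows from the convergence of absolutely convergent series. -/
theorem exists_hasSum_partialDeriv (u : ℕ → Cm m) (hu : Summable fun n => ‖u n‖) :
    ∃ f : Cm m, ∀ a b, a + b ≤ m → ∀ x,
      HasSum (fun n => partialDeriv a b (u n).lift x) (partialDeriv a b f.lift x) := by
  have hv (k : ℕ) (_ : (k : ℕ∞) ≤ (m : ℕ∞)) :
      Summable fun n => Fintype.card (Fin k → Fin 2) * ‖u n‖ := hu.mul_left _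
  have hb (k n : ℕ) (x : Fin 2 → ℝ) (hk : (k : ℕ∞) ≤ (m : ℕ∞)) :
      ‖iteratedFDeriv ℝ k (u n).lift x‖ ≤ Fintype.card (Fin k → Fin 2) * ‖u n‖ :=
    (u n).norm_iteratedFDeriv_le (by exact_mod_cast hk) x
  have hcd (n : ℕ) : ContDiff ℝ (m : ℕ∞) (u n).lift := (u n).contDiff_lift
  have hf : ContDiff ℝ m fun x => ∑' n, (u n).lift x := contDiff_tsum (N := (m : ℕ∞)) hcd hv hb
  refine ⟨⟨fun y => ∑' n, u n y, hf⟩, fun a b h x => ?_⟩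
  have hs : Summable fun n => iteratedFDeriv ℝ (a + b) (u n).lift x :=
    .of_norm_bounded (hv (a + b) (by exact_mod_cast h)) fun n => hb _ n x (by exact_mod_cast h)
  have := hs.hasSum
  rw [← iteratedFDeriv_tsum_apply (N := (m : ℕ∞)) hcd hv hb (by exact_mod_cast h) x] at this
  exact this.mapL (ContinuousMultilinearMap.apply ℝ (fun _ : Fin (a + b) => Fin 2 → ℝ) ℝ
    (fun i => if (i : ℕ) < a then Pi.single 0 1 else Pi.single 1 1))

theorem norm_deriv_sum_sub_le (u : ℕ → Cm m) (hu : Summable fun n => ‖u n‖) {f : Cm m} {a b : ℕ}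
    (h : a + b ≤ m)
    (hf : ∀ x, HasSum (fun n => partialDeriv a b (u n).lift x) (partialDeriv a b f.lift x))
    (N : ℕ) : ‖Cm.deriv (∑ n ∈ Finset.range N, u n - f) a b h‖ ≤ ∑' n, ‖u (n + N)‖ := by
  refine norm_deriv_le_of_forall h (tsum_nonneg fun _ => norm_nonneg _) fun x => ?_
  rw [← partialDerivLM_apply a b h, map_sub, map_sum, partialDerivLM_apply, norm_sub_rev,
    ← (hf x).tsum_eq]
  simp only [partialDerivLM_apply]
  rw [← (hf x).summable.sum_add_tsum_nat_add N, add_sub_cancel_left]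
  have hs := (summable_nat_add_iff N).2 hu
  exact tsum_of_norm_bounded hs.hasSum fun n => (u (n + N)).norm_partialDeriv_le h x

theorem exists_tendsto_of_summable_norm (u : ℕ → Cm m) (hu : Summable fun n => ‖u n‖) :
    ∃ f : Cm m, Tendsto (fun N => ∑ n ∈ Finset.range N, u n) atTop (𝓝 f) := by
  obtain ⟨f, hf⟩ := exists_hasSum_partialDeriv u hu
  refine ⟨f, ?_⟩
  rw [tendsto_iff_norm_sub_tendsto_zero]
  have hlim := (tendsto_sum_nat_add fun n => ‖u n‖).const_mul
    (((Finset.range (m + 1) ×ˢ Finset.range (m + 1)).filter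
      (fun p : ℕ × ℕ => p.1 + p.2 ≤ m)).card : ℝ)
  rw [mul_zero] at hlim
  exact squeeze_zero (fun _ => norm_nonneg _)
    (fun N => norm_le_card_mul _ fun a b h => norm_deriv_sum_sub_le u hu h (hf a b h) N) hlim

instance : CompleteSpace (Cm m) :=
  NormedAddCommGroup.completeSpace_of_summable_imp_tendsto fun u hu => by
    obtain ⟨f, hf⟩ := exists_tendsto_of_summable_norm u hu
    exact ⟨f, hf⟩

/-- All derivatives of order at most `m`, restricted to the unit square. -/
def jet (f : Cm m) : ((Finset.range (m + 1) ×ˢ Finset.range (m + 1)).filter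
    (fun p : ℕ × ℕ => p.1 + p.2 ≤ m)) → C(Set.Icc (0 : Fin 2 → ℝ) 1, ℝ) :=
  fun p => ⟨fun x => partialDeriv p.1.1 p.1.2 f.lift x,
    (f.continuous_partialDeriv (index_le p)).comp continuous_subtype_val⟩

theorem norm_deriv_le_of_forall_Icc (f : Cm m) {a b : ℕ} (h : a + b ≤ m) {C : ℝ} (hC : 0 ≤ C)
    (hf : ∀ x ∈ Set.Icc (0 : Fin 2 → ℝ) 1, ‖partialDeriv a b f.lift x‖ ≤ C) :
    ‖f.deriv a b h‖ ≤ C := by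
  refine (BoundedContinuousFunction.norm_le hC).2 fun x => ?_
  have hx : x = (fun i => Int.fract (x i)) + fun i => ((⌊x i⌋ : ℤ) : ℝ) := by
    funext i
    exact (Int.fract_add_floor (x i)).symm
  change ‖partialDeriv a b f.lift x‖ ≤ C
  rw [hx, partialDeriv_add_int f a b]
  exact hf _ ⟨fun i => Int.fract_nonneg _, fun i => (Int.fract_lt_one _).le⟩

theorem jet_sub (f g : Cm m) : (f - g).jet = f.jet - g.jet := by
  funext p
  ext x
  exact map_sub (partialDerivLM p.1.1 p.1.2 (index_le p) x) f g

/-- Separability is inherited from a finite product of spaces of continuous functions on a compact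
square. By periodicity the square sees the full supremum, so `jet` is Lipschitz and antilipschitz;
bounded continuous functions on the whole plane would not form a separable space. -/
theorem isInducing_jet : Topology.IsInducing (jet : Cm m → _) := by
  have h1 : AntilipschitzWith ((Finset.range (m + 1) ×ˢ Finset.range (m + 1)).filter
      (fun p : ℕ × ℕ => p.1 + p.2 ≤ m)).card (jet : Cm m → _) := by
    refine AntilipschitzWith.of_le_mul_dist fun f g => ?_
    rw [dist_eq_norm, dist_eq_norm, ← jet_sub]
    refine norm_le_card_mul _ fun a b h => ?_
    refine norm_deriv_le_of_forall_Icc _ _ (norm_nonneg _) fun x hx => ?_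
    have hm : (a, b) ∈ (Finset.range (m + 1) ×ˢ Finset.range (m + 1)).filter
        (fun p : ℕ × ℕ => p.1 + p.2 ≤ m) := by
      simp only [Finset.mem_filter, Finset.mem_product, Finset.mem_range]
      omega
    exact (((f - g).jet ⟨(a, b), hm⟩).norm_coe_le_norm ⟨x, hx⟩).trans (norm_le_pi_norm _ _)
  have h2 : LipschitzWith 1 (jet : Cm m → _) := by
    refine LipschitzWith.of_dist_le_mul fun f g => ?_
    rw [dist_eq_norm, dist_eq_norm, ← jet_sub, NNReal.coe_one, one_mul]
    refine (pi_norm_le_iff_of_nonneg (norm_nonneg _)).2 fun p => ?_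
    exact (ContinuousMap.norm_le _ (norm_nonneg _)).2 fun x =>
      norm_partialDeriv_le _ (index_le p) _
  exact (h1.isUniformInducing h2.uniformContinuous).isInducing

instance : SecondCountableTopology (Cm m) := isInducing_jet.secondCountableTopology

end Cm

end FracField

end

noncomputable section

namespace FracField

/-! ### The metric of the path space -/

section PathMetric

variable {m : ℕ}

theorem bddAbove_range_norm (r : ℝ) (ψ : PathSpace m) :
    BddAbove (Set.range fun t : Set.Icc (-r) r => ‖ψ t‖) := by
  have h : IsCompact ((fun t => ‖ψ t‖) '' Set.Icc (-r) r) :=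
    isCompact_Icc.image (by fun_prop)
  refine h.bddAbove.mono ?_
  rintro _ ⟨t, rfl⟩
  exact ⟨t, t.2, rfl⟩

theorem norm_le_supNorm {r t : ℝ} (ht : t ∈ Set.Icc (-r) r) (ψ : PathSpace m) :
    ‖ψ t‖ ≤ supNorm r ψ := le_ciSup (bddAbove_range_norm r ψ) ⟨t, ht⟩

theorem supNorm_le {r C : ℝ} (hC : 0 ≤ C) {ψ : PathSpace m}
    (h : ∀ t ∈ Set.Icc (-r) r, ‖ψ t‖ ≤ C) : supNorm r ψ ≤ C :=
  Real.iSup_le (fun t => h t t.2) hC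

theorem supNorm_nonneg (r : ℝ) (ψ : PathSpace m) : 0 ≤ supNorm r ψ :=
  Real.iSup_nonneg fun _ => norm_nonneg _

theorem supNorm_add_le (r : ℝ) (ψ φ : PathSpace m) :
    supNorm r (ψ + φ) ≤ supNorm r ψ + supNorm r φ :=
  supNorm_le (add_nonneg (supNorm_nonneg _ _) (supNorm_nonneg _ _)) fun _ ht =>
    (norm_add_le _ _).trans (add_le_add (norm_le_supNorm ht ψ) (norm_le_supNorm ht φ))

theorem supNorm_neg (r : ℝ) (ψ : PathSpace m) : supNorm r (-ψ) = supNorm r ψ := by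
  simp [supNorm]

/-- The terms of the series that defines `pathDist`. -/
def distTerm (n : ℕ) (s : ℝ) : ℝ := s / (2 ^ (n + 1) * (1 + s))

theorem distTerm_eq (n : ℕ) {s : ℝ} (hs : 0 ≤ s) :
    distTerm n s = (1 / 2) ^ (n + 1) * (1 - 1 / (1 + s)) := by
  have : 1 + s ≠ 0 := by positivity
  rw [distTerm, one_div_pow]
  field_simp
  ring

theorem distTerm_mono (n : ℕ) {s t : ℝ} (hs : 0 ≤ s) (h : s ≤ t) : distTerm n s ≤ distTerm n t := by
  rw [distTerm_eq n hs, distTerm_eq n (hs.trans h)]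
  gcongr

theorem distTerm_nonneg (n : ℕ) {s : ℝ} (hs : 0 ≤ s) : 0 ≤ distTerm n s := by
  unfold distTerm
  positivity

theorem distTerm_le (n : ℕ) {s : ℝ} (hs : 0 ≤ s) : distTerm n s ≤ (1 / 2) ^ (n + 1) := by
  rw [distTerm_eq n hs]
  exact mul_le_of_le_one_right (by positivity) (by
    have : 0 ≤ 1 / (1 + s) := by positivity
    linarith)

theorem distTerm_le_mul (n : ℕ) {s : ℝ} (hs : 0 ≤ s) : distTerm n s ≤ (1 / 2) ^ (n + 1) * s := by
  rw [distTerm, one_div_pow, div_le_iff₀ (by positivity)]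
  field_simp
  nlinarith

theorem distTerm_add_le (n : ℕ) {s t : ℝ} (hs : 0 ≤ s) (ht : 0 ≤ t) :
    distTerm n (s + t) ≤ distTerm n s + distTerm n t := by
  simp only [distTerm]
  rw [add_div]
  gcongr <;> linarith

theorem summable_distTerm {s : ℕ → ℝ} (hs : ∀ n, 0 ≤ s n) : Summable fun n => distTerm n (s n) :=
  .of_nonneg_of_le (fun n => distTerm_nonneg n (hs n)) (fun n => distTerm_le n (hs n))
    ((summable_nat_add_iff 1).2 summable_geometric_two)

theorem pathDist_eq (ψ φ : PathSpace m) :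
    pathDist ψ φ = ∑' n : ℕ, distTerm n (supNorm (n + 1) (ψ - φ)) := rfl

theorem pathDist_triangle (ψ φ χ : PathSpace m) :
    pathDist ψ χ ≤ pathDist ψ φ + pathDist φ χ := by
  simp only [pathDist_eq]
  rw [← (summable_distTerm fun n => supNorm_nonneg _ _).tsum_add
    (summable_distTerm fun n => supNorm_nonneg _ _)]
  refine (summable_distTerm fun n => supNorm_nonneg _ _).tsum_le_tsum (fun n => ?_)
    ((summable_distTerm fun n => supNorm_nonneg _ _).add
      (summable_distTerm fun n => supNorm_nonneg _ _))
  refine le_trans (distTerm_mono n (supNorm_nonneg _ _) ?_)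
    (distTerm_add_le n (supNorm_nonneg _ _) (supNorm_nonneg _ _))
  simpa using supNorm_add_le ((n : ℝ) + 1) (ψ - φ) (φ - χ)

theorem distTerm_le_pathDist (n : ℕ) (ψ φ : PathSpace m) :
    distTerm n (supNorm (n + 1) (ψ - φ)) ≤ pathDist ψ φ :=
  (summable_distTerm (s := fun k : ℕ => supNorm (k + 1) (ψ - φ))
    fun _ => supNorm_nonneg _ _).le_tsum n fun _ _ => distTerm_nonneg _ (supNorm_nonneg _ _)

theorem supNorm_lt_of_pathDist_lt {n : ℕ} {ε : ℝ} (hε : 0 < ε) {ψ φ : PathSpace m}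
    (h : pathDist ψ φ < distTerm n ε) : supNorm (n + 1) (ψ - φ) < ε := by
  by_contra! h'
  exact absurd ((distTerm_mono n hε.le h').trans (distTerm_le_pathDist n ψ φ)) (not_le.2 h)

/-- The terms with `n < N` involve only times in `[-N, N]` and add up to at most `δ`; the others are
at most `(1 / 2) ^ (n + 1)`, however far apart the paths are. -/
theorem pathDist_le {N : ℕ} {δ : ℝ} (hδ : 0 ≤ δ) {ψ φ : PathSpace m}
    (h : ∀ t ∈ Set.Icc (-(N : ℝ)) N, ‖ψ t - φ t‖ ≤ δ) : pathDist ψ φ ≤ δ + (1 / 2) ^ N := by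
  have hs := summable_distTerm (s := fun n : ℕ => supNorm (n + 1) (ψ - φ))
    fun n => supNorm_nonneg _ _
  rw [pathDist_eq, ← hs.sum_add_tsum_nat_add N]
  refine add_le_add ?_ ?_
  · calc ∑ n ∈ Finset.range N, distTerm n (supNorm (n + 1) (ψ - φ))
        ≤ ∑ n ∈ Finset.range N, (1 / 2) ^ n * (1 / 2 * δ) := by
          refine Finset.sum_le_sum fun n hn => (distTerm_le_mul n (supNorm_nonneg _ _)).trans ?_
          rw [pow_succ, mul_assoc]
          gcongr
          refine supNorm_le hδ fun t ht => h t ?_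
          have : (n : ℝ) + 1 ≤ N := by exact_mod_cast Finset.mem_range.1 hn
          exact ⟨by linarith [ht.1], by linarith [ht.2]⟩
      _ ≤ 2 * (1 / 2 * δ) := by
          rw [← Finset.sum_mul]
          gcongr
          exact sum_geometric_two_le N
      _ = δ := by ring
  · have h2 : HasSum (fun n : ℕ => (1 / 2 : ℝ) ^ N * ((1 / 2) ^ n * (1 / 2))) ((1 / 2) ^ N) := by
      simpa using (hasSum_geometric_two.mul_right (1 / 2 : ℝ)).mul_left ((1 / 2 : ℝ) ^ N)
    rw [← h2.tsum_eq]
    refine ((summable_nat_add_iff N).2 hs).tsum_le_tsum (fun n => ?_) h2.summable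
    refine (distTerm_le _ (supNorm_nonneg _ _)).trans_eq ?_
    ring

/-- Equality of uniformities, not only of topologies, is what lets completeness pass to the metric.
A compact set of times lies in some `[-n, n]`, where one term of the series controls the distance;
conversely `pathDist_le` leaves only a small tail. -/
theorem uniformity_eq_pathDist :
    uniformity (PathSpace m) = ⨅ ε > 0, 𝓟 {p : PathSpace m × PathSpace m | pathDist p.1 p.2 < ε} := by
  have hb : (⨅ ε > (0 : ℝ), 𝓟 {p : PathSpace m × PathSpace m | pathDist p.1 p.2 < ε}).HasBasis
      (fun ε : ℝ => 0 < ε) fun ε => {p | pathDist p.1 p.2 < ε} := by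
    refine hasBasis_biInf_principal (fun a ha b hb => ⟨min a b, show (0 : ℝ) < min a b from
      lt_min ha hb, ?_, ?_⟩) ⟨1, show (0 : ℝ) < 1 from one_pos⟩
    · exact fun p hp => lt_of_lt_of_le (show pathDist p.1 p.2 < min a b from hp) (min_le_left _ _)
    · exact fun p hp => lt_of_lt_of_le (show pathDist p.1 p.2 < min a b from hp) (min_le_right _ _)
  refine ((Metric.uniformity_basis_dist (α := Cm m)).compactConvergenceUniformity
    (α := ℝ)).ext hb ?_ ?_
  · rintro ⟨K, ε⟩ ⟨hK, hε⟩
    obtain ⟨R, hR⟩ := hK.isBounded.subset_closedBall 0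
    obtain ⟨n, hn⟩ := exists_nat_ge R
    -- The term with index `n` looks at `[-(n + 1), n + 1]`, which contains the ball of radius `R ≤
    -- n`.
    refine ⟨distTerm n ε, ?_, fun p hp t ht => ?_⟩
    · unfold distTerm
      positivity
    · have h1 := supNorm_lt_of_pathDist_lt hε hp
      refine lt_of_le_of_lt ?_ h1
      rw [dist_eq_norm]
      refine norm_le_supNorm (t := t) ?_ (p.1 - p.2)
      have := hR ht
      rw [Metric.mem_closedBall, Real.dist_eq, sub_zero, abs_le] at this
      exact ⟨by linarith, by linarith⟩
  · intro ε hε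
    obtain ⟨N, hN⟩ := exists_pow_lt_of_lt_one (half_pos hε) (by norm_num : (1 / 2 : ℝ) < 1)
    refine ⟨(Set.Icc (-(N : ℝ)) N, ε / 2), ⟨isCompact_Icc, half_pos hε⟩, fun p hp => ?_⟩
    change pathDist p.1 p.2 < ε
    refine (pathDist_le (N := N) (half_pos hε).le fun t ht => ?_).trans_lt (by linarith)
    rw [← dist_eq_norm]
    exact (hp t ht).le

/-- The metric `pathDist` of the path space, with the uniformity of compact convergence. -/
@[reducible] def pathMetricSpace (m : ℕ) : MetricSpace (PathSpace m) where
  dist := pathDist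
  dist_self ψ := by simp [pathDist, supNorm]
  dist_comm ψ φ := by
    simp only [pathDist]
    refine tsum_congr fun n => ?_
    rw [← supNorm_neg, neg_sub]
  dist_triangle := pathDist_triangle
  -- Keeping the given uniformity makes the induced topology the compact-open one by definition, and
  -- its completeness is already known.
  toUniformSpace := inferInstance
  uniformity_dist := uniformity_eq_pathDist
  eq_of_dist_eq_zero {ψ φ} h := by
    ext1 t
    by_contra hne
    obtain ⟨n, hn⟩ := exists_nat_ge |t|
    have hε : 0 < ‖ψ t - φ t‖ := norm_pos_iff.2 (sub_ne_zero.2 hne)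
    have h1 : supNorm (n + 1) (ψ - φ) < ‖ψ t - φ t‖ := by
      refine supNorm_lt_of_pathDist_lt hε ?_
      change pathDist ψ φ = 0 at h
      rw [h]
      unfold distTerm
      positivity
    refine absurd (norm_le_supNorm (t := t) ?_ (ψ - φ)) (not_le.2 h1)
    have := abs_le.1 hn
    exact ⟨by linarith, by linarith⟩

theorem exists_metricSpace_pathDist (m : ℕ) :
    ∃ M : MetricSpace (PathSpace m), (∀ ψ φ, M.dist ψ φ = pathDist ψ φ) ∧
      M.toUniformSpace.toTopologicalSpace =
        (ContinuousMap.compactOpen : TopologicalSpace (PathSpace m)) ∧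
      @CompleteSpace (PathSpace m) M.toUniformSpace :=
  ⟨pathMetricSpace m, fun _ _ => rfl, rfl,
    (inferInstance : CompleteSpace (PathSpace m))⟩

end PathMetric

/-! ### The Borel sets of the path space -/

section PathBorel

variable {m : ℕ}

instance : PolishSpace (PathSpace m) := by
  have : (uniformity (PathSpace m)).IsCountablyGenerated := by
    let := pathMetricSpace m
    exact EMetric.instIsCountablyGeneratedUniformity
  infer_instance

/-- The values of a path at a dense sequence of times and points. -/
def denseEval (ψ : PathSpace m) (p : ℕ × ℕ) : ℝ :=
  ψ (TopologicalSpace.denseSeq ℝ p.1) (TopologicalSpace.denseSeq Torus p.2)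

theorem continuous_eval_apply (t : ℝ) (x : Torus) : Continuous fun ψ : PathSpace m => ψ t x :=
  (Cm.evalCLM x).continuous.comp (ContinuousEvalConst.continuous_eval_const t)

theorem continuous_denseEval : Continuous (denseEval : PathSpace m → ℕ × ℕ → ℝ) :=
  continuous_pi fun _ => continuous_eval_apply _ _

theorem denseEval_injective : Function.Injective (denseEval : PathSpace m → ℕ × ℕ → ℝ) := by
  intro ψ φ h
  have h1 (i : ℕ) : ψ (TopologicalSpace.denseSeq ℝ i) = φ (TopologicalSpace.denseSeq ℝ i) := by
    refine Subtype.ext (Continuous.ext_on (TopologicalSpace.denseRange_denseSeq Torus)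
      (Cm.continuous_coe _) (Cm.continuous_coe _) ?_)
    rintro _ ⟨j, rfl⟩
    exact congrFun h (i, j)
  refine DFunLike.coe_injective (Continuous.ext_on (TopologicalSpace.denseRange_denseSeq ℝ)
    ψ.continuous φ.continuous ?_)
  rintro _ ⟨i, rfl⟩
  exact h1 i

/-- The Lusin–Souslin theorem: an injective continuous map out of a Polish space maps Borel sets to
Borel sets. Countably many real coordinates thus generate all Borel sets of paths. -/
theorem measurableEmbedding_denseEval :
    MeasurableEmbedding (denseEval : PathSpace m → ℕ × ℕ → ℝ) :=
  continuous_denseEval.measurableEmbedding denseEval_injective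

theorem borel_pathSpace_eq_comap (m : ℕ) :
    borel (PathSpace m) =
      MeasurableSpace.comap (fun (ψ : PathSpace m) (t : ℝ) => ψ t) MeasurableSpace.pi := by
  apply le_antisymm
  · change (inferInstance : MeasurableSpace (PathSpace m)) ≤ _
    rw [← measurableEmbedding_denseEval.comap_eq]
    have h : (denseEval : PathSpace m → ℕ × ℕ → ℝ) =
        (fun (ψ : ℝ → Cm m) (p : ℕ × ℕ) => Cm.evalCLM (TopologicalSpace.denseSeq Torus p.2)
          (ψ (TopologicalSpace.denseSeq ℝ p.1))) ∘ fun (ψ : PathSpace m) (t : ℝ) => ψ t := rfl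
    rw [h, ← MeasurableSpace.comap_comp]
    refine MeasurableSpace.comap_mono (measurable_iff_comap_le.1 ?_)
    refine measurable_pi_lambda _ fun p => ?_
    exact (Cm.evalCLM _).measurable.comp (measurable_pi_apply _)
  · rw [← measurable_iff_comap_le]
    refine @measurable_pi_lambda _ _ _ (borel _) _ _ fun t => ?_
    exact (ContinuousEvalConst.continuous_eval_const (F := PathSpace m) t).measurable

theorem measurable_pathSpace_iff {S : Type*} [MeasurableSpace S] {Ψ : S → PathSpace m} :
    Measurable Ψ ↔ ∀ t, Measurable fun ω => Ψ ω t := by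
  constructor
  · intro h t
    exact (ContinuousEvalConst.continuous_eval_const (F := PathSpace m) t).measurable.comp h
  · intro h
    rw [measurable_iff_comap_le]
    change MeasurableSpace.comap Ψ (borel _) ≤ _
    rw [borel_pathSpace_eq_comap, MeasurableSpace.comap_comp, ← measurable_iff_comap_le]
    exact measurable_pi_lambda _ h

/-- No information is lost under `denseEval`, and in a product of real lines a finite measure is
fixed by the characteristic functions of its finite marginals. Finite rather than probability
measures are allowed so that restrictions to invariant sets can be compared. -/
theorem measure_ext_of_charFun_eval {P Q : Measure (PathSpace m)} [IsFiniteMeasure P]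
    [IsFiniteMeasure Q]
    (h : ∀ (F : Finset (ℕ × ℕ)) (c : ℕ × ℕ → ℝ),
      ∫ ψ, Complex.exp ((∑ p ∈ F, c p * denseEval ψ p : ℝ) * Complex.I) ∂P =
      ∫ ψ, Complex.exp ((∑ p ∈ F, c p * denseEval ψ p : ℝ) * Complex.I) ∂Q) : P = Q := by
  have hme := measurableEmbedding_denseEval (m := m)
  suffices P.map denseEval = Q.map denseEval by
    rw [← hme.comap_map P, this, hme.comap_map]
  have hm (F : Finset (ℕ × ℕ)) : (P.map denseEval).map F.restrict = (Q.map denseEval).map F.restrict := by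
    have hr : Measurable (F.restrict : (ℕ × ℕ → ℝ) → (F → ℝ)) := Finset.measurable_restrict F
    refine Measure.ext_of_charFunDual ?_
    funext L
    let c : ℕ × ℕ → ℝ := fun p => if hp : p ∈ F then L (Pi.single ⟨p, hp⟩ 1) else 0
    have hL (x : F → ℝ) : L x = ∑ p : F, c p * x p := by
      rw [← L.coe_coe, LinearMap.pi_apply_eq_sum_univ]
      refine Finset.sum_congr rfl fun p _ => ?_
      simp only [c, p.2, dif_pos, smul_eq_mul, mul_comm]
      congr 1
      refine congrArg L ?_
      funext q
      simp [Pi.single_apply, eq_comm]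
    have hP (ρ : Measure (PathSpace m)) : charFunDual ((ρ.map denseEval).map F.restrict) L =
        ∫ ψ, Complex.exp ((∑ p ∈ F, c p * denseEval ψ p : ℝ) * Complex.I) ∂ρ := by
      rw [charFunDual_apply, integral_map hr.aemeasurable (by fun_prop),
        integral_map hme.measurable.aemeasurable]
      · refine integral_congr_ae (.of_forall fun ψ => ?_)
        simp only [hL, Finset.restrict]
        rw [Finset.sum_coe_sort F (fun p => c p * denseEval ψ p)]
      · exact Measurable.aestronglyMeasurable (by fun_prop)
    rw [hP, hP, h]
  exact IsProjectiveLimit.unique (P := fun F => (Q.map denseEval).map F.restrict) (fun F => hm F)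
    (fun F => rfl)

end PathBorel

end FracField

end

noncomputable section

namespace FracField

/-! ### The pointwise ergodic theorem -/

section Birkhoff

variable {X : Type*} {T : X → X} {g : X → ℝ}

/-- `max_{1 ≤ k ≤ n + 1} ∑_{j < k} g ∘ T^j`. -/
def birkhoffMax (T : X → X) (g : X → ℝ) : ℕ → X → ℝ
  | 0 => g
  | n + 1 => fun x => g x + max 0 (birkhoffMax T g n (T x))

theorem birkhoffMax_le_succ (n : ℕ) (x : X) : birkhoffMax T g n x ≤ birkhoffMax T g (n + 1) x := by
  induction n generalizing x with
  | zero => simp [birkhoffMax]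
  | succ n ih =>
    simp only [birkhoffMax] at ih ⊢
    gcongr
    exact ih _

theorem birkhoffMax_mono (x : X) : Monotone fun n => birkhoffMax T g n x :=
  monotone_nat_of_le_succ fun n => birkhoffMax_le_succ n x

theorem birkhoffSum_le_birkhoffMax (n : ℕ) (x : X) :
    birkhoffSum T g (n + 1) x ≤ birkhoffMax T g n x := by
  induction n generalizing x with
  | zero => simp [birkhoffMax]
  | succ n ih =>
    rw [birkhoffSum_succ', birkhoffMax]
    exact add_le_add le_rfl ((ih _).trans (le_max_right _ _))

/-- The recursion for `birkhoffMax` moves boundedness between `x` and `T x` at the cost of `g x`. So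
the set where the maxima stay bounded is strictly invariant, and both the maximal inequality and
ergodicity apply to it. -/
theorem bddAbove_birkhoffMax_iff (x : X) :
    BddAbove (Set.range fun n => birkhoffMax T g n (T x)) ↔
      BddAbove (Set.range fun n => birkhoffMax T g n x) := by
  constructor
  · rintro ⟨C, hC⟩
    refine ⟨g x + max 0 C, ?_⟩
    rintro _ ⟨n, rfl⟩
    refine (birkhoffMax_le_succ n x).trans ?_
    simp only [birkhoffMax]
    gcongr
    exact hC ⟨n, rfl⟩
  · rintro ⟨C, hC⟩
    refine ⟨C - g x, ?_⟩
    rintro _ ⟨n, rfl⟩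
    have := hC ⟨n + 1, rfl⟩
    simp only [birkhoffMax] at this
    linarith [le_max_right 0 (birkhoffMax T g n (T x))]

variable [MeasurableSpace X] {P : Measure X}

theorem measurable_birkhoffMax (hT : Measurable T) (hg : Measurable g) (n : ℕ) :
    Measurable (birkhoffMax T g n) := by
  induction n with
  | zero => exact hg
  | succ n ih => exact hg.add (measurable_const.max (ih.comp hT))

theorem integrable_birkhoffMax (hT : MeasurePreserving T P P) (hg : Integrable g P) (n : ℕ) :
    Integrable (birkhoffMax T g n) P := by
  induction n with
  | zero => exact hg
  | succ n ih =>
    refine hg.add ?_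
    exact (integrable_zero X ℝ P).sup ((hT.integrable_comp ih.aestronglyMeasurable).2 ih)

theorem measurableSet_bddAbove_birkhoffMax (hT : Measurable T) (hg : Measurable g) :
    MeasurableSet {x | BddAbove (Set.range fun n => birkhoffMax T g n x)} :=
  measurableSet_bddAbove_range fun n => measurable_birkhoffMax hT hg n

/-- The recursion gives `g - min 0 (M_n ∘ T) = M_{n+1} - M_n ∘ T`, with `M_n` for `birkhoffMax T g
n`. Over the invariant set `F` the right side has nonnegative integral, since `M_n ∘ T` integrates
like `M_n ≤ M_{n+1}`. On `F` the maxima tend to infinity, so the correction disappears in the limit.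
-/
theorem setIntegral_nonneg_of_birkhoffMax_unbounded (hT : MeasurePreserving T P P)
    (hgm : Measurable g) (hg : Integrable g P) :
    0 ≤ ∫ x in {x | BddAbove (Set.range fun n => birkhoffMax T g n x)}ᶜ, g x ∂P := by
  set F := {x | BddAbove (Set.range fun n => birkhoffMax T g n x)}ᶜ with hF
  have hFm : MeasurableSet F := (measurableSet_bddAbove_birkhoffMax hT.measurable hgm).compl
  have hFT : T ⁻¹' F = F := by
    ext x
    simp only [hF, Set.mem_preimage, Set.mem_compl_iff, Set.mem_ofPred_eq, bddAbove_birkhoffMax_iff]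
  have hi := integrable_birkhoffMax hT hg
  have hiT (n : ℕ) : Integrable (fun x => birkhoffMax T g n (T x)) P :=
    (hT.integrable_comp (hi n).aestronglyMeasurable).2 (hi n)
  have hint (n : ℕ) : ∫ x in F, birkhoffMax T g n (T x) ∂P = ∫ x in F, birkhoffMax T g n x ∂P := by
    have h := hT.restrict_preimage hFm
    rw [hFT] at h
    have h2 := integral_map h.measurable.aemeasurable (f := birkhoffMax T g n)
      (by rw [h.map_eq]; exact (hi n).aestronglyMeasurable.restrict)
    rw [h.map_eq] at h2
    exact h2.symm
  have hnn (n : ℕ) : 0 ≤ ∫ x in F, (g x - min 0 (birkhoffMax T g n (T x))) ∂P := by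
    have h1 : ∀ x, g x - min 0 (birkhoffMax T g n (T x)) =
        birkhoffMax T g (n + 1) x - birkhoffMax T g n (T x) := by
      intro x
      simp only [birkhoffMax]
      linarith [min_add_max 0 (birkhoffMax T g n (T x))]
    simp only [h1]
    rw [integral_sub (hi _).integrableOn (hiT n).integrableOn, hint, sub_nonneg]
    exact integral_mono (hi _).integrableOn (hi _).integrableOn fun x => birkhoffMax_le_succ n x
  refine ge_of_tendsto' (x := atTop) ?_ hnn
  refine tendsto_integral_of_dominated_convergence
    (fun x => |g x| + |birkhoffMax T g 0 (T x)|) (fun n => ?_) ?_ (fun n => ?_) ?_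
  · exact (hg.sub ((integrable_zero X ℝ P).inf (hiT n))).aestronglyMeasurable.restrict
  · exact (hg.abs.add (hiT 0).abs).integrableOn
  · refine .of_forall fun x => ?_
    have h0 := birkhoffMax_mono (T := T) (g := g) (T x) (Nat.zero_le n)
    simp only at h0
    rw [Real.norm_eq_abs]
    refine (abs_sub _ _).trans (add_le_add le_rfl ?_)
    rw [abs_of_nonpos (min_le_left _ _)]
    rcases le_total 0 (birkhoffMax T g n (T x)) with h | h
    · rw [min_eq_left h]; simp
    · rw [min_eq_right h, abs_of_nonpos (h0.trans h)]; linarith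
  · refine (ae_restrict_mem hFm).mono fun x hx => ?_
    rw [← hFT] at hx
    have hx : ¬ BddAbove (Set.range fun n => birkhoffMax T g n (T x)) := hx
    have h1 : Tendsto (fun n => birkhoffMax T g n (T x)) atTop atTop :=
      tendsto_atTop_atTop_of_monotone (birkhoffMax_mono _) fun b => by
        by_contra! hb
        exact hx ⟨b, by rintro _ ⟨n, rfl⟩; exact (hb n).le⟩
    refine tendsto_const_nhds.congr' ?_
    filter_upwards [h1.eventually_ge_atTop 0] with n hn
    rw [min_eq_left hn, sub_zero]

/-- If the invariant set of bounded maxima were null, its complement would carry the whole negative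
integral of `g`, against the maximal inequality. -/
theorem ae_bddAbove_birkhoffSum [IsProbabilityMeasure P] (hT : MeasurePreserving T P P)
    (herg : ∀ E, MeasurableSet E → T ⁻¹' E = E → P E = 0 ∨ P E = 1)
    (hgm : Measurable g) (hg : Integrable g P) (hneg : ∫ x, g x ∂P < 0) :
    ∀ᵐ x ∂P, ∃ C, ∀ n, birkhoffSum T g n x ≤ C := by
  set B := {x | BddAbove (Set.range fun n => birkhoffMax T g n x)} with hB
  have hBm : MeasurableSet B := measurableSet_bddAbove_birkhoffMax hT.measurable hgm
  have hBT : T ⁻¹' B = B := by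
    ext x
    exact bddAbove_birkhoffMax_iff x
  have hB1 : P B = 1 := by
    refine (herg B hBm hBT).resolve_left fun h0 => ?_
    have h := setIntegral_nonneg_of_birkhoffMax_unbounded hT hgm hg
    rw [← hB, Measure.restrict_eq_self_of_ae_mem (s := Bᶜ) (compl_mem_ae_iff.2 h0)] at h
    exact absurd h (not_le.2 hneg)
  filter_upwards [(prob_compl_eq_zero_iff hBm).2 hB1 |> compl_mem_ae_iff.2] with x hx
  rw [compl_compl] at hx
  obtain ⟨C, hC⟩ := hx
  refine ⟨max 0 C, fun n => ?_⟩
  cases n with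
  | zero => simp
  | succ n => exact ((birkhoffSum_le_birkhoffMax n x).trans (hC ⟨n, rfl⟩)).trans (le_max_right _ _)

/-- Subtract a level `b'` strictly between the mean and `b`: the sums of `g - b'` stay bounded, and
the gap `b - b'` times `n` eventually absorbs the bound. -/
theorem ae_eventually_birkhoffSum_le [IsProbabilityMeasure P] (hT : MeasurePreserving T P P)
    (herg : ∀ E, MeasurableSet E → T ⁻¹' E = E → P E = 0 ∨ P E = 1)
    (hgm : Measurable g) (hg : Integrable g P) {b : ℝ} (hb : ∫ x, g x ∂P < b) :
    ∀ᵐ x ∂P, ∀ᶠ n : ℕ in atTop, birkhoffSum T g n x / n ≤ b := by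
  obtain ⟨b', hb1, hb2⟩ := exists_between hb
  have h := ae_bddAbove_birkhoffSum hT herg (g := fun x => g x - b') (hgm.sub_const b')
    (hg.sub (integrable_const b')) (by
      rw [integral_sub hg (integrable_const b')]
      simpa using hb1)
  filter_upwards [h] with x ⟨C, hC⟩
  have hev : ∀ᶠ n : ℕ in atTop, C / (b - b') ≤ n :=
    tendsto_natCast_atTop_atTop.eventually_ge_atTop _
  filter_upwards [hev, eventually_gt_atTop 0] with n hn hn0
  have hn0' : (0 : ℝ) < n := by exact_mod_cast hn0
  rw [div_le_iff₀ (sub_pos.2 hb2)] at hn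
  rw [div_le_iff₀ hn0']
  have := hC n
  simp only [birkhoffSum, Finset.sum_sub_distrib, Finset.sum_const, Finset.card_range,
    nsmul_eq_mul] at this ⊢
  nlinarith

/-- Birkhoff's ergodic theorem for an ergodic transformation. -/
theorem ae_tendsto_birkhoffSum_div [IsProbabilityMeasure P] (hT : MeasurePreserving T P P)
    (herg : ∀ E, MeasurableSet E → T ⁻¹' E = E → P E = 0 ∨ P E = 1)
    (hgm : Measurable g) (hg : Integrable g P) :
    ∀ᵐ x ∂P, Tendsto (fun n : ℕ => birkhoffSum T g n x / n) atTop (𝓝 (∫ x, g x ∂P)) := by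
  have h1 (k : ℕ) := ae_eventually_birkhoffSum_le hT herg hgm hg
    (b := ∫ x, g x ∂P + 1 / (k + 1)) (by linarith [Nat.one_div_pos_of_nat (α := ℝ) (n := k)])
  have h2 (k : ℕ) := ae_eventually_birkhoffSum_le hT herg hgm.neg hg.neg
    (b := ∫ x, (-g) x ∂P + 1 / (k + 1)) (by linarith [Nat.one_div_pos_of_nat (α := ℝ) (n := k)])
  filter_upwards [ae_all_iff.2 h1, ae_all_iff.2 h2] with x hx1 hx2
  rw [Metric.tendsto_atTop']
  intro ε hε
  obtain ⟨k, hk⟩ := exists_nat_one_div_lt hε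
  obtain ⟨N, hN⟩ := eventually_atTop.1 ((hx1 k).and (hx2 k))
  refine ⟨N, fun n hn => ?_⟩
  obtain ⟨ha, hb⟩ := hN n hn.le
  simp only [Pi.neg_apply, integral_neg] at hb
  have : birkhoffSum T (-g) n x = - birkhoffSum T g n x := by simp [birkhoffSum]
  rw [this, neg_div] at hb
  rw [Real.dist_eq, abs_lt]
  constructor <;> linarith

/-- Convergence of time averages along the integers implies convergence along the reals, provided
that the time averages of the absolute value converge as well. -/
theorem tendsto_timeAverage {h : ℝ → ℝ} (hi : ∀ T, 0 ≤ T → IntervalIntegrable h volume 0 T)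
    {L L' : ℝ} (h1 : Tendsto (fun n : ℕ => (∫ t in (0 : ℝ)..n, h t) / n) atTop (𝓝 L))
    (h2 : Tendsto (fun n : ℕ => (∫ t in (0 : ℝ)..n, |h t|) / n) atTop (𝓝 L')) :
    Tendsto (fun T : ℝ => 1 / T * ∫ t in (0 : ℝ)..T, h t) atTop (𝓝 L) := by
  set I : ℝ → ℝ := fun T => ∫ t in (0 : ℝ)..T, h t with hI
  set G : ℝ → ℝ := fun T => ∫ t in (0 : ℝ)..T, |h t| with hG
  have hii {a b : ℝ} (ha : 0 ≤ a) (hb : 0 ≤ b) : IntervalIntegrable h volume a b :=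
    (hi a ha).symm.trans (hi b hb)
  have hfl := tendsto_nat_floor_atTop (α := ℝ)
  have hratio : Tendsto (fun T : ℝ => (⌊T⌋₊ : ℝ) / T) atTop (𝓝 1) := tendsto_nat_floor_div_atTop
  -- The integral of `|h|` over `[n, n + 1]` is `o(n)`, being the difference of two averages with
  -- the same limit. It dominates the part of the integral between `⌊T⌋₊` and `T`.
  have hdiff : Tendsto (fun n : ℕ => (G (n + 1 : ℕ) - G n) / n) atTop (𝓝 0) := by
    have h3 : Tendsto (fun n : ℕ => G (n + 1 : ℕ) / (n + 1 : ℕ) * ((n + 1 : ℕ) / n)) atTop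
        (𝓝 (L' * 1)) := by
      refine ((tendsto_add_atTop_iff_nat 1).2 h2).mul ?_
      have := (tendsto_const_nhds (x := (1 : ℝ))).add (tendsto_one_div_atTop_nhds_zero_nat (𝕜 := ℝ))
      rw [add_zero] at this
      refine this.congr' ?_
      filter_upwards [eventually_gt_atTop 0] with n hn
      have : (n : ℝ) ≠ 0 := by positivity
      push_cast
      field_simp
    have h4 := h3.sub h2
    rw [mul_one, sub_self] at h4
    refine h4.congr' ?_
    filter_upwards [eventually_gt_atTop 0] with n hn
    have h5 : (n : ℝ) ≠ 0 := by positivity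
    have h6 : ((n + 1 : ℕ) : ℝ) ≠ 0 := by positivity
    change G (n + 1 : ℕ) / (n + 1 : ℕ) * ((n + 1 : ℕ) / n) - G n / n = _
    field_simp
  have hmain : Tendsto (fun T : ℝ => (⌊T⌋₊ : ℝ) / T * (I ⌊T⌋₊ / ⌊T⌋₊)) atTop (𝓝 (1 * L)) :=
    hratio.mul (h1.comp hfl)
  have herr : Tendsto (fun T : ℝ => (⌊T⌋₊ : ℝ) / T * ((G (⌊T⌋₊ + 1 : ℕ) - G ⌊T⌋₊) / ⌊T⌋₊)) atTop
      (𝓝 (1 * 0)) := hratio.mul (hdiff.comp hfl)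
  rw [one_mul] at hmain
  rw [mul_zero] at herr
  have hrem : Tendsto (fun T : ℝ => 1 / T * (I T - I ⌊T⌋₊)) atTop (𝓝 0) := by
    refine squeeze_zero_norm' ?_ herr
    filter_upwards [eventually_ge_atTop 1] with T hT
    have hT0 : 0 < T := by linarith
    have hf0 : (0 : ℝ) < ⌊T⌋₊ := by exact_mod_cast Nat.floor_pos.2 hT
    have hle := Nat.floor_le hT0.le
    have hlt := (Nat.lt_floor_add_one T).le
    have e1 : I T - I ⌊T⌋₊ = ∫ t in (⌊T⌋₊ : ℝ)..T, h t :=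
      intervalIntegral.integral_interval_sub_left (hi _ hT0.le) (hi _ hf0.le)
    have e2 : G (⌊T⌋₊ + 1 : ℕ) - G ⌊T⌋₊ = ∫ t in (⌊T⌋₊ : ℝ)..(⌊T⌋₊ + 1 : ℕ), |h t| :=
      intervalIntegral.integral_interval_sub_left (hi _ (by positivity)).abs (hi _ hf0.le).abs
    have e3 : |I T - I ⌊T⌋₊| ≤ G (⌊T⌋₊ + 1 : ℕ) - G ⌊T⌋₊ := by
      rw [e1, e2]
      refine (intervalIntegral.abs_integral_le_integral_abs hle).trans ?_
      refine intervalIntegral.integral_mono_interval le_rfl hle (by exact_mod_cast hlt)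
        (.of_forall fun _ => abs_nonneg _) (hii hf0.le (by positivity)).abs
    rw [Real.norm_eq_abs, abs_mul, abs_of_pos (by positivity : 0 < 1 / T)]
    calc 1 / T * |I T - I ⌊T⌋₊| ≤ 1 / T * (G (⌊T⌋₊ + 1 : ℕ) - G ⌊T⌋₊) := by gcongr
      _ = _ := by field_simp
  have := hmain.add hrem
  rw [add_zero] at this
  refine this.congr' ?_
  filter_upwards [eventually_ge_atTop 1] with T hT
  have hf0 : (0 : ℝ) < ⌊T⌋₊ := by exact_mod_cast Nat.floor_pos.2 hT
  field_simp
  ring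

end Birkhoff

end FracField

end

noncomputable section

namespace FracField

/-! ### Kolmogorov's continuity theorem -/

section Kolmogorov

/-- The tent function. -/
def tent (x : ℝ) : ℝ := max 0 (1 - |x|)

theorem continuous_tent : Continuous tent := by unfold tent; fun_prop

variable {E : Type*} [NormedAddCommGroup E]

theorem exists_continuousMap_tendsto_of_geometric [CompleteSpace E] {F : ℕ → ℝ → E}
    (hF : ∀ N, Continuous (F N)) {K r : ℝ} (hr0 : 0 ≤ r) (hr1 : r < 1)
    (h : ∀ M N : ℕ, M + 2 ≤ N → ∀ t : ℝ, |t| ≤ M → ‖F (N + 1) t - F N t‖ ≤ K * r ^ N) :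
    ∃ f : C(ℝ, E), ∀ t, Tendsto (fun N => F N t) atTop (𝓝 (f t)) := by
  have hstep (M N : ℕ) (t : ℝ) (ht : |t| ≤ M) :
      dist (F (N + (M + 2)) t) (F (N + 1 + (M + 2)) t) ≤ K * r ^ (M + 2) * r ^ N := by
    rw [dist_comm, dist_eq_norm, show N + 1 + (M + 2) = N + (M + 2) + 1 by ring]
    refine (h M _ (by omega) t ht).trans_eq ?_
    ring
  have hlim (t : ℝ) : ∃ z, Tendsto (fun N => F N t) atTop (𝓝 z) := by
    obtain ⟨M, hM⟩ := exists_nat_ge |t|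
    obtain ⟨z, hz⟩ := cauchySeq_tendsto_of_complete
      (cauchySeq_of_le_geometric r _ hr1 fun N => hstep M N t hM)
    exact ⟨z, (tendsto_add_atTop_iff_nat (f := fun N => F N t) (M + 2)).1 hz⟩
  choose f hf using hlim
  have hloc (M : ℕ) : TendstoUniformlyOn (fun N => F (N + (M + 2))) f atTop
      (Set.Ioo (-M : ℝ) M) := by
    rw [Metric.tendstoUniformlyOn_iff]
    intro ε hε
    have h0 : Tendsto (fun N => K * r ^ (M + 2) * r ^ N / (1 - r)) atTop (𝓝 0) := by
      have := ((tendsto_pow_atTop_nhds_zero_of_lt_one hr0 hr1).const_mul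
        (K * r ^ (M + 2))).div_const (1 - r)
      rwa [mul_zero, zero_div] at this
    filter_upwards [h0.eventually_lt_const hε] with N hN t ht
    rw [dist_comm]
    have ht' : |t| ≤ M := abs_le.2 ⟨ht.1.le, ht.2.le⟩
    exact (dist_le_of_le_geometric_of_tendsto r _ hr1 (fun N => hstep M N t ht')
      ((tendsto_add_atTop_iff_nat (f := fun N => F N t) (M + 2)).2 (hf t)) N).trans_lt hN
  refine ⟨⟨f, continuous_iff_continuousAt.2 fun t => ?_⟩, hf⟩
  obtain ⟨M, hM⟩ := exists_nat_gt |t|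
  have hmem : Set.Ioo (-M : ℝ) M ∈ 𝓝 t := Ioo_mem_nhds (abs_lt.1 hM).1 (abs_lt.1 hM).2
  exact ((hloc M).continuousOn (Frequently.of_forall fun N =>
    (hF _).continuousOn)).continuousAt hmem

/-- A single increment is bounded by the whole sum, so the weight `2 ^ N` forces its `q`-th power to
be at most a constant times `2 ^ (-N)`: decay of the sum becomes geometric decay at rate `2 ^
(-1/q)`. -/
theorem exists_forall_norm_le_of_summable {q : ℕ} (hq : q ≠ 0) {y : ℕ → ℤ → E}
    (h : ∑' N : ℕ, (2 : ENNReal) ^ N * ∑ k ∈ Finset.Icc (-4 ^ N : ℤ) (4 ^ N),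
      ‖y N (k + 1) - y N k‖ₑ ^ q < ⊤) :
    ∃ A, ∀ N, ∀ k ∈ Finset.Icc (-4 ^ N : ℤ) (4 ^ N),
      ‖y N (k + 1) - y N k‖ ≤ A * ((1 / 2 : ℝ) ^ (1 / q : ℝ)) ^ N := by
  set Z := ∑' N : ℕ, (2 : ENNReal) ^ N * ∑ k ∈ Finset.Icc (-4 ^ N : ℤ) (4 ^ N),
      ‖y N (k + 1) - y N k‖ₑ ^ q
  refine ⟨Z.toReal ^ (1 / q : ℝ), fun N k hk => ?_⟩
  have h1 : (2 : ENNReal) ^ N * ‖y N (k + 1) - y N k‖ₑ ^ q ≤ Z := by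
    refine le_trans ?_ (ENNReal.le_tsum N)
    gcongr
    exact Finset.single_le_sum (f := fun k => ‖y N (k + 1) - y N k‖ₑ ^ q)
      (fun _ _ => zero_le) hk
  have h2 := ENNReal.toReal_mono h.ne h1
  rw [ENNReal.toReal_mul, ENNReal.toReal_pow, ENNReal.toReal_pow, toReal_enorm] at h2
  have h3 : ‖y N (k + 1) - y N k‖ ^ q ≤ Z.toReal * (1 / 2) ^ N := by
    rw [one_div_pow, mul_one_div, le_div_iff₀ (by positivity), mul_comm]
    simpa using h2
  calc ‖y N (k + 1) - y N k‖ = (‖y N (k + 1) - y N k‖ ^ q) ^ (1 / q : ℝ) := by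
        rw [one_div, Real.pow_rpow_inv_natCast (norm_nonneg _) hq]
    _ ≤ (Z.toReal * (1 / 2) ^ N) ^ (1 / q : ℝ) := by gcongr
    _ = _ := by
        rw [Real.mul_rpow ENNReal.toReal_nonneg (by positivity), Real.rpow_pow_comm (by norm_num)]

variable [NormedSpace ℝ E]

theorem sum_tent_smul (y : ℤ → E) (R : ℤ) (s : ℝ) (h1 : -R ≤ ⌊s⌋) (h2 : ⌊s⌋ + 1 ≤ R) :
    ∑ k ∈ Finset.Icc (-R) R, tent (s - k) • y k =
      (1 - Int.fract s) • y ⌊s⌋ + Int.fract s • y (⌊s⌋ + 1) := by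
  have hf0 := Int.fract_nonneg s
  have hf1 := Int.fract_lt_one s
  have hs := Int.floor_add_fract s
  have hsub : ({⌊s⌋, ⌊s⌋ + 1} : Finset ℤ) ⊆ Finset.Icc (-R) R := by
    intro k hk
    simp only [Finset.mem_insert, Finset.mem_singleton] at hk
    rw [Finset.mem_Icc]
    omega
  rw [← Finset.sum_subset hsub, Finset.sum_pair (by omega)]
  · congr 2
    · rw [tent, show s - (⌊s⌋ : ℝ) = Int.fract s from rfl, abs_of_nonneg hf0,
        max_eq_right (by linarith)]
    · rw [tent, show s - ((⌊s⌋ + 1 : ℤ) : ℝ) = Int.fract s - 1 by push_cast; linarith,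
        abs_of_nonpos (by linarith), max_eq_right (by linarith)]
      ring
  · intro k _ hk
    simp only [Finset.mem_insert, Finset.mem_singleton, not_or] at hk
    rw [tent, max_eq_left, zero_smul]
    rcases lt_or_ge k ⌊s⌋ with h | h
    · have : (k : ℝ) + 1 ≤ ⌊s⌋ := by exact_mod_cast h
      linarith [le_abs_self (s - k)]
    · have h3 : ⌊s⌋ + 2 ≤ k := by omega
      have : (⌊s⌋ : ℝ) + 2 ≤ k := by exact_mod_cast h3
      linarith [neg_abs_le (s - k)]

/-- Halving the mesh moves the piecewise linear interpolation by `c` times the second difference of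
`y` at the midpoint, with `c = f` on the left half and `c = 1 - f` on the right half, where `f` is
the fractional part of `s`. -/
theorem norm_interpolation_sub_le (y : ℤ → E) (s : ℝ) :
    ‖((1 - Int.fract (2 * s)) • y ⌊2 * s⌋ + Int.fract (2 * s) • y (⌊2 * s⌋ + 1)) -
      ((1 - Int.fract s) • y (2 * ⌊s⌋) + Int.fract s • y (2 * (⌊s⌋ + 1)))‖ ≤
      ‖y (2 * ⌊s⌋ + 1) - y (2 * ⌊s⌋)‖ + ‖y (2 * ⌊s⌋ + 1 + 1) - y (2 * ⌊s⌋ + 1)‖ := by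
  have hf0 := Int.fract_nonneg s
  have hf1 := Int.fract_lt_one s
  have hs := Int.floor_add_fract s
  set f := Int.fract s
  set k := ⌊s⌋
  have e2 : 2 * (k + 1) = 2 * k + 1 + 1 := by ring
  rw [e2]
  have hbound (c : ℝ) (hc0 : 0 ≤ c) (hc1 : c ≤ 1) :
      ‖c • ((y (2 * k + 1) - y (2 * k)) - (y (2 * k + 1 + 1) - y (2 * k + 1)))‖ ≤
        ‖y (2 * k + 1) - y (2 * k)‖ + ‖y (2 * k + 1 + 1) - y (2 * k + 1)‖ := by
    rw [norm_smul, Real.norm_of_nonneg hc0]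
    exact (mul_le_of_le_one_left (norm_nonneg _) hc1).trans (norm_sub_le _ _)
  rcases lt_or_ge f (1 / 2) with h | h
  · have hfl : ⌊2 * s⌋ = 2 * k := by
      rw [Int.floor_eq_iff]
      push_cast
      constructor <;> linarith
    have hfr : Int.fract (2 * s) = 2 * f := by
      rw [Int.fract, hfl]
      push_cast
      linarith
    rw [hfl, hfr]
    convert hbound f hf0 hf1.le using 2
    module
  · have hfl : ⌊2 * s⌋ = 2 * k + 1 := by
      rw [Int.floor_eq_iff]
      push_cast
      constructor <;> linarith
    have hfr : Int.fract (2 * s) = 2 * f - 1 := by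
      rw [Int.fract, hfl]
      push_cast
      linarith
    rw [hfl, hfr]
    convert hbound (1 - f) (by linarith) (by linarith) using 2
    module

/-- Piecewise linear interpolation of `y` at the points `k / 2 ^ N` with `|k| ≤ 4 ^ N`. -/
def dyadicInterpolation (N : ℕ) (y : ℤ → E) (t : ℝ) : E :=
  ∑ k ∈ Finset.Icc (-4 ^ N : ℤ) (4 ^ N), tent (2 ^ N * t - k) • y k

theorem continuous_dyadicInterpolation (N : ℕ) (y : ℤ → E) :
    Continuous (dyadicInterpolation N y) := by
  refine continuous_finsetSum _ fun k _ => ?_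
  exact (continuous_tent.comp (by fun_prop)).smul continuous_const

/-- With `|k| ≤ 4 ^ N` and mesh `2 ^ (-N)` the grid covers `[-2 ^ N, 2 ^ N]`, so from level `M + 2`
on it contains both neighbours of every `t` with `|t| ≤ M`. -/
theorem floor_bounds {N M : ℕ} (hN : M + 2 ≤ N) {t : ℝ} (ht : |t| ≤ M) :
    -(4 : ℤ) ^ N ≤ ⌊(2 : ℝ) ^ N * t⌋ ∧ ⌊(2 : ℝ) ^ N * t⌋ + 1 ≤ 4 ^ N := by
  have h1 : (M : ℝ) + 2 ≤ 2 ^ N := by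
    have : N < 2 ^ N := Nat.lt_two_pow_self
    exact_mod_cast (hN.trans this.le)
  have h2 : (4 : ℝ) ^ N = 2 ^ N * 2 ^ N := by rw [← mul_pow]; norm_num
  have h3 : (1 : ℝ) ≤ 2 ^ N := one_le_pow₀ (by norm_num)
  obtain ⟨ha, hb⟩ := abs_le.1 ht
  constructor
  · rw [Int.le_floor]
    push_cast
    nlinarith
  · have : (⌊(2 : ℝ) ^ N * t⌋ : ℝ) ≤ 2 ^ N * t := Int.floor_le _
    have : (⌊(2 : ℝ) ^ N * t⌋ : ℝ) + 1 ≤ 4 ^ N := by nlinarith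
    exact_mod_cast this

theorem dyadicInterpolation_eq {N M : ℕ} (hN : M + 2 ≤ N) {t : ℝ} (ht : |t| ≤ M) (y : ℤ → E) :
    dyadicInterpolation N y t = (1 - Int.fract (2 ^ N * t)) • y ⌊(2 : ℝ) ^ N * t⌋ +
      Int.fract (2 ^ N * t) • y (⌊(2 : ℝ) ^ N * t⌋ + 1) :=
  sum_tent_smul y (4 ^ N) _ (floor_bounds hN ht).1 (floor_bounds hN ht).2

theorem norm_dyadicInterpolation_succ_sub_le {y : ℕ → ℤ → E} (hy : ∀ N k, y N k = y (N + 1) (2 * k))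
    {A r : ℝ} (hA : ∀ N, ∀ k ∈ Finset.Icc (-4 ^ N : ℤ) (4 ^ N), ‖y N (k + 1) - y N k‖ ≤ A * r ^ N)
    {N M : ℕ} (hN : M + 2 ≤ N) {t : ℝ} (ht : |t| ≤ M) :
    ‖dyadicInterpolation (N + 1) (y (N + 1)) t - dyadicInterpolation N (y N) t‖ ≤
      2 * (A * r ^ (N + 1)) := by
  rw [dyadicInterpolation_eq hN ht (y N),
    dyadicInterpolation_eq (hN.trans (Nat.le_succ N)) ht (y (N + 1)), hy N, hy N,
    show (2 : ℝ) ^ (N + 1) * t = 2 * (2 ^ N * t) by ring]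
  refine (norm_interpolation_sub_le _ _).trans ?_
  obtain ⟨h1, h2⟩ := floor_bounds hN ht
  have h4 : (4 : ℤ) ^ (N + 1) = 4 * 4 ^ N := by ring
  have h5 : (0 : ℤ) < 4 ^ N := by positivity
  have e1 := hA (N + 1) (2 * ⌊(2 : ℝ) ^ N * t⌋) (by rw [Finset.mem_Icc]; omega)
  have e2 := hA (N + 1) (2 * ⌊(2 : ℝ) ^ N * t⌋ + 1) (by rw [Finset.mem_Icc]; omega)
  linarith

theorem exists_continuousMap_tendsto_dyadicInterpolation [CompleteSpace E] {y : ℕ → ℤ → E}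
    (hy : ∀ N k, y N k = y (N + 1) (2 * k)) {A r : ℝ} (hr0 : 0 ≤ r) (hr1 : r < 1)
    (hA : ∀ N, ∀ k ∈ Finset.Icc (-4 ^ N : ℤ) (4 ^ N), ‖y N (k + 1) - y N k‖ ≤ A * r ^ N) :
    ∃ f : C(ℝ, E), ∀ t, Tendsto (fun N => dyadicInterpolation N (y N) t) atTop (𝓝 (f t)) :=
  exists_continuousMap_tendsto_of_geometric (K := 2 * A * r)
    (F := fun N => dyadicInterpolation N (y N))
    (fun N => continuous_dyadicInterpolation N (y N)) hr0 hr1 fun M N hN t ht =>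
      (norm_dyadicInterpolation_succ_sub_le hy hA hN ht).trans_eq (by ring)

variable [CompleteSpace E] [MeasurableSpace E] [BorelSpace E] [SecondCountableTopology E]
  {S : Type*} [MeasurableSpace S] {μ : Measure S}

/-- Kolmogorov's continuity theorem for a Hölder continuous curve in `L^q`. -/
theorem exists_continuous_version [IsProbabilityMeasure μ] {q : ℕ} (hq : q ≠ 0)
    [Fact (1 ≤ (q : ENNReal))] (X : ℝ → Lp E q μ) {C δ : ℝ} (hC : 0 ≤ C) (hδ : 0 < δ)
    (hδq : 4 ≤ δ * q) (hX : ∀ s t, ‖X t - X s‖ ≤ C * |t - s| ^ δ) :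
    ∃ Ψ : S → C(ℝ, E), (∀ t, Measurable fun ω => Ψ ω t) ∧ ∀ t, ∀ᵐ ω ∂μ, Ψ ω t = X t ω := by
  set y : S → ℕ → ℤ → E := fun ω N k => X (k / 2 ^ N) ω with hydef
  have hym (N : ℕ) (k : ℤ) : Measurable fun ω => y ω N k := (Lp.stronglyMeasurable _).measurable
  have hy (ω : S) (N : ℕ) (k : ℤ) : y ω N k = y ω (N + 1) (2 * k) := by
    simp only [hydef]
    congr 2
    push_cast
    rw [pow_succ]
    field_simp
  -- The reason for `4 ≤ δ * q`: an increment at level `N` has `q`-th moment at most `C ^ q * 2 ^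
  -- (-4N)`, there are `2 * 4 ^ N + 1` of them, and with the weight `2 ^ N` level `N` contributes at
  -- most `3 * C ^ q * 2 ^ (-N)`. So `Z` has finite expectation.
  set Z : S → ENNReal := fun ω => ∑' N : ℕ, (2 : ENNReal) ^ N *
    ∑ k ∈ Finset.Icc (-4 ^ N : ℤ) (4 ^ N), ‖y ω N (k + 1) - y ω N k‖ₑ ^ q with hZdef
  have hterm (N : ℕ) (k : ℤ) : Measurable fun ω => ‖y ω N (k + 1) - y ω N k‖ₑ ^ q :=
    ((hym N (k + 1)).sub (hym N k)).enorm.pow_const q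
  have hlev (N : ℕ) : Measurable fun ω => (2 : ENNReal) ^ N *
      ∑ k ∈ Finset.Icc (-4 ^ N : ℤ) (4 ^ N), ‖y ω N (k + 1) - y ω N k‖ₑ ^ q :=
    (Finset.measurable_sum _ fun k _ => hterm N k).const_mul _
  have hZm : Measurable Z := Measurable.tsum hlev
  have hmom (N : ℕ) (k : ℤ) : ∫⁻ ω, ‖y ω N (k + 1) - y ω N k‖ₑ ^ q ∂μ ≤
      ENNReal.ofReal (C ^ q * (1 / 2) ^ (4 * N)) := by
    have h1 : ∫⁻ ω, ‖y ω N (k + 1) - y ω N k‖ₑ ^ q ∂μ =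
        ENNReal.ofReal (‖X ((k + 1 : ℤ) / 2 ^ N) - X (k / 2 ^ N)‖ ^ q) := by
      rw [ENNReal.ofReal_pow (norm_nonneg _), ofReal_norm, Lp.enorm_def,
        eLpNorm_congr_ae (Lp.coeFn_sub _ _),
        eLpNorm_eq_lintegral_rpow_enorm_toReal (by exact_mod_cast hq) (by simp)]
      simp only [ENNReal.toReal_natCast, ENNReal.rpow_natCast]
      rw [one_div, ENNReal.rpow_inv_natCast_pow hq]
      rfl
    rw [h1]
    refine ENNReal.ofReal_le_ofReal ?_
    calc ‖X ((k + 1 : ℤ) / 2 ^ N) - X (k / 2 ^ N)‖ ^ q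
        ≤ (C * |((k + 1 : ℤ) / 2 ^ N : ℝ) - k / 2 ^ N| ^ δ) ^ q := by
          gcongr
          exact hX _ _
      _ = C ^ q * ((1 / 2 : ℝ) ^ N) ^ (δ * q) := by
          rw [mul_pow, Real.rpow_mul (by positivity), Real.rpow_natCast]
          congr 3
          rw [← sub_div]
          push_cast
          rw [add_sub_cancel_left, abs_of_pos (by positivity), one_div_pow]
      _ ≤ C ^ q * ((1 / 2 : ℝ) ^ N) ^ (4 : ℝ) := by
          gcongr 1
          exact Real.rpow_le_rpow_of_exponent_ge (by positivity)
            (pow_le_one₀ (by norm_num) (by norm_num)) hδq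
      _ = C ^ q * (1 / 2) ^ (4 * N) := by
          rw [show (4 : ℝ) = (4 : ℕ) by norm_num, Real.rpow_natCast, ← pow_mul, mul_comm N]
  have hZfin : ∫⁻ ω, Z ω ∂μ < ⊤ := by
    simp only [hZdef]
    rw [lintegral_tsum fun N => (hlev N).aemeasurable]
    have hb (N : ℕ) : ∫⁻ ω, (2 : ENNReal) ^ N * ∑ k ∈ Finset.Icc (-4 ^ N : ℤ) (4 ^ N),
        ‖y ω N (k + 1) - y ω N k‖ₑ ^ q ∂μ ≤ ENNReal.ofReal (3 * C ^ q * (1 / 2) ^ N) := by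
      rw [lintegral_const_mul _ (Finset.measurable_sum _ fun k _ => hterm N k),
        lintegral_finsetSum _ fun k _ => hterm N k]
      calc (2 : ENNReal) ^ N * ∑ k ∈ Finset.Icc (-4 ^ N : ℤ) (4 ^ N),
            ∫⁻ ω, ‖y ω N (k + 1) - y ω N k‖ₑ ^ q ∂μ
          ≤ (2 : ENNReal) ^ N * ((Finset.Icc (-4 ^ N : ℤ) (4 ^ N)).card •
              ENNReal.ofReal (C ^ q * (1 / 2) ^ (4 * N))) := by
            gcongr
            exact Finset.sum_le_card_nsmul _ _ _ fun k _ => hmom N k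
        _ = ENNReal.ofReal (2 ^ N * (2 * 4 ^ N + 1) * (C ^ q * (1 / 2) ^ (4 * N))) := by
            have hc : (Finset.Icc (-4 ^ N : ℤ) (4 ^ N)).card = 2 * 4 ^ N + 1 := by
              rw [Int.card_Icc]
              have : (4 ^ N + 1 - -4 ^ N : ℤ) = ((2 * 4 ^ N + 1 : ℕ) : ℤ) := by push_cast; ring
              rw [this, Int.toNat_natCast]
            rw [hc, nsmul_eq_mul, mul_assoc, ENNReal.ofReal_mul (p := 2 ^ N) (by positivity),
              ENNReal.ofReal_mul (p := 2 * 4 ^ N + 1) (by positivity)]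
            congr 2
            · rw [ENNReal.ofReal_pow (by norm_num)]; simp
            · rw [← ENNReal.ofReal_natCast]; push_cast; rfl
        _ ≤ _ := by
            refine ENNReal.ofReal_le_ofReal ?_
            have e1 : (1 / 2 : ℝ) ^ (4 * N) = (1 / 2) ^ N * (1 / 2) ^ N * ((1 / 4) ^ N) := by
              rw [pow_mul, ← mul_pow, ← mul_pow]; norm_num
            have e2 : (2 : ℝ) ^ N * (1 / 2) ^ N = 1 := by rw [← mul_pow]; norm_num
            have e3 : (4 : ℝ) ^ N * (1 / 4) ^ N = 1 := by rw [← mul_pow]; norm_num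
            have e4 : (1 / 4 : ℝ) ^ N ≤ 1 := pow_le_one₀ (by norm_num) (by norm_num)
            rw [e1]
            calc (2 : ℝ) ^ N * (2 * 4 ^ N + 1) * (C ^ q * ((1 / 2) ^ N * (1 / 2) ^ N * (1 / 4) ^ N))
                = (2 ^ N * (1 / 2) ^ N) * (2 * (4 ^ N * (1 / 4) ^ N) + (1 / 4) ^ N) *
                    (C ^ q * (1 / 2) ^ N) := by ring
              _ ≤ 1 * 3 * (C ^ q * (1 / 2) ^ N) := by
                  rw [e2, e3]
                  gcongr
                  linarith
              _ = _ := by ring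
    refine (ENNReal.tsum_le_tsum hb).trans_lt ?_
    rw [← ENNReal.ofReal_tsum_of_nonneg (fun N => by positivity)
      (summable_geometric_two.mul_left _)]
    exact ENNReal.ofReal_lt_top
  have hgood : MeasurableSet {ω | Z ω < ⊤} := measurableSet_lt hZm measurable_const
  have hq0 : (0 : ℝ) < 1 / q := by positivity
  -- On the null set where `Z` is infinite the path is set to zero, so that every path is
  -- continuous.
  have hex (ω : S) : ∃ f : C(ℝ, E), (Z ω < ⊤ → ∀ t,
      Tendsto (fun N => dyadicInterpolation N (y ω N) t) atTop (𝓝 (f t))) ∧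
      (¬ Z ω < ⊤ → f = 0) := by
    by_cases hω : Z ω < ⊤
    · obtain ⟨A, hA⟩ := exists_forall_norm_le_of_summable hq hω
      obtain ⟨f, hf⟩ := exists_continuousMap_tendsto_dyadicInterpolation (hy ω) (by positivity)
        (Real.rpow_lt_one (by norm_num) (by norm_num) hq0) hA
      exact ⟨f, fun _ => hf, fun h => absurd hω h⟩
    · exact ⟨0, fun h => absurd h hω, fun _ => rfl⟩
  choose Ψ hΨ hΨ0 using hex
  have hLm (N : ℕ) (t : ℝ) : Measurable fun ω => dyadicInterpolation N (y ω N) t :=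
    Finset.measurable_sum _ fun k _ => (hym N k).const_smul _
  refine ⟨Ψ, fun t => ?_, fun t => ?_⟩
  · refine measurable_of_tendsto_metrizable (fun N => (hLm N t).indicator hgood)
      (tendsto_pi_nhds.2 fun ω => ?_)
    by_cases hω : Z ω < ⊤
    · have : ω ∈ {ω | Z ω < ⊤} := hω
      simpa only [Set.indicator_of_mem this] using hΨ ω hω t
    · have : ω ∉ {ω | Z ω < ⊤} := hω
      simp only [Set.indicator_of_notMem this, hΨ0 ω hω, ContinuousMap.zero_apply]
      exact tendsto_const_nhds
  -- The same interpolation carried out in `L^q` converges to `X t`; a subsequence converges almost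
  -- everywhere, and there its limit must be the pathwise one.
  · set D : ℕ → Lp E q μ := fun N => dyadicInterpolation N (fun k => X (k / 2 ^ N)) t with hD
    have hDlim : Tendsto D atTop (𝓝 (X t)) := by
      rw [tendsto_iff_norm_sub_tendsto_zero]
      have h0 : Tendsto (fun N : ℕ => C * ((1 / 2 : ℝ) ^ N) ^ δ) atTop (𝓝 0) := by
        have := ((tendsto_pow_atTop_nhds_zero_of_lt_one (by norm_num)
          (by norm_num : (1 / 2 : ℝ) < 1)).rpow_const (Or.inr hδ.le)).const_mul C
        simpa [Real.zero_rpow hδ.ne'] using this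
      refine squeeze_zero' (.of_forall fun _ => norm_nonneg _) ?_ h0
      obtain ⟨M, hM⟩ := exists_nat_ge |t|
      filter_upwards [eventually_ge_atTop (M + 2)] with N hN
      simp only [hD]
      rw [dyadicInterpolation_eq hN hM]
      have hf0 := Int.fract_nonneg ((2 : ℝ) ^ N * t)
      have hf1 := Int.fract_lt_one ((2 : ℝ) ^ N * t)
      have hs := Int.floor_add_fract ((2 : ℝ) ^ N * t)
      set f := Int.fract ((2 : ℝ) ^ N * t)
      set k := ⌊(2 : ℝ) ^ N * t⌋
      have h2 : (0 : ℝ) < 2 ^ N := by positivity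
      have hnear (j : ℤ) (hj : |(j : ℝ) - 2 ^ N * t| ≤ 1) :
          ‖X (j / 2 ^ N) - X t‖ ≤ C * ((1 / 2 : ℝ) ^ N) ^ δ := by
        refine (hX _ _).trans ?_
        gcongr
        rw [one_div_pow, div_sub' h2.ne', abs_div, abs_of_pos h2]
        gcongr
      have e : (1 - f) • X (k / 2 ^ N) + f • X ((k + 1 : ℤ) / 2 ^ N) - X t =
          (1 - f) • (X (k / 2 ^ N) - X t) + f • (X ((k + 1 : ℤ) / 2 ^ N) - X t) := by module
      rw [e]
      refine (norm_add_le _ _).trans ?_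
      rw [norm_smul, norm_smul, Real.norm_of_nonneg hf0, Real.norm_of_nonneg (by linarith)]
      have n1 := hnear k (by rw [abs_le]; constructor <;> linarith)
      have n2 := hnear (k + 1) (by push_cast; rw [abs_le]; constructor <;> linarith)
      nlinarith
    have hDae (N : ℕ) : D N =ᵐ[μ] fun ω => dyadicInterpolation N (y ω N) t := by
      have h1 := Lp.coeFn_fun_finsetSum (Finset.Icc (-4 ^ N : ℤ) (4 ^ N))
        (fun k => tent (2 ^ N * t - k) • X (k / 2 ^ N))
      have h2 := ae_all_iff.2 fun k : ℤ => Lp.coeFn_smul (tent (2 ^ N * t - k)) (X (k / 2 ^ N))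
      filter_upwards [h1, h2] with ω hω1 hω2
      refine hω1.trans (Finset.sum_congr rfl fun k _ => ?_)
      exact hω2 k
    obtain ⟨ns, hns, hlim⟩ := (tendstoInMeasure_of_tendsto_Lp hDlim).exists_seq_tendsto_ae
    filter_upwards [hlim, ae_all_iff.2 hDae, ae_lt_top hZm hZfin.ne] with ω h1 h2 h3
    refine tendsto_nhds_unique ?_ h1
    simp only [h2]
    exact (hΨ ω h3 t).comp hns.tendsto_atTop

end Kolmogorov

end FracField

end

noncomputable section

namespace FracField

/-! ### Fractional Ornstein-Uhlenbeck curves in a Hilbert space -/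

/-! ### Exponential averages and second differences of powers -/

section ExpWeight

/-- The density of the exponential distribution. -/
def expWeight (a v : ℝ) : ℝ := a * Real.exp (-(a * v))

variable {a : ℝ}

theorem expWeight_nonneg (ha : 0 < a) (v : ℝ) : 0 ≤ expWeight a v := by
  unfold expWeight; positivity

theorem continuous_expWeight (a : ℝ) : Continuous (expWeight a) := by
  unfold expWeight; fun_prop

theorem integrableOn_expWeight_mul_rpow (ha : 0 < a) {s : ℝ} (hs : 0 ≤ s) :
    IntegrableOn (fun v => expWeight a v * v ^ s) (Set.Ioi 0) := by
  have h := (integrableOn_rpow_mul_exp_neg_mul_rpow (p := 1) (s := s) (b := a) (by linarith)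
    one_pos ha).const_mul a
  refine h.congr (.of_forall fun v => ?_)
  simp only [Real.rpow_one, expWeight, neg_mul]
  ring

theorem integral_expWeight_mul_rpow (ha : 0 < a) {s : ℝ} (hs : 0 ≤ s) :
    ∫ v in Set.Ioi 0, expWeight a v * v ^ s = a ^ (-s) * Real.Gamma (s + 1) := by
  have h := Real.integral_rpow_mul_exp_neg_mul_Ioi (a := s + 1) (r := a) (by linarith) ha
  have e (v : ℝ) : expWeight a v * v ^ s = a * (v ^ (s + 1 - 1) * Real.exp (-(a * v))) := by
    rw [expWeight, add_sub_cancel_right]; ring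
  simp only [e]
  rw [integral_const_mul, h, one_div, Real.inv_rpow ha.le, Real.rpow_add_one ha.ne',
    Real.rpow_neg ha.le]
  field_simp

theorem integrableOn_expWeight (ha : 0 < a) : IntegrableOn (expWeight a) (Set.Ioi 0) := by
  simpa using integrableOn_expWeight_mul_rpow ha le_rfl

theorem integral_expWeight (ha : 0 < a) : ∫ v in Set.Ioi 0, expWeight a v = 1 := by
  simpa using integral_expWeight_mul_rpow ha le_rfl

/-- Two applications of the mean value inequality bound the mixed second difference of `x ^ p` by `v
w` times the supremum of the second derivative, which is of order `(τ - v) ^ (p - 2)`. For `p = 2H`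
the condition `p < 2` is `H < 1`. -/
theorem tendsto_second_difference_rpow {p : ℝ} (hp : p < 2) {v w : ℝ} (hv : 0 < v)
    (hw : 0 < w) :
    Tendsto (fun τ : ℝ => |τ + w| ^ p + |τ - v| ^ p - |τ| ^ p - |τ - v + w| ^ p) atTop (𝓝 0) := by
  have hlim : Tendsto (fun τ : ℝ => |p * (p - 1)| * (τ - v) ^ (-(2 - p)) * w * v) atTop (𝓝 0) := by
    have h1 : Tendsto (fun τ : ℝ => τ - v) atTop atTop := tendsto_atTop_add_const_right _ _ tendsto_id
    have h2 := (tendsto_rpow_neg_atTop (y := 2 - p) (by linarith)).comp h1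
    have := ((h2.const_mul |p * (p - 1)|).mul_const w).mul_const v
    simpa using this
  refine squeeze_zero_norm' ?_ hlim
  filter_upwards [eventually_gt_atTop v] with τ hτ
  have hx0 : 0 < τ - v := sub_pos.2 hτ
  set D := |p * (p - 1)| * (τ - v) ^ (-(2 - p)) with hD
  have hd (x : ℝ) (hx : x ∈ Set.Ici (τ - v)) :
      HasDerivAt (fun x => p * x ^ (p - 1)) (p * ((p - 1) * x ^ (p - 1 - 1))) x :=
    (Real.hasDerivAt_rpow_const (Or.inl (hx0.trans_le hx).ne')).const_mul p
  have hd2 (x : ℝ) (hx : x ∈ Set.Ici (τ - v)) :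
      ‖p * (x + w) ^ (p - 1) - p * x ^ (p - 1)‖ ≤ D * w := by
    have h := (convex_Ici (τ - v)).norm_image_sub_le_of_norm_hasDerivWithin_le (C := D)
      (fun x hx => (hd x hx).hasDerivWithinAt) (fun y hy => ?_) hx
      (show x + w ∈ Set.Ici (τ - v) from le_add_of_le_of_nonneg hx hw.le)
    · simpa [abs_of_pos hw] using h
    · have hy0 : 0 < y := hx0.trans_le hy
      rw [← mul_assoc, norm_mul, Real.norm_eq_abs, Real.norm_of_nonneg (by positivity), hD,
        show p - 1 - 1 = -(2 - p) by ring]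
      gcongr 1
      exact Real.rpow_le_rpow_of_nonpos hx0 hy (by linarith)
  have hg (x : ℝ) (hx : x ∈ Set.Ici (τ - v)) :
      HasDerivAt (fun x => (x + w) ^ p - x ^ p) (p * (x + w) ^ (p - 1) - p * x ^ (p - 1)) x := by
    have h0 : 0 < x := hx0.trans_le hx
    have h1 := (Real.hasDerivAt_rpow_const (p := p) (x := x + w) (Or.inl (by positivity))).comp_add_const x w
    exact h1.sub (Real.hasDerivAt_rpow_const (Or.inl h0.ne'))
  have h := (convex_Ici (τ - v)).norm_image_sub_le_of_norm_hasDerivWithin_le (C := D * w)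
    (fun x hx => (hg x hx).hasDerivWithinAt) hd2 (Set.self_mem_Ici)
    (show τ ∈ Set.Ici (τ - v) from by simpa using hv.le)
  rw [sub_sub_cancel, Real.norm_of_nonneg hv.le] at h
  refine le_trans (le_of_eq ?_) h
  rw [abs_of_pos (by linarith : 0 < τ + w), abs_of_pos hx0, abs_of_pos (by linarith : 0 < τ),
    abs_of_pos (by linarith : 0 < τ - v + w)]
  congr 1
  ring

end ExpWeight

section FOU

open scoped RealInnerProductSpace

variable {E : Type*} [NormedAddCommGroup E] [InnerProductSpace ℝ E]

/-- The curve `η` has the covariance of fractional Brownian motion. -/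
def IsFBMCurve (H : ℝ) (η : ℝ → E) : Prop :=
  ∀ s t, ⟪η t, η s⟫ = 1 / 2 * (|t| ^ (2 * H) + |s| ^ (2 * H) - |t - s| ^ (2 * H))

/-- The stationary Ornstein-Uhlenbeck curve driven by `η`, which is
`∫_{-∞}^t exp(-a(t-u)) dη(u)` after an integration by parts. -/
def fou (η : ℝ → E) (a t : ℝ) : E := ∫ v in Set.Ioi 0, expWeight a v • (η t - η (t - v))

variable {H : ℝ} {η : ℝ → E} {a : ℝ}

theorem IsFBMCurve.norm_sub (h : IsFBMCurve H η) (hH : 0 < H) (s t : ℝ) :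
    ‖η t - η s‖ = |t - s| ^ H := by
  have h2 : ‖η t - η s‖ ^ 2 = (|t - s| ^ H) ^ 2 := by
    rw [norm_sub_sq_real, ← real_inner_self_eq_norm_sq, ← real_inner_self_eq_norm_sq, h, h, h,
      ← Real.rpow_natCast (|t - s| ^ H), ← Real.rpow_mul (abs_nonneg _)]
    simp only [sub_self, abs_zero]
    rw [Real.zero_rpow (by positivity), mul_comm H]
    push_cast
    ring
  exact (pow_left_inj₀ (norm_nonneg _) (by positivity) two_ne_zero).1 h2

theorem IsFBMCurve.continuous (h : IsFBMCurve H η) (hH : 0 < H) : Continuous η := by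
  refine continuous_iff_continuousAt.2 fun t => ?_
  rw [ContinuousAt, tendsto_iff_norm_sub_tendsto_zero]
  simp only [h.norm_sub hH]
  have : Continuous fun x : ℝ => |x - t| ^ H :=
    (by fun_prop : Continuous fun x : ℝ => |x - t|).rpow_const fun _ => Or.inr hH.le
  simpa [Real.zero_rpow hH.ne'] using this.tendsto t

theorem IsFBMCurve.inner_increments (h : IsFBMCurve H η) (s t v w : ℝ) :
    ⟪η t - η (t - v), η s - η (s - w)⟫ = 1 / 2 * (|t - s + w| ^ (2 * H) + |t - s - v| ^ (2 * H) -
      |t - s| ^ (2 * H) - |t - s - v + w| ^ (2 * H)) := by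
  simp only [inner_sub_left, inner_sub_right, h _ _]
  rw [show t - (s - w) = t - s + w by ring, show t - v - s = t - s - v by ring,
    show t - v - (s - w) = t - s - v + w by ring]
  ring

theorem IsFBMCurve.integrableOn (h : IsFBMCurve H η) (hH : 0 < H) (ha : 0 < a) (t : ℝ) :
    IntegrableOn (fun v => expWeight a v • (η t - η (t - v))) (Set.Ioi 0) := by
  refine (integrableOn_expWeight_mul_rpow ha hH.le).mono' ?_ ?_
  · exact ((continuous_expWeight a).smul (continuous_const.sub ((h.continuous hH).comp
      (by fun_prop)))).aestronglyMeasurable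
  · refine (ae_restrict_mem measurableSet_Ioi).mono fun v (hv : 0 < v) => ?_
    rw [norm_smul, Real.norm_of_nonneg (expWeight_nonneg ha v), h.norm_sub hH, sub_sub_cancel,
      abs_of_pos hv]

theorem min_rpow_le {x y d : ℝ} (hx : 0 ≤ x) (hy : 0 ≤ y) (hd : 0 ≤ d) (hdH : d ≤ H) :
    min (x ^ H) (y ^ H) ≤ x ^ d * y ^ (H - d) := by
  have e (z : ℝ) (hz : 0 ≤ z) : z ^ H = z ^ d * z ^ (H - d) := by
    rw [← Real.rpow_add_of_nonneg hz hd (by linarith), add_sub_cancel]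
  rcases le_total x y with hxy | hxy
  · refine (min_le_left _ _).trans ?_
    rw [e x hx]
    gcongr
  · refine (min_le_right _ _).trans ?_
    rw [e y hy]
    gcongr

/-- The integrand contains a double increment of `η`, at most `2 |t - s| ^ H` when grouped by times
and at most `2 v ^ H` when grouped by lags. Interpolating with `min_rpow_le` trades smoothness in
`t` for powers of `v`, which the exponential average turns into powers of `a`. -/
theorem IsFBMCurve.norm_fou_sub_le (h : IsFBMCurve H η) (hH : 0 < H) (ha : 0 < a) {d : ℝ}
    (hd : 0 ≤ d) (hdH : d ≤ H) (s t : ℝ) :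
    ‖fou η a t - fou η a s‖ ≤ 2 * Real.Gamma (H - d + 1) * a ^ (d - H) * |t - s| ^ d := by
  rw [fou, fou, ← integral_sub (h.integrableOn hH ha t) (h.integrableOn hH ha s)]
  have hi : IntegrableOn (fun v => 2 * |t - s| ^ d * (expWeight a v * v ^ (H - d))) (Set.Ioi 0) :=
    (integrableOn_expWeight_mul_rpow ha (by linarith)).const_mul _
  refine (norm_integral_le_of_norm_le hi ?_).trans_eq ?_
  · refine (ae_restrict_mem measurableSet_Ioi).mono fun v (hv : 0 < v) => ?_
    rw [← smul_sub, norm_smul, Real.norm_of_nonneg (expWeight_nonneg ha v)]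
    have h1 : ‖η t - η (t - v) - (η s - η (s - v))‖ ≤ 2 * min (|t - s| ^ H) (v ^ H) := by
      rw [mul_min_of_nonneg _ _ zero_le_two, le_min_iff]
      constructor
      · rw [sub_sub_sub_comm]
        refine (norm_sub_le _ _).trans_eq ?_
        rw [h.norm_sub hH, h.norm_sub hH, sub_sub_sub_cancel_right]
        ring
      · refine (norm_sub_le _ _).trans_eq ?_
        rw [h.norm_sub hH, h.norm_sub hH, sub_sub_cancel, sub_sub_cancel, abs_of_pos hv]
        ring
    have h2 := h1.trans (mul_le_mul_of_nonneg_left (min_rpow_le (abs_nonneg (t - s)) hv.le hd hdH)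
      zero_le_two)
    calc expWeight a v * ‖η t - η (t - v) - (η s - η (s - v))‖
        ≤ expWeight a v * (2 * (|t - s| ^ d * v ^ (H - d))) := by
          gcongr
          exact expWeight_nonneg ha v
      _ = _ := by ring
  · rw [integral_const_mul, integral_expWeight_mul_rpow ha (by linarith), neg_sub]
    ring

theorem IsFBMCurve.norm_fou_le (h : IsFBMCurve H η) (hH : 0 < H) (ha : 0 < a) (t : ℝ) :
    ‖fou η a t‖ ≤ Real.Gamma (H + 1) * a ^ (-H) := by
  rw [fou]
  refine (norm_integral_le_of_norm_le (integrableOn_expWeight_mul_rpow ha hH.le) ?_).trans_eq ?_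
  · refine (ae_restrict_mem measurableSet_Ioi).mono fun v (hv : 0 < v) => ?_
    rw [norm_smul, Real.norm_of_nonneg (expWeight_nonneg ha v), h.norm_sub hH, sub_sub_cancel,
      abs_of_pos hv]
  · rw [integral_expWeight_mul_rpow ha hH.le]
    ring

theorem IsFBMCurve.integrableOn_shift (h : IsFBMCurve H η) (hH : 0 < H) (ha : 0 < a) (t : ℝ) :
    IntegrableOn (fun v => expWeight a v • η (t - v)) (Set.Ioi 0) := by
  have h1 := ((integrableOn_expWeight ha).smul_const (η t)).sub (h.integrableOn hH ha t)
  refine h1.congr (.of_forall fun v => ?_)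
  simp [smul_sub]

variable [CompleteSpace E]

theorem IsFBMCurve.inner_fou (h : IsFBMCurve H η) (hH : 0 < H) (ha : 0 < a) (x : E) (t : ℝ) :
    ⟪x, fou η a t⟫ = ∫ v in Set.Ioi 0, expWeight a v * ⟪x, η t - η (t - v)⟫ := by
  have := (innerSL ℝ x).integral_comp_comm (h.integrableOn hH ha t)
  simp only [map_smul, innerSL_apply_apply, smul_eq_mul] at this
  exact this.symm

/-- Only `t - s` enters the right side, which is the source of stationarity. -/
theorem IsFBMCurve.inner_fou_fou (h : IsFBMCurve H η) (hH : 0 < H) (ha : 0 < a) (s t : ℝ) :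
    ⟪fou η a t, fou η a s⟫ = ∫ w in Set.Ioi 0, expWeight a w * ∫ v in Set.Ioi 0, expWeight a v *
      (1 / 2 * (|t - s + v| ^ (2 * H) + |t - s - w| ^ (2 * H) - |t - s| ^ (2 * H) -
        |t - s - w + v| ^ (2 * H))) := by
  rw [real_inner_comm, h.inner_fou hH ha]
  refine integral_congr_ae (.of_forall fun w => ?_)
  simp only
  rw [real_inner_comm, h.inner_fou hH ha]
  simp only [h.inner_increments]

theorem IsFBMCurve.inner_fou_stationary (h : IsFBMCurve H η) (hH : 0 < H) (ha : 0 < a)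
    (r s t : ℝ) : ⟪fou η a (t + r), fou η a (s + r)⟫ = ⟪fou η a t, fou η a s⟫ := by
  rw [h.inner_fou_fou hH ha, h.inner_fou_fou hH ha, add_sub_add_right_eq_sub]

theorem inner_fou_eq_zero {η' : ℝ → E} {H' a' : ℝ} (h : IsFBMCurve H η) (hH : 0 < H) (ha : 0 < a)
    (h' : IsFBMCurve H' η') (hH' : 0 < H') (ha' : 0 < a') (h0 : ∀ s t, ⟪η t, η' s⟫ = 0)
    (s t : ℝ) : ⟪fou η a t, fou η' a' s⟫ = 0 := by
  rw [h'.inner_fou hH' ha']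
  have (w : ℝ) : ⟪fou η a t, η' s - η' (s - w)⟫ = 0 := by
    rw [real_inner_comm, h.inner_fou hH ha]
    have h0' (s t : ℝ) : ⟪η' t, η s⟫ = 0 := by rw [real_inner_comm, h0]
    simp [inner_sub_left, inner_sub_right, h0']
  simp [this]

/-- A closed subspace is its own double orthogonal complement, so it suffices that a vector
orthogonal to all values of `η` is orthogonal to their integral. -/
theorem fou_mem (h : IsFBMCurve H η) (hH : 0 < H) (ha : 0 < a) {K : Submodule ℝ E}
    (hK : IsClosed (K : Set E)) (hη : ∀ t, η t ∈ K) (t : ℝ) : fou η a t ∈ K := by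
  have hKc : K.topologicalClosure = K := hK.submodule_topologicalClosure_eq
  rw [← hKc, ← Submodule.orthogonal_orthogonal_eq_closure, Submodule.mem_orthogonal]
  intro x hx
  rw [h.inner_fou hH ha]
  have (v : ℝ) : ⟪x, η t - η (t - v)⟫ = 0 := by
    rw [real_inner_comm]
    exact (Submodule.mem_orthogonal _ _).1 hx _ (K.sub_mem (hη _) (hη _))
  simp [this]

/-- The covariance is a double exponential average of second differences of `|τ| ^ (2H)`. Each tends
to zero by `tendsto_second_difference_rpow`, and dominated convergence is applied once for each
average, with Cauchy–Schwarz supplying the bounds. -/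
theorem IsFBMCurve.tendsto_inner_fou (h : IsFBMCurve H η) (hH : 0 < H) (hH1 : H < 1) (ha : 0 < a) :
    Tendsto (fun t => ⟪fou η a t, fou η a 0⟫) atTop (𝓝 0) := by
  have hc := h.continuous hH
  have hinc (v : ℝ) (hv : 0 < v) :
      Tendsto (fun t => ⟪η t - η (t - v), fou η a 0⟫) atTop (𝓝 0) := by
    simp only [h.inner_fou hH ha]
    rw [show 𝓝 (0 : ℝ) = 𝓝 (∫ _ in Set.Ioi (0 : ℝ), (0 : ℝ)) by rw [integral_zero]]
    refine tendsto_integral_filter_of_dominated_convergence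
      (fun w => v ^ H * (expWeight a w * w ^ H)) (.of_forall fun t => ?_) (.of_forall fun t => ?_)
      ((integrableOn_expWeight_mul_rpow ha hH.le).const_mul _) ?_
    · refine Continuous.aestronglyMeasurable ?_
      exact (continuous_expWeight a).mul (continuous_const.inner
        (continuous_const.sub (hc.comp (by fun_prop))))
    · refine (ae_restrict_mem measurableSet_Ioi).mono fun w (hw : 0 < w) => ?_
      rw [norm_mul, Real.norm_of_nonneg (expWeight_nonneg ha w)]
      have := norm_inner_le_norm (𝕜 := ℝ) (η t - η (t - v)) (η 0 - η (0 - w))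
      rw [h.norm_sub hH, h.norm_sub hH, sub_sub_cancel, sub_sub_cancel, abs_of_pos hv,
        abs_of_pos hw] at this
      calc expWeight a w * ‖⟪η t - η (t - v), η 0 - η (0 - w)⟫‖
          ≤ expWeight a w * (v ^ H * w ^ H) := by
            gcongr
            exact expWeight_nonneg ha w
        _ = _ := by ring
    · refine (ae_restrict_mem measurableSet_Ioi).mono fun w (hw : 0 < w) => ?_
      simp only [h.inner_increments, sub_zero]
      have := ((tendsto_second_difference_rpow (p := 2 * H) (by linarith) hv hw).const_mul
        (1 / 2)).const_mul (expWeight a w)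
      simpa using this
  simp only [fun t => real_inner_comm (fou η a 0) (fou η a t), h.inner_fou hH ha]
  rw [show 𝓝 (0 : ℝ) = 𝓝 (∫ _ in Set.Ioi (0 : ℝ), (0 : ℝ)) by rw [integral_zero]]
  refine tendsto_integral_filter_of_dominated_convergence
    (fun w => ‖fou η a 0‖ * (expWeight a w * w ^ H)) (.of_forall fun t => ?_) (.of_forall fun t => ?_)
    ((integrableOn_expWeight_mul_rpow ha hH.le).const_mul _) ?_
  · refine Continuous.aestronglyMeasurable ?_
    exact (continuous_expWeight a).mul (continuous_const.inner
      (continuous_const.sub (hc.comp (by fun_prop))))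
  · refine (ae_restrict_mem measurableSet_Ioi).mono fun w (hw : 0 < w) => ?_
    rw [norm_mul, Real.norm_of_nonneg (expWeight_nonneg ha w)]
    have := norm_inner_le_norm (𝕜 := ℝ) (fou η a 0) (η t - η (t - w))
    rw [h.norm_sub hH, sub_sub_cancel, abs_of_pos hw] at this
    calc expWeight a w * ‖⟪fou η a 0, η t - η (t - w)⟫‖
        ≤ expWeight a w * (‖fou η a 0‖ * w ^ H) := by
          gcongr
          exact expWeight_nonneg ha w
      _ = _ := by ring
  · refine (ae_restrict_mem measurableSet_Ioi).mono fun w (hw : 0 < w) => ?_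
    have := (hinc w hw).const_mul (expWeight a w)
    simp only [real_inner_comm, mul_zero] at this ⊢
    exact this

theorem IsFBMCurve.fou_eq (h : IsFBMCurve H η) (hH : 0 < H) (ha : 0 < a) (t : ℝ) :
    fou η a t = η t - ∫ v in Set.Ioi 0, expWeight a v • η (t - v) := by
  simp only [fou, smul_sub]
  rw [integral_sub ((integrableOn_expWeight ha).smul_const _) (h.integrableOn_shift hH ha t),
    integral_smul_const, integral_expWeight ha, one_smul]

/-- The variation of constants formula. -/
theorem IsFBMCurve.fou_eq_add (h : IsFBMCurve H η) (hH : 0 < H) (ha : 0 < a) {s t : ℝ}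
    (hst : s ≤ t) :
    fou η a t = Real.exp (-(a * (t - s))) • fou η a s + (η t - Real.exp (-(a * (t - s))) • η s -
      ∫ u in s..t, expWeight a (t - u) • η u) := by
  have hi := h.integrableOn_shift hH ha t
  have hts : 0 ≤ t - s := sub_nonneg.2 hst
  have h1 := intervalIntegral.integral_interval_add_Ioi hi (hi.mono_set (Set.Ioi_subset_Ioi hts))
  have h2 : ∫ v in (0 : ℝ)..(t - s), expWeight a v • η (t - v) =
      ∫ u in s..t, expWeight a (t - u) • η u := by
    have := intervalIntegral.integral_comp_sub_left (a := s) (b := t)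
      (fun v => expWeight a v • η (t - v)) t
    simp only [sub_sub_cancel, sub_self] at this
    exact this.symm
  -- The history before time `s` is the whole average at time `s`, translated by `t - s`; the
  -- exponential weight releases the damping factor.
  have h3 : ∫ v in Set.Ioi (t - s), expWeight a v • η (t - v) =
      Real.exp (-(a * (t - s))) • ∫ v in Set.Ioi 0, expWeight a v • η (s - v) := by
    have hmp := measurePreserving_add_right (volume : Measure ℝ) (t - s)
    have hpre : (fun x => x + (t - s)) ⁻¹' Set.Ioi (t - s) = Set.Ioi 0 := by
      ext x; simp
    rw [← hmp.setIntegral_preimage_emb (measurableEmbedding_addRight _), hpre, ← integral_smul]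
    refine integral_congr_ae (.of_forall fun v => ?_)
    simp only [smul_smul, expWeight]
    congr 1
    · rw [mul_left_comm, ← Real.exp_add]
      ring_nf
    · congr 1
      ring
  rw [h.fou_eq hH ha t, h.fou_eq hH ha s, ← h1, h2, h3]
  module

end FOU

end FracField

end

noncomputable section

namespace FracField

/-! ### The Gaussian space of the noise -/

/-! ### Choosing one mode from each pair `k`, `-k` -/

namespace Mode

/-- A half plane of modes, containing exactly one of `k` and `-k`. -/
def Pos (k : Mode) : Prop := 0 < k.1 0 ∨ (k.1 0 = 0 ∧ 0 < k.1 1)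

instance : DecidablePred Pos := fun k => by unfold Pos; infer_instance

theorem neg_neg (k : Mode) : k.neg.neg = k := Subtype.ext (_root_.neg_neg k.1)

theorem pos_neg_iff (k : Mode) : k.neg.Pos ↔ ¬ k.Pos := by
  have h : ¬ (k.1 0 = 0 ∧ k.1 1 = 0) := by
    rintro ⟨h0, h1⟩
    refine k.2 (funext fun i => ?_)
    fin_cases i
    exacts [h0, h1]
  simp only [Pos, neg, Pi.neg_apply]
  omega

/-- The element of `{k, -k}` in the half plane. -/
def rep (k : Mode) : Mode := if k.Pos then k else k.neg

theorem rep_pos (k : Mode) : k.rep.Pos := by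
  unfold rep
  split_ifs with h
  · exact h
  · exact (pos_neg_iff k).2 h

theorem eq_of_rep_eq {k l : Mode} (h : k.rep = l.rep) (hp : k.Pos ↔ l.Pos) : k = l := by
  unfold rep at h
  by_cases hk : k.Pos
  · rwa [if_pos hk, if_pos (hp.1 hk)] at h
  · rw [if_neg hk, if_neg (fun hl => hk (hp.2 hl))] at h
    rw [← neg_neg k, h, neg_neg]

end Mode

/-! ### Gaussian laws and moments on the closed span of the noise -/

section Noise

variable {S : Type*} [MeasurableSpace S] {μ : Measure S} {H : ℝ} {β : Mode → ℝ → S → ℂ}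

/-- The independent real fractional Brownian motions behind the noise. -/
def realNoise (β : Mode → ℝ → S → ℂ) (k : Mode) (t : ℝ) (ω : S) : ℝ :=
  if k.Pos then Real.sqrt 2 * (β k t ω).re else Real.sqrt 2 * (β k t ω).im

theorem IsNoise.isFBM (hβ : IsNoise μ H β) (k : Mode) : IsFBM μ H (realNoise β k) := by
  by_cases hk : k.Pos
  · have h : realNoise β k = fun t ω => Real.sqrt 2 * (β k t ω).re := by
      funext t ω
      exact if_pos hk
    exact h ▸ hβ.fbm_re k
  · have h : realNoise β k = fun t ω => Real.sqrt 2 * (β k t ω).im := by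
      funext t ω
      exact if_neg hk
    exact h ▸ hβ.fbm_im k

/-- The functional of the path of `β_{rep k}` that gives the real noise `k` at time `t`. -/
def noiseFunctional (p : Mode × ℝ) (b : ℝ → ℂ) : ℝ :=
  if p.1.Pos then Real.sqrt 2 * (b p.2).re else -(Real.sqrt 2 * (b p.2).im)

theorem measurable_noiseFunctional (p : Mode × ℝ) : Measurable (noiseFunctional p) := by
  unfold noiseFunctional
  split_ifs <;> fun_prop

/-- Outside the half plane `β_k` is the conjugate of `β_{rep k}`, which flips the sign of the
imaginary part. All real noises are thus functionals of the independent family indexed by the half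
plane: real parts for modes inside it, imaginary parts for modes outside. -/
theorem IsNoise.ae_realNoise_eq (hβ : IsNoise μ H β) (p : Mode × ℝ) :
    realNoise β p.1 p.2 =ᵐ[μ] fun ω => noiseFunctional p fun t => β p.1.rep t ω := by
  by_cases hk : p.1.Pos
  · refine Eventually.of_forall fun ω => ?_
    simp [realNoise, noiseFunctional, Mode.rep, hk]
  · filter_upwards [hβ.conj p.1 p.2] with ω hω
    simp [realNoise, noiseFunctional, Mode.rep, hk, hω]

theorem IsFBM.hasGaussianLaw_sum {X : ℝ → S → ℝ} (hX : IsFBM μ H X) {ι : Type*} (I : Finset ι)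
    (t : ι → ℝ) (c : ι → ℝ) : HasGaussianLaw (fun ω => ∑ i ∈ I, c i * X (t i) ω) μ :=
  ((hX.gaussian.comp_right t).smul c).hasGaussianLaw_fun_sum (I := I)

theorem IsNoise.hasGaussianLaw_functional_sum (hβ : IsNoise μ H β) (I : Finset (Mode × ℝ))
    (c : Mode × ℝ → ℝ) (j : Mode) :
    HasGaussianLaw (fun ω => ∑ p ∈ I, c p * noiseFunctional p fun t => β j t ω) μ := by
  have h1 := (hβ.fbm_re j).hasGaussianLaw_sum (I.filter fun p => p.1.Pos) Prod.snd c
  have h2 := (hβ.fbm_im j).hasGaussianLaw_sum (I.filter fun p => ¬ p.1.Pos) Prod.snd fun p => -c p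
  have hm1 : Measurable fun b : ℝ → ℝ =>
      ∑ p ∈ I.filter fun p => p.1.Pos, c p * (Real.sqrt 2 * b p.2) := by fun_prop
  have hm2 : Measurable fun b : ℝ → ℝ =>
      ∑ p ∈ I.filter fun p => ¬ p.1.Pos, -c p * (Real.sqrt 2 * b p.2) := by fun_prop
  have h3 := (((hβ.indep_re_im j).comp hm1 hm2).hasGaussianLaw h1 h2).fun_add
  refine h3.congr (Eventually.of_forall fun ω => ?_)
  dsimp only [Function.comp_apply]
  rw [← Finset.sum_filter_add_sum_filter_not I fun p : Mode × ℝ => p.1.Pos]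
  congr 1
  · exact Finset.sum_congr rfl fun p hp => by
      rw [noiseFunctional, if_pos (Finset.mem_filter.1 hp).2]
  · exact Finset.sum_congr rfl fun p hp => by
      rw [noiseFunctional, if_neg (Finset.mem_filter.1 hp).2]
      ring

/-- Group the terms by representative: the groups are independent by `IsNoise.indep`, and within a
group the real and the imaginary part are independent Gaussian processes. So joint Gaussianity,
which is not assumed, follows from independence. -/
theorem IsNoise.hasGaussianLaw_sum (hβ : IsNoise μ H β) (I : Finset (Mode × ℝ))
    (c : Mode × ℝ → ℝ) :
    HasGaussianLaw (fun ω => ∑ p ∈ I, c p * realNoise β p.1 p.2 ω) μ := by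
  classical
  set J : Finset Mode := I.image fun p => p.1.rep with hJ
  have hJpos : ∀ k ∈ (J : Set Mode), k.neg ∉ (J : Set Mode) := by
    have : ∀ k ∈ J, k.Pos := by
      intro k hk
      obtain ⟨p, -, rfl⟩ := Finset.mem_image.1 hk
      exact p.1.rep_pos
    intro k hk hk'
    exact (Mode.pos_neg_iff k).1 (this _ hk') (this _ hk)
  have hind := hβ.indep (J : Set Mode) hJpos
  have hind2 := hind.comp (fun (j : (J : Set Mode)) (b : ℝ → ℂ) =>
    ∑ p ∈ I.filter (fun p => p.1.rep = j.1), c p * noiseFunctional p b) fun j =>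
      Finset.measurable_sum _ fun p _ => (measurable_noiseFunctional p).const_mul _
  have hsum := iIndepFun.hasGaussianLaw_fun_sum (fun j : (J : Set Mode) =>
    hβ.hasGaussianLaw_functional_sum (I.filter (fun p => p.1.rep = j.1)) c j) hind2
  refine hsum.congr ?_
  have hae : ∀ᵐ ω ∂μ, ∀ p ∈ I,
      realNoise β p.1 p.2 ω = noiseFunctional p fun t => β p.1.rep t ω :=
    (Finset.eventually_all I).2 fun p _ => hβ.ae_realNoise_eq p
  filter_upwards [hae] with ω hω
  have h1 : ∑ p ∈ I, c p * realNoise β p.1 p.2 ω =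
      ∑ p ∈ I, c p * noiseFunctional p fun t => β p.1.rep t ω :=
    Finset.sum_congr rfl fun p hp => by rw [hω p hp]
  rw [h1, ← Finset.sum_fiberwise_of_maps_to (s := I) (t := J) (g := fun p => p.1.rep)
    fun p hp => Finset.mem_image_of_mem _ hp]
  refine (Finset.sum_coe_sort J fun j => ∑ p ∈ I.filter (fun p => p.1.rep = j),
    c p * noiseFunctional p fun t => β j t ω).trans ?_
  refine Finset.sum_congr rfl fun j _ => Finset.sum_congr rfl fun p hp => ?_
  rw [(Finset.mem_filter.1 hp).2]

theorem IsFBM.memLp {X : ℝ → S → ℝ} (hX : IsFBM μ H X) (t : ℝ) : MemLp (X t) 2 μ :=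
  (hX.gaussian.hasGaussianLaw_eval t).memLp_two

/-- The real noises are uncorrelated. -/
theorem IsNoise.integral_realNoise_mul_eq_zero (hβ : IsNoise μ H β) {k l : Mode} (hkl : k ≠ l)
    (t s : ℝ) : ∫ ω, realNoise β k t ω * realNoise β l s ω ∂μ = 0 := by
  have key : IndepFun (realNoise β k t) (realNoise β l s) μ := by
    -- Distinct modes with one representative give the real and the imaginary part of the same `β`;
    -- different representatives give different members of the independent family.
    by_cases hr : k.rep = l.rep
    · have hre : Measurable fun b : ℝ → ℝ => Real.sqrt 2 * b t := by fun_prop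
      have hre' : Measurable fun b : ℝ → ℝ => Real.sqrt 2 * b s := by fun_prop
      have him : Measurable fun b : ℝ → ℝ => -(Real.sqrt 2 * b t) := by fun_prop
      have him' : Measurable fun b : ℝ → ℝ => -(Real.sqrt 2 * b s) := by fun_prop
      have hne : ¬ (k.Pos ↔ l.Pos) := fun h => hkl (Mode.eq_of_rep_eq hr h)
      by_cases hk : k.Pos
      · have hl : ¬ l.Pos := fun hl => hne ⟨fun _ => hl, fun _ => hk⟩
        refine ((hβ.indep_re_im k.rep).comp hre him').congr ?_ ?_
        · filter_upwards [hβ.ae_realNoise_eq (k, t)] with ω hω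
          rw [hω, noiseFunctional, if_pos hk]
          rfl
        · filter_upwards [hβ.ae_realNoise_eq (l, s)] with ω hω
          rw [hω, noiseFunctional, if_neg hl, hr]
          rfl
      · have hl : l.Pos := by by_contra hl; exact hne ⟨fun h => (hk h).elim, fun h => (hl h).elim⟩
        refine ((hβ.indep_re_im k.rep).symm.comp him hre').congr ?_ ?_
        · filter_upwards [hβ.ae_realNoise_eq (k, t)] with ω hω
          rw [hω, noiseFunctional, if_neg hk]
          rfl
        · filter_upwards [hβ.ae_realNoise_eq (l, s)] with ω hω
          rw [hω, noiseFunctional, if_pos hl, hr]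
          rfl
    · have hJ : ∀ j ∈ ({k.rep, l.rep} : Set Mode), j.neg ∉ ({k.rep, l.rep} : Set Mode) := by
        have hp : ∀ j ∈ ({k.rep, l.rep} : Set Mode), j.Pos := by
          rintro j (rfl | rfl) <;> exact Mode.rep_pos _
        exact fun j hj hj' => (Mode.pos_neg_iff j).1 (hp _ hj') (hp _ hj)
      have h2 := (hβ.indep _ hJ).indepFun (i := ⟨k.rep, Or.inl rfl⟩) (j := ⟨l.rep, Or.inr rfl⟩)
        fun h => hr (congrArg Subtype.val h)
      refine (h2.comp (measurable_noiseFunctional (k, t))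
        (measurable_noiseFunctional (l, s))).congr ?_ ?_
      · exact (hβ.ae_realNoise_eq (k, t)).symm
      · exact (hβ.ae_realNoise_eq (l, s)).symm
  have h := key.integral_mul_eq_mul_integral ((hβ.isFBM k).memLp t).1 ((hβ.isFBM l).memLp s).1
  simp only [Pi.mul_apply] at h
  rw [h, (hβ.isFBM k).mean, zero_mul]

/-- The real noise as a curve in `L²(μ)`. -/
def IsNoise.curve (hβ : IsNoise μ H β) (k : Mode) (t : ℝ) : Lp ℝ 2 μ :=
  ((hβ.isFBM k).memLp t).toLp _

theorem IsNoise.coeFn_curve (hβ : IsNoise μ H β) (k : Mode) (t : ℝ) :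
    hβ.curve k t =ᵐ[μ] realNoise β k t := MemLp.coeFn_toLp _

theorem IsNoise.inner_curve (hβ : IsNoise μ H β) (k l : Mode) (t s : ℝ) :
    inner ℝ (hβ.curve k t) (hβ.curve l s) = ∫ ω, realNoise β k t ω * realNoise β l s ω ∂μ := by
  rw [L2.inner_def]
  refine integral_congr_ae ?_
  filter_upwards [hβ.coeFn_curve k t, hβ.coeFn_curve l s] with ω h1 h2
  rw [h1, h2, real_inner_eq_re_inner]
  simp [mul_comm]

theorem IsNoise.isFBMCurve (hβ : IsNoise μ H β) (k : Mode) : IsFBMCurve H (hβ.curve k) := by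
  intro s t
  rw [hβ.inner_curve, (hβ.isFBM k).cov]

theorem IsNoise.inner_curve_eq_zero (hβ : IsNoise μ H β) {k l : Mode} (hkl : k ≠ l) (t s : ℝ) :
    inner ℝ (hβ.curve k t) (hβ.curve l s) = 0 := by
  rw [hβ.inner_curve, hβ.integral_realNoise_mul_eq_zero hkl]

/-- The Gaussian space of the noise. -/
def IsNoise.space (hβ : IsNoise μ H β) : Submodule ℝ (Lp ℝ 2 μ) :=
  (Submodule.span ℝ (Set.range fun p : Mode × ℝ => hβ.curve p.1 p.2)).topologicalClosure

theorem IsNoise.isClosed_space (hβ : IsNoise μ H β) : IsClosed (hβ.space : Set (Lp ℝ 2 μ)) :=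
  Submodule.isClosed_topologicalClosure _

theorem IsNoise.curve_mem_space (hβ : IsNoise μ H β) (k : Mode) (t : ℝ) :
    hβ.curve k t ∈ hβ.space :=
  Submodule.le_topologicalClosure _ (Submodule.subset_span ⟨(k, t), rfl⟩)

/-- `x ↦ exp(i c x)` is `|c|`-Lipschitz and the `L¹` norm is at most the `L²` norm. This continuity
extends the Gaussian characteristic function from the span of the noise to its closure. -/
theorem integral_exp_lipschitz [IsProbabilityMeasure μ] (c : ℝ) (f g : Lp ℝ 2 μ) :
    ‖(∫ ω, Complex.exp ((c * f ω : ℝ) * Complex.I) ∂μ) -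
      ∫ ω, Complex.exp ((c * g ω : ℝ) * Complex.I) ∂μ‖ ≤ |c| * ‖f - g‖ := by
  have hint : ∀ f : Lp ℝ 2 μ, Integrable (fun ω => Complex.exp ((c * f ω : ℝ) * Complex.I)) μ := by
    intro f
    refine (integrable_const (1 : ℝ)).mono' ?_ (Eventually.of_forall fun ω => ?_)
    · have hf := (Lp.aestronglyMeasurable f).aemeasurable
      have : AEMeasurable (fun ω => Complex.exp ((c * f ω : ℝ) * Complex.I)) μ := by fun_prop
      exact this.aestronglyMeasurable
    · rw [Complex.norm_exp_ofReal_mul_I]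
  have hfg : Integrable (fun ω => ‖(f - g) ω‖) μ :=
    ((Lp.memLp (f - g)).integrable (by norm_num)).norm
  rw [← integral_sub (hint f) (hint g)]
  calc _ ≤ ∫ ω, |c| * ‖(f - g) ω‖ ∂μ := by
        refine norm_integral_le_of_norm_le (hfg.const_mul _) ?_
        filter_upwards [Lp.coeFn_sub f g] with ω hω
        rw [hω, Pi.sub_apply, Real.norm_eq_abs, ← abs_mul, mul_sub]
        have := Real.norm_exp_I_mul_ofReal_sub_one_le (x := c * f ω - c * g ω)
        calc _ = ‖Complex.exp ((c * g ω : ℝ) * Complex.I) *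
              (Complex.exp (Complex.I * ((c * f ω - c * g ω : ℝ))) - 1)‖ := by
              rw [mul_sub, ← Complex.exp_add, mul_one]
              congr 3
              push_cast
              ring
          _ ≤ |c * f ω - c * g ω| := by
              rw [norm_mul, Complex.norm_exp_ofReal_mul_I, one_mul]
              exact this
    _ = |c| * ∫ ω, ‖(f - g) ω‖ ∂μ := integral_const_mul _ _
    _ ≤ |c| * ‖f - g‖ := by
        gcongr
        rw [Lp.norm_def]
        have h1 : eLpNorm (f - g) 1 μ ≤ eLpNorm (f - g) 2 μ :=
          eLpNorm_le_eLpNorm_of_exponent_le (by norm_num) (Lp.aestronglyMeasurable _)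
        have h2 := ENNReal.toReal_mono (Lp.eLpNorm_ne_top (f - g)) h1
        rwa [eLpNorm_one_eq_lintegral_enorm, ← integral_norm_eq_lintegral_enorm
          (Lp.aestronglyMeasurable _)] at h2

theorem IsNoise.integral_exp_eq_of_mem_span [IsProbabilityMeasure μ] (hβ : IsNoise μ H β)
    {w : Lp ℝ 2 μ}
    (hw : w ∈ Submodule.span ℝ (Set.range fun p : Mode × ℝ => hβ.curve p.1 p.2)) (c : ℝ) :
    ∫ ω, Complex.exp ((c * w ω : ℝ) * Complex.I) ∂μ = Real.exp (-(c ^ 2 * ‖w‖ ^ 2 / 2)) := by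
  obtain ⟨a, rfl⟩ := (Finsupp.mem_span_range_iff_exists_finsupp).1 hw
  set w : Lp ℝ 2 μ := a.sum fun p r => r • hβ.curve p.1 p.2 with hwdef
  have hae : w =ᵐ[μ] fun ω => ∑ p ∈ a.support, a p * realNoise β p.1 p.2 ω := by
    have h1 : w =ᵐ[μ] fun ω => ∑ p ∈ a.support, (a p • hβ.curve p.1 p.2 : Lp ℝ 2 μ) ω :=
      Lp.coeFn_fun_finsetSum _ _
    have h2 : ∀ᵐ ω ∂μ, ∀ p ∈ a.support,
        (a p • hβ.curve p.1 p.2 : Lp ℝ 2 μ) ω = a p * realNoise β p.1 p.2 ω := by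
      refine (Finset.eventually_all _).2 fun p _ => ?_
      filter_upwards [Lp.coeFn_smul (a p) (hβ.curve p.1 p.2), hβ.coeFn_curve p.1 p.2] with ω h h'
      rw [h, Pi.smul_apply, h', smul_eq_mul]
    filter_upwards [h1, h2] with ω h h'
    rw [h]
    exact Finset.sum_congr rfl h'
  have hG : HasGaussianLaw w μ :=
    (hβ.hasGaussianLaw_sum a.support a).congr hae.symm
  have hmean : ∫ ω, w ω ∂μ = 0 := by
    rw [integral_congr_ae hae, integral_finsetSum _ fun p _ =>
      ((((hβ.isFBM p.1).memLp p.2).integrable (by norm_num)).const_mul (a p))]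
    refine Finset.sum_eq_zero fun p _ => ?_
    rw [integral_const_mul, (hβ.isFBM p.1).mean, mul_zero]
  have hvar : Var[w; μ] = ‖w‖ ^ 2 := by
    rw [variance_of_integral_eq_zero hG.aemeasurable hmean, ← real_inner_self_eq_norm_sq,
      L2.inner_def]
    refine integral_congr_ae (Eventually.of_forall fun ω => ?_)
    simp [sq]
  have h := charFun_gaussianReal (μ := 0) (v := Var[w; μ].toNNReal) c
  have hmap := hG.map_eq_gaussianReal
  rw [hmean] at hmap
  rw [← hmap, charFun_apply_real, integral_map hG.aemeasurable (by fun_prop), hvar,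
    Real.coe_toNNReal _ (sq_nonneg _)] at h
  convert h using 1
  · congr 1
    funext ω
    push_cast
    rfl
  · push_cast
    congr 1
    ring

theorem IsNoise.integral_exp_eq [IsProbabilityMeasure μ] (hβ : IsNoise μ H β)
    {w : Lp ℝ 2 μ} (hw : w ∈ hβ.space) (c : ℝ) :
    ∫ ω, Complex.exp ((c * w ω : ℝ) * Complex.I) ∂μ = Real.exp (-(c ^ 2 * ‖w‖ ^ 2 / 2)) := by
  have hcl : IsClosed {w : Lp ℝ 2 μ | ∫ ω, Complex.exp ((c * w ω : ℝ) * Complex.I) ∂μ =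
      Real.exp (-(c ^ 2 * ‖w‖ ^ 2 / 2))} := by
    refine isClosed_eq ?_ (by fun_prop)
    refine (LipschitzWith.of_dist_le_mul (K := ⟨|c|, abs_nonneg c⟩) fun f g => ?_).continuous
    rw [dist_eq_norm, dist_eq_norm]
    exact integral_exp_lipschitz c f g
  exact hcl.closure_subset_iff.2 (fun w hw => hβ.integral_exp_eq_of_mem_span hw c) hw

/-- Every element of the Gaussian space is a centered Gaussian random variable. -/
theorem IsNoise.map_eq_gaussianReal [IsProbabilityMeasure μ] (hβ : IsNoise μ H β)
    {w : Lp ℝ 2 μ} (hw : w ∈ hβ.space) :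
    μ.map w = gaussianReal 0 (‖w‖ ^ 2).toNNReal := by
  have hm := (Lp.aestronglyMeasurable w).aemeasurable
  have := Measure.isProbabilityMeasure_map hm
  refine Measure.ext_of_charFun (funext fun c => ?_)
  rw [charFun_gaussianReal, charFun_apply_real, integral_map hm (by fun_prop),
    Real.coe_toNNReal _ (sq_nonneg _)]
  convert hβ.integral_exp_eq hw c using 1
  · congr 1
    funext ω
    push_cast
    rfl
  · push_cast
    congr 1
    ring

/-- A centered Gaussian variable is a standard one scaled by its `L²` norm. Hence high moments cost
only a constant, which is what makes large powers `p` affordable later. -/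
theorem IsNoise.lintegral_enorm_pow [IsProbabilityMeasure μ] (hβ : IsNoise μ H β)
    {w : Lp ℝ 2 μ} (hw : w ∈ hβ.space) (n : ℕ) :
    ∫⁻ ω, ‖w ω‖ₑ ^ n ∂μ = ‖w‖ₑ ^ n * ∫⁻ x, ‖x‖ₑ ^ n ∂(gaussianReal 0 1) := by
  have hm := (Lp.aestronglyMeasurable w).aemeasurable
  have h1 : gaussianReal 0 (‖w‖ ^ 2).toNNReal = (gaussianReal 0 1).map (‖w‖ * ·) := by
    rw [gaussianReal_map_const_mul]
    congr 1
    · simp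
    · ext
      simp
  have h2 : ∫⁻ ω, ‖w ω‖ₑ ^ n ∂μ = ∫⁻ x, ‖x‖ₑ ^ n ∂(μ.map w) :=
    (lintegral_map' (f := fun x : ℝ => ‖x‖ₑ ^ n) (by fun_prop) hm).symm
  rw [h2, hβ.map_eq_gaussianReal hw, h1, lintegral_map (by fun_prop) (by fun_prop),
    ← lintegral_const_mul _ (by fun_prop)]
  refine lintegral_congr fun x => ?_
  rw [enorm_mul, mul_pow, enorm_norm]

theorem lintegral_enorm_pow_gaussianReal_ne_top (n : ℕ) :
    ∫⁻ x, ‖x‖ₑ ^ n ∂(gaussianReal 0 1) ≠ ⊤ := by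
  rcases Nat.eq_zero_or_pos n with rfl | hn
  · simp
  have h := (memLp_id_gaussianReal (μ := 0) (v := 1) (n : NNReal)).2
  have h0 : ((n : NNReal) : ENNReal) ≠ 0 := by
    simpa using hn.ne'
  have h2 := (eLpNorm_lt_top_iff_lintegral_rpow_enorm_lt_top h0 (by simp)).1 h
  simpa using h2.ne

end Noise

end FracField

end

noncomputable section

namespace FracField

/-! ### Pathwise integrals and Bochner integrals -/

section Pathwise

variable {S : Type*} [MeasurableSpace S] {μ : Measure S}

/-- Setting the paths to zero on a measurable null set makes all of them continuous; continuity in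
time and measurability in `ω` then give the joint measurability needed for Fubini. -/
theorem exists_jointly_measurable_version {X : ℝ → S → ℝ} (hm : ∀ t, Measurable (X t))
    (hc : ∀ᵐ ω ∂μ, Continuous fun t => X t ω) :
    ∃ Y : ℝ → S → ℝ, Measurable (fun p : S × ℝ => Y p.2 p.1) ∧ (∀ ω, Continuous fun t => Y t ω) ∧
      ∀ᵐ ω ∂μ, ∀ t, Y t ω = X t ω := by
  classical
  set N := toMeasurable μ {ω | ¬ Continuous fun t => X t ω} with hN
  have hN0 : μ N = 0 := by rw [hN, measure_toMeasurable]; exact hc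
  have hNm : MeasurableSet N := measurableSet_toMeasurable _ _
  have hNc : ∀ ω, ω ∉ N → Continuous fun t => X t ω := fun ω hω => by
    by_contra h
    exact hω (subset_toMeasurable _ _ h)
  have hYc : ∀ ω, Continuous fun t => (if ω ∈ N then 0 else X t ω : ℝ) := by
    intro ω
    by_cases h : ω ∈ N
    · simpa [h] using continuous_const
    · simpa [h] using hNc ω h
  refine ⟨fun t ω => if ω ∈ N then 0 else X t ω, ?_, hYc, ?_⟩
  · exact (measurable_uncurry_of_continuous_of_measurable (ι := ℝ)
      (u := fun t ω => (if ω ∈ N then 0 else X t ω : ℝ)) hYc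
      fun t => Measurable.ite hNm measurable_const (hm t)).comp measurable_swap
  · have : ∀ᵐ ω ∂μ, ω ∉ N := measure_eq_zero_iff_ae_notMem.1 hN0
    filter_upwards [this] with ω hω t
    simp [hω]

/-- The Bochner integral in `L²` of a process with continuous paths is the pathwise integral. -/
theorem coeFn_intervalIntegral_ae_eq [IsProbabilityMeasure μ] {X : ℝ → S → ℝ} {η : ℝ → Lp ℝ 2 μ}
    (hm : ∀ t, Measurable (X t)) (hc : ∀ᵐ ω ∂μ, Continuous fun t => X t ω)
    (hη : ∀ t, η t =ᵐ[μ] X t) (hηc : Continuous η) {φ : ℝ → ℝ} (hφ : Continuous φ)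
    {s t : ℝ} (hst : s ≤ t) :
    ((∫ u in s..t, φ u • η u : Lp ℝ 2 μ) : S → ℝ) =ᵐ[μ] fun ω => ∫ u in s..t, φ u * X u ω := by
  obtain ⟨Y, hYm, hYc, hYX⟩ := exists_jointly_measurable_version hm hc
  have hηY : ∀ u, η u =ᵐ[μ] Y u := fun u => by
    filter_upwards [hη u, hYX] with ω h h'
    rw [h, h']
  suffices h : ((∫ u in s..t, φ u • η u : Lp ℝ 2 μ) : S → ℝ) =ᵐ[μ]
      fun ω => ∫ u in s..t, φ u * Y u ω by
    filter_upwards [h, hYX] with ω h h'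
    rw [h]
    simp only [h']
  have hjoint : Integrable (fun p : S × ℝ => φ p.2 * Y p.2 p.1)
      (μ.prod (volume.restrict (Set.uIoc s t))) := by
    have hmeas : Measurable fun p : S × ℝ => φ p.2 * Y p.2 p.1 :=
      (hφ.measurable.comp measurable_snd).mul hYm
    rw [integrable_prod_iff' hmeas.aestronglyMeasurable]
    have hi : ∀ u, Integrable (fun ω => φ u * Y u ω) μ := fun u =>
      ((((Lp.memLp (η u)).integrable (by norm_num)).congr (hηY u)).const_mul (φ u))
    refine ⟨Eventually.of_forall hi, ?_⟩
    have hb : IntegrableOn (fun u => |φ u| * ‖η u‖) (Set.uIoc s t) :=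
      (((hφ.abs.mul hηc.norm).integrableOn_Icc (a := s ⊓ t) (b := s ⊔ t))).mono_set
        Set.Ioc_subset_Icc_self
    refine hb.mono' ?_ (Eventually.of_forall fun u => ?_)
    · exact (hmeas.norm.stronglyMeasurable.integral_prod_left').aestronglyMeasurable
    · rw [Real.norm_of_nonneg (integral_nonneg fun _ => norm_nonneg _)]
      simp only [norm_mul, Real.norm_eq_abs (φ u)]
      rw [integral_const_mul]
      gcongr
      have h0 : ∫ ω, ‖Y u ω‖ ∂μ = ∫ ω, ‖η u ω‖ ∂μ :=
        integral_congr_ae ((hηY u).symm.fun_comp (‖·‖))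
      rw [h0, Lp.norm_def]
      have h1 : eLpNorm (η u) 1 μ ≤ eLpNorm (η u) 2 μ :=
        eLpNorm_le_eLpNorm_of_exponent_le (by norm_num) (Lp.aestronglyMeasurable _)
      have h2 := ENNReal.toReal_mono (Lp.eLpNorm_ne_top (η u)) h1
      rwa [eLpNorm_one_eq_lintegral_enorm, ← integral_norm_eq_lintegral_enorm
        (Lp.aestronglyMeasurable _)] at h2
  have hioc : Set.uIoc s t = Set.Ioc s t := Set.uIoc_of_le hst
  refine Integrable.ae_eq_of_forall_setIntegral_eq _ _ ((Lp.memLp _).integrable (by norm_num)) ?_ ?_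
  · have := hjoint.integral_prod_left
    simpa only [intervalIntegral.integral_of_le hst, hioc] using this
  -- Test both sides on a set `A`: pairing with its indicator commutes with the Bochner integral,
  -- and Fubini gives the same for the pathwise integral.
  · intro A hA _
    have hμA : μ A ≠ ⊤ := measure_ne_top _ _
    rw [← L2.inner_indicatorConstLp_one (𝕜 := ℝ) hA hμA]
    have hcont : Continuous fun u => φ u • η u := hφ.smul hηc
    have h1 := (innerSL ℝ (indicatorConstLp 2 hA hμA (1 : ℝ))).intervalIntegral_comp_comm
      (hcont.intervalIntegrable (μ := volume) s t)
    simp only [innerSL_apply_apply] at h1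
    rw [← h1]
    have h2 : ∀ u, inner ℝ (indicatorConstLp 2 hA hμA (1 : ℝ)) (φ u • η u) =
        ∫ ω in A, φ u * Y u ω ∂μ := fun u => by
      rw [L2.inner_indicatorConstLp_one]
      refine integral_congr_ae (ae_restrict_of_ae ?_)
      filter_upwards [Lp.coeFn_smul (φ u) (η u), hηY u] with ω h h'
      rw [h, Pi.smul_apply, h', smul_eq_mul]
    simp only [h2, intervalIntegral.integral_of_le hst]
    have h3 : Integrable (fun p : S × ℝ => φ p.2 * Y p.2 p.1)
        ((μ.restrict A).prod (volume.restrict (Set.Ioc s t))) := by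
      rw [hioc] at hjoint
      refine hjoint.mono_measure ?_
      exact Measure.prod_mono Measure.restrict_le_self le_rfl
    exact (integral_integral_swap h3).symm

end Pathwise

/-! ### Weak mixing of decaying sequences -/

/-- Add `N` of the vectors, spaced by `K + 1`. The sum pairs with `w` to `N c`, while its squared
norm is at most `N R² + N² ε` because only the diagonal escapes the decay. Cauchy–Schwarz for large
`N` then forces `c = 0`. -/
theorem eq_zero_of_forall_inner_eq {E : Type*} [NormedAddCommGroup E] [InnerProductSpace ℝ E]
    (w : E) (v : ℕ → E) {c R : ℝ} (hw : ∀ n, inner ℝ w (v n) = c) (hR : ∀ n, ‖v n‖ ≤ R)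
    (hv : ∀ ε > 0, ∃ K : ℕ, ∀ n m, n + K ≤ m → |inner ℝ (v n) (v m)| ≤ ε) : c = 0 := by
  by_contra hc
  have hc2 : 0 < c ^ 2 := by positivity
  -- Chosen so that `‖w‖² ε ≤ c² / 2`, leaving half of `c² N²` to beat the diagonal term; the `+ 1`
  -- covers `w = 0`.
  set ε := c ^ 2 / (2 * (‖w‖ ^ 2 + 1)) with hε
  have hεpos : 0 < ε := by positivity
  obtain ⟨K, hK⟩ := hv ε hεpos
  have key : ∀ N : ℕ, c ^ 2 * N ^ 2 ≤ ‖w‖ ^ 2 * (N * R ^ 2 + N ^ 2 * ε) := by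
    intro N
    set x := ∑ i ∈ Finset.range N, v (i * (K + 1)) with hx
    have h1 : inner ℝ w x = N * c := by
      rw [hx, inner_sum, Finset.sum_congr rfl fun i _ => hw _]
      simp
    have h2 : ‖x‖ ^ 2 ≤ N * R ^ 2 + N ^ 2 * ε := by
      rw [← real_inner_self_eq_norm_sq, hx, sum_inner]
      simp only [inner_sum]
      have h3 : ∀ i ∈ Finset.range N, ∀ j ∈ Finset.range N,
          inner ℝ (v (i * (K + 1))) (v (j * (K + 1))) ≤ (if i = j then R ^ 2 else 0) + ε := by
        intro i _ j _
        rcases lt_trichotomy i j with h | h | h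
        · rw [if_neg h.ne, zero_add]
          refine (le_abs_self _).trans (hK _ _ ?_)
          nlinarith
        · subst h
          rw [if_pos rfl, real_inner_self_eq_norm_sq]
          have := pow_le_pow_left₀ (norm_nonneg _) (hR (i * (K + 1))) 2
          linarith
        · rw [if_neg h.ne', zero_add, real_inner_comm]
          refine (le_abs_self _).trans (hK _ _ ?_)
          nlinarith
      refine (Finset.sum_le_sum fun i hi => Finset.sum_le_sum fun j hj => h3 i hi j hj).trans ?_
      simp only [Finset.sum_add_distrib, Finset.sum_ite_eq, Finset.sum_const, Finset.card_range]
      rw [Finset.sum_congr rfl fun i hi => if_pos hi]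
      simp only [Finset.sum_const, Finset.card_range, nsmul_eq_mul]
      apply le_of_eq
      ring
    have h3 := abs_real_inner_le_norm w x
    rw [h1] at h3
    have h4 : (N * c) ^ 2 ≤ (‖w‖ * ‖x‖) ^ 2 := by
      rw [← sq_abs (N * c)]
      exact pow_le_pow_left₀ (abs_nonneg _) h3 2
    calc c ^ 2 * N ^ 2 = (N * c) ^ 2 := by ring
      _ ≤ ‖w‖ ^ 2 * ‖x‖ ^ 2 := by rw [← mul_pow]; exact h4
      _ ≤ _ := by gcongr
  have hεw : ‖w‖ ^ 2 * ε ≤ c ^ 2 / 2 := by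
    rw [hε, mul_div_assoc', div_le_div_iff₀ (by positivity) (by norm_num)]
    nlinarith [sq_nonneg ‖w‖]
  obtain ⟨N, hN⟩ := exists_nat_gt (2 * (‖w‖ ^ 2 * R ^ 2) / c ^ 2)
  have hN' : 2 * (‖w‖ ^ 2 * R ^ 2) < N * c ^ 2 := by rwa [div_lt_iff₀ hc2] at hN
  have hNpos : (0 : ℝ) < N := lt_of_le_of_lt (by positivity) hN
  have h5 := key N
  have h6 : ‖w‖ ^ 2 * ε * N ^ 2 ≤ c ^ 2 / 2 * N ^ 2 := by gcongr
  have h7 : (2 * (‖w‖ ^ 2 * R ^ 2)) * N < (N * c ^ 2) * N := by gcongr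
  nlinarith

end FracField

end

noncomputable section

namespace FracField

/-! ### Trigonometric functions on the torus -/

section Wave

/-- The wave `s ↦ Re (u exp(i s))`. -/
def wave (u : ℂ) (s : ℝ) : ℝ := (u * Complex.exp (s * Complex.I)).re

theorem hasDerivAt_wave (u : ℂ) (s : ℝ) : HasDerivAt (wave u) (wave (u * Complex.I) s) s := by
  have h1 : HasDerivAt (fun s : ℝ => u * Complex.exp (s * Complex.I))
      (u * (Complex.exp (s * Complex.I) * (1 * Complex.I))) s :=
    (((Complex.ofRealCLM.hasDerivAt (x := s)).mul_const Complex.I).cexp).const_mul u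
  have h2 := (Complex.reCLM.hasFDerivAt.comp_hasDerivAt s h1)
  refine h2.congr_deriv ?_
  simp only [wave, Complex.reCLM_apply]
  congr 1
  ring

theorem iteratedDeriv_wave (n : ℕ) (u : ℂ) :
    iteratedDeriv n (wave u) = wave (u * Complex.I ^ n) := by
  induction n generalizing u with
  | zero => simp
  | succ n ih =>
    have : deriv (wave u) = wave (u * Complex.I) := funext fun s => (hasDerivAt_wave u s).deriv
    rw [iteratedDeriv_succ', this, ih, pow_succ', mul_assoc]

theorem contDiff_wave (n : WithTop ℕ∞) (u : ℂ) : ContDiff ℝ n (wave u) := by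
  have h : ContDiff ℝ n fun s : ℝ => u * Complex.exp (s * Complex.I) :=
    contDiff_const.mul ((Complex.ofRealCLM.contDiff.mul contDiff_const).cexp)
  exact Complex.reCLM.contDiff.comp h

namespace Mode

/-- The linear functional `⟨k, x⟩ = 2π ⟨n, x⟩`. -/
def phase (k : Mode) : (Fin 2 → ℝ) →L[ℝ] ℝ :=
  ∑ i, (2 * Real.pi * k.1 i) • ContinuousLinearMap.proj (R := ℝ) (φ := fun _ : Fin 2 => ℝ) i

theorem phase_single (k : Mode) (i : Fin 2) :
    k.phase (Pi.single i 1) = 2 * Real.pi * k.1 i := by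
  simp only [phase, _root_.sum_apply, _root_.smul_apply,
    ContinuousLinearMap.proj_apply, smul_eq_mul, Pi.single_apply, mul_ite, mul_one, mul_zero]
  simp

theorem mFourier_proj (k : Mode) (x : Fin 2 → ℝ) :
    UnitAddTorus.mFourier k.1 (proj x) = Complex.exp (k.phase x * Complex.I) := by
  have h : UnitAddTorus.mFourier k.1 (proj x) = ∏ i, fourier (k.1 i) ((x i : ℝ) : UnitAddCircle) :=
    rfl
  rw [h]
  simp only [fourier_coe_apply, ← Complex.exp_sum]
  congr 1
  simp only [phase, _root_.sum_apply, _root_.smul_apply,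
    ContinuousLinearMap.proj_apply, smul_eq_mul, Complex.ofReal_sum, Finset.sum_mul]
  refine Finset.sum_congr rfl fun i _ => ?_
  push_cast
  ring

theorem abs_le_length (k : Mode) (i : Fin 2) : 2 * Real.pi * |(k.1 i : ℝ)| ≤ k.length := by
  unfold length
  gcongr
  rw [← Real.sqrt_sq_eq_abs]
  refine Real.sqrt_le_sqrt ?_
  fin_cases i
  · simpa using sq_nonneg (k.1 1 : ℝ)
  · simpa using sq_nonneg (k.1 0 : ℝ)

theorem one_le_length (k : Mode) : 1 ≤ k.length := by
  obtain ⟨i, hi⟩ := Function.ne_iff.1 k.2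
  have h1 : (1 : ℝ) ≤ |(k.1 i : ℝ)| := by exact_mod_cast Int.one_le_abs hi
  refine le_trans ?_ (k.abs_le_length i)
  nlinarith [Real.pi_gt_three]

/-- `1` on the half plane of modes and `i` on its complement. -/
def unit (k : Mode) : ℂ := if k.Pos then 1 else Complex.I

theorem norm_unit (k : Mode) : ‖k.unit‖ = 1 := by
  unfold unit
  split_ifs <;> simp

end Mode

/-- The real trigonometric function `Re (u exp(i⟨k, x⟩))` on the torus. -/
def trigFun (u : ℂ) (k : Mode) (x : Torus) : ℝ := (u * UnitAddTorus.mFourier k.1 x).re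

theorem trigFun_comp_proj (u : ℂ) (k : Mode) : trigFun u k ∘ proj = wave u ∘ k.phase :=
  funext fun x => by simp only [trigFun, wave, Function.comp_apply, k.mFourier_proj]

theorem abs_trigFun_le (u : ℂ) (k : Mode) (x : Torus) : |trigFun u k x| ≤ ‖u‖ := by
  refine (Complex.abs_re_le_norm _).trans ?_
  rw [norm_mul]
  have h := (UnitAddTorus.mFourier k.1).norm_coe_le_norm x
  rw [UnitAddTorus.mFourier_norm] at h
  exact mul_le_of_le_one_right (norm_nonneg _) h

theorem continuous_trigFun (u : ℂ) (k : Mode) : Continuous (trigFun u k) := by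
  unfold trigFun
  fun_prop

/-- The real trigonometric basis, in `C^m`. -/
def trig (m : ℕ) (k : Mode) : Cm m :=
  ⟨trigFun k.unit k, by
    change ContDiff ℝ m (trigFun k.unit k ∘ proj)
    rw [trigFun_comp_proj]
    exact (contDiff_wave _ _).comp k.phase.contDiff⟩

theorem trig_apply (m : ℕ) (k : Mode) (x : Torus) : trig m k x = trigFun k.unit k x := rfl

/-- The factor by which `∂₁ᵃ ∂₂ᵇ` scales a wave. -/
def derivFactor (a b : ℕ) (k : Mode) : ℝ :=
  ∏ i : Fin (a + b), k.phase (if (i : ℕ) < a then Pi.single 0 1 else Pi.single 1 1)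

theorem abs_derivFactor_le (a b : ℕ) (k : Mode) : |derivFactor a b k| ≤ k.length ^ (a + b) := by
  have h : ∀ i : Fin (a + b),
      |k.phase (if (i : ℕ) < a then Pi.single 0 1 else Pi.single 1 1)| ≤ k.length := by
    intro i
    have h2 : ∀ j, |k.phase (Pi.single j 1)| ≤ k.length := fun j => by
      rw [k.phase_single, abs_mul, abs_of_pos (by positivity)]
      exact k.abs_le_length j
    split_ifs <;> exact h2 _
  unfold derivFactor
  rw [Finset.abs_prod]
  refine (Finset.prod_le_prod (fun _ _ => abs_nonneg _) fun i _ => h i).trans ?_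
  simp

/-- Along a line the function is a wave: each derivative rotates the amplitude by `i` and multiplies
by one component of the wave vector. -/
theorem partialDeriv_trig {m a b : ℕ} (k : Mode) (x : Fin 2 → ℝ) :
    partialDeriv a b (trig m k).lift x =
      derivFactor a b k * trigFun (k.unit * Complex.I ^ (a + b)) k (proj x) := by
  have h1 : (trig m k).lift = wave k.unit ∘ k.phase := trigFun_comp_proj _ _
  unfold partialDeriv
  rw [h1, ContinuousLinearMap.iteratedFDeriv_comp_right (i := a + b) (n := (a + b : ℕ)) k.phase
    (contDiff_wave _ _) x le_rfl]
  rw [ContinuousMultilinearMap.compContinuousLinearMap_apply,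
    iteratedFDeriv_apply_eq_iteratedDeriv_mul_prod, iteratedDeriv_wave, smul_eq_mul]
  congr 1
  exact (congrFun (trigFun_comp_proj (k.unit * Complex.I ^ (a + b)) k) x).symm

end Wave

/-! ### The supremum of a trigonometric polynomial -/

section Nikolskii

open UnitAddTorus

/-- The exponential `mFourier n`, in `L²`. -/
def mono (n : Fin 2 → ℤ) : Lp ℂ 2 torusMeasure :=
  ContinuousMap.toLp 2 torusMeasure ℂ (mFourier n)

theorem orthonormal_mono : Orthonormal ℂ mono := by
  classical
  rw [orthonormal_iff_ite]
  intro n n'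
  unfold mono
  rw [ContinuousMap.inner_toLp]
  have h : ∀ x, mFourier n' x * (starRingEnd ℂ) (mFourier n x) = mFourier (n' + -n) x := fun x => by
    rw [mFourier_add, mFourier_neg]
  simp only [h]
  split_ifs with h0
  · subst h0
    rw [add_neg_cancel, mFourier_zero]
    simp
  · have h1 : n' + -n ≠ 0 := fun h => h0 (by rw [← sub_eq_add_neg] at h; exact (sub_eq_zero.1 h).symm)
    exact integral_mFourier_eq_zero ⟨_, h1⟩

/-- The frequencies with components at most `N`. -/
def freqBox (N : ℕ) : Finset (Fin 2 → ℤ) := Fintype.piFinset fun _ => Finset.Icc (-N : ℤ) N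

theorem mem_freqBox {N : ℕ} {n : Fin 2 → ℤ} : n ∈ freqBox N ↔ ∀ i, |n i| ≤ N := by
  simp only [freqBox, Fintype.mem_piFinset, Finset.mem_Icc, abs_le]

theorem card_freqBox (N : ℕ) : (freqBox N).card = (2 * N + 1) ^ 2 := by
  simp only [freqBox, Fintype.card_piFinset, Int.card_Icc, Finset.prod_const, Finset.card_univ,
    Fintype.card_fin]
  congr 1
  omega

/-- Trigonometric polynomials with frequencies in a box. -/
def trigPoly (N : ℕ) : Submodule ℂ C(Torus, ℂ) :=
  Submodule.span ℂ (mFourier '' (freqBox N : Set (Fin 2 → ℤ)))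

theorem mFourier_mem_trigPoly {N : ℕ} {n : Fin 2 → ℤ} (h : ∀ i, |n i| ≤ N) :
    mFourier n ∈ trigPoly N :=
  Submodule.subset_span ⟨n, mem_freqBox.2 h, rfl⟩

theorem mul_mem_trigPoly {N M : ℕ} {f g : C(Torus, ℂ)} (hf : f ∈ trigPoly N)
    (hg : g ∈ trigPoly M) : f * g ∈ trigPoly (N + M) := by
  have h : trigPoly N * trigPoly M ≤ trigPoly (N + M) := by
    unfold trigPoly
    rw [Submodule.span_mul_span]
    refine Submodule.span_mono ?_
    rintro _ ⟨_, ⟨n, hn, rfl⟩, _, ⟨n', hn', rfl⟩, rfl⟩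
    refine ⟨n + n', mem_freqBox.2 fun i => ?_, ?_⟩
    · have h1 := mem_freqBox.1 hn i
      have h2 := mem_freqBox.1 hn' i
      rw [Pi.add_apply]
      push_cast
      exact (abs_add_le _ _).trans (add_le_add h1 h2)
    · ext x
      exact mFourier_add
  exact h (Submodule.mul_mem_mul hf hg)

theorem pow_mem_trigPoly {N : ℕ} {f : C(Torus, ℂ)} (hf : f ∈ trigPoly N) (p : ℕ) :
    f ^ p ∈ trigPoly (p * N) := by
  induction p with
  | zero =>
    rw [pow_zero, Nat.zero_mul, ← mFourier_zero]
    exact mFourier_mem_trigPoly fun i => by simp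
  | succ p ih =>
    rw [pow_succ, Nat.succ_mul]
    exact mul_mem_trigPoly ih hf

/-- Bound the value by the sum of the moduli of the Fourier coefficients, then use Cauchy–Schwarz
over the `(2N + 1)²` frequencies and Parseval. -/
theorem norm_sq_le_of_mem_trigPoly {N : ℕ} {f : C(Torus, ℂ)} (hf : f ∈ trigPoly N) (x : Torus) :
    ‖f x‖ ^ 2 ≤ (2 * N + 1) ^ 2 * ∫ y, ‖f y‖ ^ 2 ∂torusMeasure := by
  obtain ⟨c, rfl⟩ := Submodule.mem_span_image_finset_iff_exists_fun ℂ |>.1 hf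
  set f : C(Torus, ℂ) := ∑ n : freqBox N, c n • mFourier n.1 with hfdef
  have h1 : ∫ y, ‖f y‖ ^ 2 ∂torusMeasure = ∑ n : freqBox N, ‖c n‖ ^ 2 := by
    have h2 : ContinuousMap.toLp 2 torusMeasure ℂ f = ∑ n : freqBox N, c n • mono n.1 := by
      rw [hfdef, map_sum]
      exact Finset.sum_congr rfl fun n _ => map_smul _ _ _
    have h3 : inner ℂ (ContinuousMap.toLp 2 torusMeasure ℂ f)
        (ContinuousMap.toLp 2 torusMeasure ℂ f) = ((∑ n : freqBox N, ‖c n‖ ^ 2 : ℝ) : ℂ) := by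
      rw [h2]
      refine ((orthonormal_mono.comp _ Subtype.val_injective).inner_sum c c Finset.univ).trans ?_
      push_cast
      exact Finset.sum_congr rfl fun n _ => Complex.conj_mul' _
    rw [ContinuousMap.inner_toLp] at h3
    have h4 : ∀ y, f y * (starRingEnd ℂ) (f y) = ((‖f y‖ ^ 2 : ℝ) : ℂ) := fun y => by
      rw [Complex.mul_conj']
      push_cast
      rfl
    simp only [h4] at h3
    rw [integral_complex_ofReal] at h3
    exact_mod_cast h3
  have h5 : ‖f x‖ ≤ ∑ n : freqBox N, ‖c n‖ := by
    rw [hfdef, ContinuousMap.sum_apply]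
    refine (norm_sum_le _ _).trans (Finset.sum_le_sum fun n _ => ?_)
    rw [ContinuousMap.smul_apply, norm_smul]
    have h := (mFourier n.1).norm_coe_le_norm x
    rw [mFourier_norm] at h
    exact mul_le_of_le_one_right (norm_nonneg _) h
  have h6 := pow_le_pow_left₀ (norm_nonneg _) h5 2
  rw [h1]
  refine h6.trans ((sq_sum_le_card_mul_sum_sq).trans_eq ?_)
  rw [Finset.card_univ, Fintype.card_coe, card_freqBox]
  push_cast
  rfl

/-- A Nikolskii type inequality. -/
theorem pow_le_integral_of_mem_trigPoly {N : ℕ} {g : Torus → ℝ} (hg : Continuous g)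
    (hf : (⟨fun x => (g x : ℂ), by fun_prop⟩ : C(Torus, ℂ)) ∈ trigPoly N) (p : ℕ) (x : Torus) :
    |g x| ^ (2 * p) ≤ (2 * (p * N : ℕ) + 1) ^ 2 * ∫ y, |g y| ^ (2 * p) ∂torusMeasure := by
  -- The `p`-th power has frequencies up to `p N`, so its `L²` bound is an `L^{2p}` bound for `g` in
  -- which the loss stays of order `N²` for every `p`.
  have h := norm_sq_le_of_mem_trigPoly (pow_mem_trigPoly hf p) x
  have h2 : ∀ y, ‖((⟨fun x => (g x : ℂ), by fun_prop⟩ : C(Torus, ℂ)) ^ p) y‖ ^ 2 =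
      |g y| ^ (2 * p) := fun y => by
    rw [ContinuousMap.pow_apply, norm_pow, ← pow_mul, mul_comm p 2]
    simp
  simpa only [h2] using h

end Nikolskii

end FracField

end

noncomputable section

namespace FracField

/-! ### Random trigonometric polynomials -/

/-- The number of partial derivatives of order at most `m`. -/
def derivCount (m : ℕ) : ℕ :=
  ((Finset.range (m + 1) ×ˢ Finset.range (m + 1)).filter
    (fun p : ℕ × ℕ => p.1 + p.2 ≤ m)).card

theorem Cm.norm_pow_le {m : ℕ} (f : Cm m) {q : ℕ} (hq : q ≠ 0) {A : ℝ}
    (h : ∀ a b, a + b ≤ m → ∀ x, |partialDeriv a b f.lift x| ^ q ≤ A) :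
    ‖f‖ ^ q ≤ derivCount m ^ q * A := by
  have hA : 0 ≤ A := (pow_nonneg (abs_nonneg _) q).trans (h 0 0 (Nat.zero_le m) 0)
  have h1 : ‖f‖ ≤ derivCount m * A ^ (1 / q : ℝ) := by
    refine f.norm_le_card_mul fun a b hab => ?_
    refine Cm.norm_deriv_le_of_forall hab (by positivity) fun x => ?_
    rw [Real.norm_eq_abs, ← Real.pow_rpow_inv_natCast (abs_nonneg (partialDeriv a b f.lift x)) hq,
      one_div]
    exact Real.rpow_le_rpow (by positivity) (h a b hab x) (by positivity)
  refine (pow_le_pow_left₀ (norm_nonneg _) h1 q).trans_eq ?_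
  rw [mul_pow, one_div, Real.rpow_inv_natCast_pow hA hq]

section TrigSum

variable {S : Type*} [MeasurableSpace S] {μ : Measure S}

/-- The random function `∑_{k ∈ F} Y_k trig_k`. -/
def trigSum (m : ℕ) (F : Finset Mode) (Y : Mode → Lp ℝ 2 μ) (ω : S) : Cm m :=
  ∑ k ∈ F, Y k ω • trig m k

theorem measurable_trigSum (m : ℕ) (F : Finset Mode) (Y : Mode → Lp ℝ 2 μ) :
    Measurable (trigSum m F Y) := by
  unfold trigSum
  exact Finset.measurable_sum _ fun k _ =>
    (Lp.stronglyMeasurable (Y k)).measurable.smul_const (trig m k)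

/-- The coefficient of `Y_k` in `∂₁ᵃ ∂₂ᵇ ∑_k Y_k trig_k` at a point. -/
def trigCoeff (a b : ℕ) (k : Mode) (y : Torus) : ℝ :=
  derivFactor a b k * trigFun (k.unit * Complex.I ^ (a + b)) k y

theorem continuous_trigCoeff (a b : ℕ) (k : Mode) : Continuous (trigCoeff a b k) :=
  continuous_const.mul (continuous_trigFun _ _)

theorem sq_trigCoeff_le {m a b : ℕ} (h : a + b ≤ m) (k : Mode) (y : Torus) :
    trigCoeff a b k y ^ 2 ≤ k.length ^ (2 * m) := by
  have h1 : |trigCoeff a b k y| ≤ k.length ^ m := by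
    unfold trigCoeff
    rw [abs_mul]
    have h2 := abs_trigFun_le (k.unit * Complex.I ^ (a + b)) k y
    rw [norm_mul, k.norm_unit, norm_pow, Complex.norm_I, one_pow, one_mul] at h2
    calc _ ≤ k.length ^ (a + b) * 1 :=
          mul_le_mul (abs_derivFactor_le a b k) h2 (abs_nonneg _)
            (pow_nonneg (zero_le_one.trans k.one_le_length) _)
      _ ≤ _ := by
          rw [mul_one]
          exact pow_le_pow_right₀ k.one_le_length h
  rw [← sq_abs, mul_comm 2 m, pow_mul]
  exact pow_le_pow_left₀ (abs_nonneg _) h1 2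

theorem partialDeriv_trigSum {m a b : ℕ} (h : a + b ≤ m) (F : Finset Mode) (Y : Mode → Lp ℝ 2 μ)
    (ω : S) (x : Fin 2 → ℝ) :
    partialDeriv a b (trigSum m F Y ω).lift x = ∑ k ∈ F, Y k ω * trigCoeff a b k (proj x) := by
  rw [← Cm.partialDerivLM_apply a b h, trigSum, map_sum]
  refine Finset.sum_congr rfl fun k _ => ?_
  rw [map_smul, Cm.partialDerivLM_apply, partialDeriv_trig, smul_eq_mul, trigCoeff]

theorem sum_trigCoeff_mem_trigPoly {N : ℕ} (a b : ℕ) {F : Finset Mode}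
    (hF : ∀ k ∈ F, ∀ i, |k.1 i| ≤ (N : ℤ)) (r : Mode → ℝ)
    (hc : Continuous fun y => ((∑ k ∈ F, r k * trigCoeff a b k y : ℝ) : ℂ)) :
    (⟨fun y => ((∑ k ∈ F, r k * trigCoeff a b k y : ℝ) : ℂ), hc⟩ : C(Torus, ℂ)) ∈ trigPoly N := by
  set u : Mode → ℂ := fun k => k.unit * Complex.I ^ (a + b) with hu
  have h : (⟨fun y => ((∑ k ∈ F, r k * trigCoeff a b k y : ℝ) : ℂ), hc⟩ : C(Torus, ℂ)) =
      ∑ k ∈ F, ((r k * derivFactor a b k : ℝ) : ℂ) • ((u k / 2) • UnitAddTorus.mFourier k.1 +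
        ((starRingEnd ℂ) (u k) / 2) • UnitAddTorus.mFourier (-k.1)) := by
    ext y
    rw [ContinuousMap.sum_apply]
    simp only [ContinuousMap.coe_mk, Complex.ofReal_sum]
    refine Finset.sum_congr rfl fun k _ => ?_
    simp only [ContinuousMap.smul_apply, ContinuousMap.add_apply, UnitAddTorus.mFourier_neg,
      trigCoeff, trigFun, smul_eq_mul]
    push_cast
    rw [Complex.re_eq_add_conj, map_mul]
    ring
  rw [h]
  refine Submodule.sum_mem _ fun k hk => Submodule.smul_mem _ _ (Submodule.add_mem _
    (Submodule.smul_mem _ _ (mFourier_mem_trigPoly (hF k hk)))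
    (Submodule.smul_mem _ _ (mFourier_mem_trigPoly fun i => ?_)))
  rw [Pi.neg_apply, abs_neg]
  exact hF k hk i

theorem norm_trigSum_pow_le {m N p : ℕ} (hp : p ≠ 0) {F : Finset Mode}
    (hF : ∀ k ∈ F, ∀ i, |k.1 i| ≤ (N : ℤ)) (Y : Mode → Lp ℝ 2 μ) (ω : S) :
    ‖trigSum m F Y ω‖ ^ (2 * p) ≤ derivCount m ^ (2 * p) * ((2 * (p * N : ℕ) + 1) ^ 2 *
      ∑ q ∈ (Finset.range (m + 1) ×ˢ Finset.range (m + 1)).filter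
        (fun p : ℕ × ℕ => p.1 + p.2 ≤ m),
        ∫ y, |∑ k ∈ F, Y k ω * trigCoeff q.1 q.2 k y| ^ (2 * p) ∂torusMeasure) := by
  refine Cm.norm_pow_le _ (by omega) fun a b hab x => ?_
  rw [partialDeriv_trigSum hab]
  have hc : Continuous fun y => ∑ k ∈ F, Y k ω * trigCoeff a b k y :=
    continuous_finsetSum _ fun k _ => continuous_const.mul (continuous_trigCoeff a b k)
  refine (pow_le_integral_of_mem_trigPoly (N := N) hc
    (sum_trigCoeff_mem_trigPoly a b hF (fun k => Y k ω) _) p (proj x)).trans ?_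
  gcongr
  refine Finset.single_le_sum (f := fun q : ℕ × ℕ =>
    ∫ y, |∑ k ∈ F, Y k ω * trigCoeff q.1 q.2 k y| ^ (2 * p) ∂torusMeasure)
    (fun q _ => integral_nonneg fun y => by positivity) (a := (a, b)) ?_
  simp only [Finset.mem_filter, Finset.mem_product, Finset.mem_range]
  omega

/-- At a fixed point the derivative of the random sum belongs to the Gaussian space, and
orthogonality of the coefficients bounds its variance; `lintegral_enorm_pow` yields the moment. -/
theorem lintegral_pow_trigCoeff_sum_le [IsProbabilityMeasure μ] {H : ℝ} {β : Mode → ℝ → S → ℂ}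
    (hβ : IsNoise μ H β) {m a b : ℕ} (h : a + b ≤ m) (p : ℕ) (F : Finset Mode)
    {Y : Mode → Lp ℝ 2 μ} (hY : ∀ k, Y k ∈ hβ.space)
    (hYo : ∀ k l, k ≠ l → inner ℝ (Y k) (Y l) = 0) (y : Torus) :
    ∫⁻ ω, ‖∑ k ∈ F, Y k ω * trigCoeff a b k y‖ₑ ^ (2 * p) ∂μ ≤
      ENNReal.ofReal ((∑ k ∈ F, ‖Y k‖ ^ 2 * k.length ^ (2 * m)) ^ p) *
        ∫⁻ x, ‖x‖ₑ ^ (2 * p) ∂(gaussianReal 0 1) := by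
  set w : Lp ℝ 2 μ := ∑ k ∈ F, trigCoeff a b k y • Y k with hw
  have hwm : w ∈ hβ.space := Submodule.sum_mem _ fun k _ => Submodule.smul_mem _ _ (hY k)
  have hwae : w =ᵐ[μ] fun ω => ∑ k ∈ F, Y k ω * trigCoeff a b k y := by
    have h1 : w =ᵐ[μ] fun ω => ∑ k ∈ F, (trigCoeff a b k y • Y k : Lp ℝ 2 μ) ω :=
      Lp.coeFn_fun_finsetSum _ _
    have h2 : ∀ᵐ ω ∂μ, ∀ k ∈ F,
        (trigCoeff a b k y • Y k : Lp ℝ 2 μ) ω = Y k ω * trigCoeff a b k y :=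
      (Finset.eventually_all _).2 fun k _ => by
        filter_upwards [Lp.coeFn_smul (trigCoeff a b k y) (Y k)] with ω h
        rw [h, Pi.smul_apply, smul_eq_mul, mul_comm]
    filter_upwards [h1, h2] with ω h h'
    rw [h]
    exact Finset.sum_congr rfl h'
  have hn : ‖w‖ ^ 2 ≤ ∑ k ∈ F, ‖Y k‖ ^ 2 * k.length ^ (2 * m) := by
    rw [← real_inner_self_eq_norm_sq, hw, sum_inner]
    refine Finset.sum_le_sum fun k hk => ?_
    rw [inner_sum, Finset.sum_eq_single_of_mem k hk fun l _ hl => by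
      rw [real_inner_smul_left, real_inner_smul_right, hYo k l hl.symm, mul_zero, mul_zero],
      real_inner_smul_left, real_inner_smul_right, real_inner_self_eq_norm_sq]
    calc _ = ‖Y k‖ ^ 2 * trigCoeff a b k y ^ 2 := by ring
      _ ≤ _ := by gcongr; exact sq_trigCoeff_le h k y
  have h1 : ∫⁻ ω, ‖∑ k ∈ F, Y k ω * trigCoeff a b k y‖ₑ ^ (2 * p) ∂μ =
      ∫⁻ ω, ‖w ω‖ₑ ^ (2 * p) ∂μ :=
    lintegral_congr_ae (hwae.symm.fun_comp fun r => ‖r‖ₑ ^ (2 * p))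
  rw [h1, hβ.lintegral_enorm_pow hwm]
  gcongr
  rw [← ofReal_norm, ← ENNReal.ofReal_pow (norm_nonneg _), pow_mul]
  exact ENNReal.ofReal_le_ofReal (pow_le_pow_left₀ (sq_nonneg _) hn p)

/-- The constant in the moment estimate for random trigonometric polynomials. -/
def momentConst (m p : ℕ) : ℝ :=
  derivCount m ^ (2 * p) * derivCount m * (∫⁻ x, ‖x‖ₑ ^ (2 * p) ∂(gaussianReal 0 1)).toReal

/-- After the Nikolskii bound the supremum over the torus is replaced by an integral, which may be
exchanged with the expectation; the pointwise Gaussian moments are then bounded uniformly in the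
point. -/
theorem lintegral_norm_trigSum_pow_le [IsProbabilityMeasure μ] {H : ℝ} {β : Mode → ℝ → S → ℂ}
    (hβ : IsNoise μ H β) {m N p : ℕ} (hp : p ≠ 0) {F : Finset Mode}
    (hF : ∀ k ∈ F, ∀ i, |k.1 i| ≤ (N : ℤ)) {Y : Mode → Lp ℝ 2 μ} (hY : ∀ k, Y k ∈ hβ.space)
    (hYo : ∀ k l, k ≠ l → inner ℝ (Y k) (Y l) = 0) :
    ∫⁻ ω, ‖trigSum m F Y ω‖ₑ ^ (2 * p) ∂μ ≤ ENNReal.ofReal (momentConst m p *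
      (2 * (p * N : ℕ) + 1) ^ 2 * (∑ k ∈ F, ‖Y k‖ ^ 2 * k.length ^ (2 * m)) ^ p) := by
  set I := (Finset.range (m + 1) ×ˢ Finset.range (m + 1)).filter
    (fun p : ℕ × ℕ => p.1 + p.2 ≤ m) with hI
  set σ := (∑ k ∈ F, ‖Y k‖ ^ 2 * k.length ^ (2 * m)) ^ p with hσ
  set M := ∫⁻ x, ‖x‖ₑ ^ (2 * p) ∂(gaussianReal 0 1) with hM
  have hMtop : M ≠ ⊤ := lintegral_enorm_pow_gaussianReal_ne_top _
  have hσ0 : 0 ≤ σ := pow_nonneg (Finset.sum_nonneg fun k _ => mul_nonneg (sq_nonneg _)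
    (pow_nonneg (zero_le_one.trans k.one_le_length) _)) _
  have hcont : ∀ (q : ℕ × ℕ) ω, Continuous fun y => ∑ k ∈ F, Y k ω * trigCoeff q.1 q.2 k y :=
    fun q ω => continuous_finsetSum _ fun k _ => continuous_const.mul (continuous_trigCoeff _ _ k)
  have h1 : ∀ ω, ‖trigSum m F Y ω‖ₑ ^ (2 * p) ≤
      ENNReal.ofReal (derivCount m ^ (2 * p) * (2 * (p * N : ℕ) + 1) ^ 2) *
        ∑ q ∈ I, ∫⁻ y, ‖∑ k ∈ F, Y k ω * trigCoeff q.1 q.2 k y‖ₑ ^ (2 * p) ∂torusMeasure := by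
    intro ω
    have h2 : ∀ q ∈ I, ∫⁻ y, ‖∑ k ∈ F, Y k ω * trigCoeff q.1 q.2 k y‖ₑ ^ (2 * p) ∂torusMeasure =
        ENNReal.ofReal (∫ y, |∑ k ∈ F, Y k ω * trigCoeff q.1 q.2 k y| ^ (2 * p) ∂torusMeasure) := by
      intro q _
      have hi : Integrable (fun y => |∑ k ∈ F, Y k ω * trigCoeff q.1 q.2 k y| ^ (2 * p))
          torusMeasure :=
        ((hcont q ω).abs.pow _).integrable_of_hasCompactSupport
          (HasCompactSupport.of_compactSpace _)
      rw [ofReal_integral_eq_lintegral_ofReal hi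
        (Eventually.of_forall fun y => pow_nonneg (abs_nonneg _) _)]
      refine lintegral_congr fun y => ?_
      rw [ENNReal.ofReal_pow (abs_nonneg _), ← Real.norm_eq_abs, ofReal_norm]
    rw [Finset.sum_congr rfl h2, ← ENNReal.ofReal_sum_of_nonneg fun q _ =>
      integral_nonneg fun y => by positivity, ← ENNReal.ofReal_mul (by positivity),
      ← ofReal_norm, ← ENNReal.ofReal_pow (norm_nonneg _), mul_assoc]
    exact ENNReal.ofReal_le_ofReal (norm_trigSum_pow_le hp hF Y ω)
  have hjm : ∀ q : ℕ × ℕ, Measurable fun z : S × Torus =>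
      ‖∑ k ∈ F, Y k z.1 * trigCoeff q.1 q.2 k z.2‖ₑ ^ (2 * p) := by
    intro q
    refine Measurable.pow_const (Measurable.enorm (Finset.measurable_sum _ fun k _ => ?_)) _
    exact ((Lp.stronglyMeasurable (Y k)).measurable.comp measurable_fst).mul
      ((continuous_trigCoeff _ _ k).measurable.comp measurable_snd)
  calc ∫⁻ ω, ‖trigSum m F Y ω‖ₑ ^ (2 * p) ∂μ
      ≤ ∫⁻ ω, ENNReal.ofReal (derivCount m ^ (2 * p) * (2 * (p * N : ℕ) + 1) ^ 2) *
        ∑ q ∈ I, ∫⁻ y, ‖∑ k ∈ F, Y k ω * trigCoeff q.1 q.2 k y‖ₑ ^ (2 * p) ∂torusMeasure ∂μ :=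
        lintegral_mono h1
    _ = ENNReal.ofReal (derivCount m ^ (2 * p) * (2 * (p * N : ℕ) + 1) ^ 2) *
        ∑ q ∈ I, ∫⁻ y, ∫⁻ ω, ‖∑ k ∈ F, Y k ω * trigCoeff q.1 q.2 k y‖ₑ ^ (2 * p) ∂μ
          ∂torusMeasure := by
        rw [lintegral_const_mul _ (Finset.measurable_sum _ fun q _ =>
          (hjm q).lintegral_prod_right'), lintegral_finsetSum _ fun q _ =>
          (hjm q).lintegral_prod_right']
        congr 1
        refine Finset.sum_congr rfl fun q _ => ?_
        exact lintegral_lintegral_swap (hjm q).aemeasurable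
    _ ≤ ENNReal.ofReal (derivCount m ^ (2 * p) * (2 * (p * N : ℕ) + 1) ^ 2) *
        ∑ q ∈ I, ∫⁻ _, ENNReal.ofReal σ * M ∂torusMeasure := by
        gcongr with q hq y
        exact lintegral_pow_trigCoeff_sum_le hβ (Finset.mem_filter.1 hq).2 p F hY hYo y
    _ = _ := by
        rw [Finset.sum_congr rfl fun q _ => by
          rw [lintegral_const, measure_univ, mul_one], Finset.sum_const, nsmul_eq_mul,
          show I.card = derivCount m from rfl, ← ENNReal.ofReal_toReal hMtop,
          ← ENNReal.ofReal_natCast, ← ENNReal.ofReal_mul hσ0,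
          ← ENNReal.ofReal_mul (by positivity), ← ENNReal.ofReal_mul (by positivity)]
        congr 1
        unfold momentConst
        ring

end TrigSum

end FracField

end

noncomputable section

namespace FracField

/-! ### Random fields with given Fourier coefficients -/

/-- The modes with components less than `2^J`. -/
def modeBall (J : ℕ) : Finset Mode :=
  (Fintype.piFinset fun _ : Fin 2 => Finset.Ioo (-2 ^ J : ℤ) (2 ^ J)).subtype (· ≠ 0)

theorem mem_modeBall {J : ℕ} {k : Mode} : k ∈ modeBall J ↔ ∀ i, |k.1 i| < 2 ^ J := by
  simp only [modeBall, Finset.mem_subtype, Fintype.mem_piFinset, Finset.mem_Ioo, abs_lt]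

theorem monotone_modeBall : Monotone modeBall := fun J J' h k hk =>
  mem_modeBall.2 fun i => (mem_modeBall.1 hk i).trans_le (pow_le_pow_right₀ (by norm_num) h)

theorem tendsto_modeBall : Tendsto modeBall atTop atTop := by
  refine tendsto_atTop_finset_of_monotone monotone_modeBall fun k => ?_
  refine ⟨(|k.1 0| + |k.1 1|).toNat, mem_modeBall.2 fun i => ?_⟩
  have h1 : |k.1 i| ≤ |k.1 0| + |k.1 1| := by
    fin_cases i
    · simp
    · simp
  have h2 : ((|k.1 0| + |k.1 1|).toNat : ℤ) = |k.1 0| + |k.1 1| :=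
    Int.toNat_of_nonneg (by positivity)
  have h3 : (((|k.1 0| + |k.1 1|).toNat : ℕ) : ℤ) < 2 ^ (|k.1 0| + |k.1 1|).toNat := by
    exact_mod_cast Nat.lt_two_pow_self
  omega

/-- A dyadic shell of modes. -/
def modeShell (j : ℕ) : Finset Mode := modeBall (j + 1) \ modeBall j

theorem modeBall_zero : modeBall 0 = ∅ := by
  refine Finset.eq_empty_of_forall_notMem fun k hk => k.2 (funext fun i => ?_)
  have := mem_modeBall.1 hk i
  rw [pow_zero, Int.abs_lt_one_iff] at this
  exact this

theorem sum_range_modeShell {E : Type*} [AddCommMonoid E] (f : Mode → E) (J : ℕ) :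
    ∑ j ∈ Finset.range J, ∑ k ∈ modeShell j, f k = ∑ k ∈ modeBall J, f k := by
  induction J with
  | zero => simp [modeBall_zero]
  | succ J ih =>
    rw [Finset.sum_range_succ, ih, add_comm]
    exact Finset.sum_sdiff (monotone_modeBall (Nat.le_succ J))

theorem le_length_of_mem_modeShell {j : ℕ} {k : Mode} (hk : k ∈ modeShell j) :
    (2 : ℝ) ^ j ≤ k.length := by
  have h := (Finset.mem_sdiff.1 hk).2
  rw [mem_modeBall] at h
  push Not at h
  obtain ⟨i, hi⟩ := h
  have h1 : (2 : ℝ) ^ j ≤ |(k.1 i : ℝ)| := by exact_mod_cast hi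
  have h2 := k.abs_le_length i
  have h3 : |(k.1 i : ℝ)| ≤ 2 * Real.pi * |(k.1 i : ℝ)| :=
    le_mul_of_one_le_left (abs_nonneg _) (by nlinarith [Real.pi_gt_three])
  linarith

theorem abs_le_of_mem_modeShell {j : ℕ} {k : Mode} (hk : k ∈ modeShell j) (i : Fin 2) :
    |k.1 i| ≤ ((2 ^ (j + 1) : ℕ) : ℤ) := by
  push_cast
  exact (mem_modeBall.1 (Finset.mem_sdiff.1 hk).1 i).le

section Field

variable {S : Type*} [MeasurableSpace S] {μ : Measure S}

theorem eLpNorm_le_of_lintegral_pow_le {E : Type*} [NormedAddCommGroup E] {f : S → E} {q : ℕ}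
    (hq : q ≠ 0) {A : ℝ} (hA : 0 ≤ A)
    (h : ∫⁻ ω, ‖f ω‖ₑ ^ q ∂μ ≤ ENNReal.ofReal (A ^ q)) :
    eLpNorm f (q : ENNReal) μ ≤ ENNReal.ofReal A := by
  rw [eLpNorm_eq_lintegral_rpow_enorm_toReal (by exact_mod_cast hq) (by simp)]
  simp only [ENNReal.toReal_natCast, ENNReal.rpow_natCast]
  have h1 := ENNReal.rpow_le_rpow h (z := 1 / (q : ℝ)) (by positivity)
  refine h1.trans_eq ?_
  rw [ENNReal.ofReal_pow hA, one_div, ← ENNReal.rpow_natCast, ← ENNReal.rpow_mul,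
    mul_inv_cancel₀ (by exact_mod_cast hq), ENNReal.rpow_one]

/-- On the shell `|k| ≥ 2 ^ j`, so the extra weight `|k| ^ (2δ)` in the convergent series buys the
factor `2 ^ (-2 δ j)`. -/
theorem sum_modeShell_le {m : ℕ} {δ τ : ℝ} (hδ : 0 < δ) {r : Mode → ℝ}
    (hrs : Summable fun k : Mode => r k ^ 2 * k.length ^ (2 * (m : ℝ) + 2 * δ))
    {Y : Mode → Lp ℝ 2 μ} (hY : ∀ k, ‖Y k‖ ≤ τ * r k) (j : ℕ) :
    ∑ k ∈ modeShell j, ‖Y k‖ ^ 2 * k.length ^ (2 * m) ≤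
      τ ^ 2 * (((2 : ℝ) ^ j) ^ (-(2 * δ)) *
        ∑' k : Mode, r k ^ 2 * k.length ^ (2 * (m : ℝ) + 2 * δ)) := by
  have h1 : ∀ k ∈ modeShell j, ‖Y k‖ ^ 2 * k.length ^ (2 * m) ≤ τ ^ 2 * (((2 : ℝ) ^ j) ^ (-(2 * δ)) *
      (r k ^ 2 * k.length ^ (2 * (m : ℝ) + 2 * δ))) := by
    intro k hk
    have hl : 0 < k.length := zero_lt_one.trans_le k.one_le_length
    have h2 : k.length ^ (2 * m) = k.length ^ (-(2 * δ)) * k.length ^ (2 * (m : ℝ) + 2 * δ) := by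
      rw [← Real.rpow_add hl, ← Real.rpow_natCast]
      congr 1
      push_cast
      ring
    have h3 : k.length ^ (-(2 * δ)) ≤ ((2 : ℝ) ^ j) ^ (-(2 * δ)) :=
      Real.rpow_le_rpow_of_nonpos (by positivity) (le_length_of_mem_modeShell hk) (by linarith)
    calc ‖Y k‖ ^ 2 * k.length ^ (2 * m) ≤ (τ * r k) ^ 2 * (((2 : ℝ) ^ j) ^ (-(2 * δ)) *
          k.length ^ (2 * (m : ℝ) + 2 * δ)) := by
          rw [h2]
          have := Real.rpow_nonneg hl.le (2 * (m : ℝ) + 2 * δ)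
          gcongr
          exact hY k
      _ = _ := by ring
  refine (Finset.sum_le_sum h1).trans ?_
  rw [← Finset.mul_sum, ← Finset.mul_sum]
  gcongr
  exact hrs.sum_le_tsum _ fun k _ => mul_nonneg (sq_nonneg _)
    (Real.rpow_nonneg (zero_le_one.trans k.one_le_length) _)

/-- The loss `2 ^ (2j)` of the Nikolskii bound meets the gain `2 ^ (-2 δ p j)`; under `2 ≤ δ * p`
half of the gain pays for the loss and the other half is left. -/
theorem dyadic_arith {δ : ℝ} {p : ℕ} (hδp : 2 ≤ δ * p) (j : ℕ) :
    ((2 : ℝ) ^ j) ^ 2 * (((2 : ℝ) ^ j) ^ (-(2 * δ))) ^ p ≤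
      (((2 : ℝ) ^ (-(δ / 2))) ^ j) ^ (2 * p) := by
  have hx1 : (1 : ℝ) ≤ 2 ^ j := one_le_pow₀ (by norm_num)
  have hx0 : (0 : ℝ) < 2 ^ j := by positivity
  rw [Real.rpow_pow_comm (by norm_num) (-(δ / 2)) j]
  generalize (2 : ℝ) ^ j = x at hx1 hx0
  rw [← Real.rpow_natCast x 2, ← Real.rpow_natCast _ p, ← Real.rpow_natCast _ (2 * p),
    ← Real.rpow_mul hx0.le, ← Real.rpow_mul hx0.le, ← Real.rpow_add hx0]
  refine Real.rpow_le_rpow_of_exponent_le hx1 ?_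
  push_cast
  nlinarith

theorem moment_arith {K n q x σ τ ρ R w : ℝ} {p : ℕ} (hK : 0 ≤ K) (hn : 0 ≤ n) (hσ : 0 ≤ σ)
    (h1 : n ≤ 5 * q * x) (h2 : σ ≤ τ ^ 2 * (ρ * R)) (h3 : x ^ 2 * ρ ^ p ≤ w ^ (2 * p))
    (hR : 0 ≤ R := by positivity) :
    K * n ^ 2 * σ ^ p ≤ K * (5 * q) ^ 2 * R ^ p * τ ^ (2 * p) * w ^ (2 * p) := by
  calc K * n ^ 2 * σ ^ p ≤ K * (5 * q * x) ^ 2 * (τ ^ 2 * (ρ * R)) ^ p := by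
        gcongr
    _ = K * (5 * q) ^ 2 * R ^ p * τ ^ (2 * p) * (x ^ 2 * ρ ^ p) := by
        rw [pow_mul τ]
        ring
    _ ≤ _ := by
        have : 0 ≤ τ ^ (2 * p) := by rw [pow_mul]; positivity
        gcongr

/-- The constant depends neither on the coefficients nor on the scale `τ`, so one estimate serves
both the values of the field, with `τ = 1`, and its increments, with `τ = |t - s| ^ δ`. -/
theorem exists_eLpNorm_trigSum_le [IsProbabilityMeasure μ] {H : ℝ} {β : Mode → ℝ → S → ℂ}
    (hβ : IsNoise μ H β) (m : ℕ) {δ : ℝ} (hδ : 0 < δ) {p : ℕ} (hp : p ≠ 0) (hδp : 2 ≤ δ * p)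
    {r : Mode → ℝ}
    (hrs : Summable fun k : Mode => r k ^ 2 * k.length ^ (2 * (m : ℝ) + 2 * δ)) :
    ∃ D : ℝ, 0 ≤ D ∧ ∀ (τ : ℝ) (Y : Mode → Lp ℝ 2 μ), 0 ≤ τ → (∀ k, Y k ∈ hβ.space) →
      (∀ k l, k ≠ l → inner ℝ (Y k) (Y l) = 0) → (∀ k, ‖Y k‖ ≤ τ * r k) → ∀ j : ℕ,
      eLpNorm (trigSum m (modeShell j) Y) ((2 * p : ℕ) : ENNReal) μ ≤
        ENNReal.ofReal (D * τ * ((2 : ℝ) ^ (-(δ / 2))) ^ j) := by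
  set R := ∑' k : Mode, r k ^ 2 * k.length ^ (2 * (m : ℝ) + 2 * δ) with hR
  have hR0 : 0 ≤ R := tsum_nonneg fun k => mul_nonneg (sq_nonneg _)
    (Real.rpow_nonneg (zero_le_one.trans k.one_le_length) _)
  have hMC : 0 ≤ momentConst m p := by unfold momentConst; positivity
  set A := momentConst m p * (5 * p) ^ 2 * R ^ p with hA
  have hA0 : 0 ≤ A := by positivity
  have h2p : 2 * p ≠ 0 := by omega
  refine ⟨A ^ (((2 * p : ℕ) : ℝ)⁻¹), by positivity, fun τ Y hτ hY hYo hYr j => ?_⟩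
  refine eLpNorm_le_of_lintegral_pow_le h2p (by positivity) ?_
  refine (lintegral_norm_trigSum_pow_le hβ hp (fun k hk i => abs_le_of_mem_modeShell hk i)
    hY hYo).trans (ENNReal.ofReal_le_ofReal ?_)
  have hp1 : (1 : ℝ) ≤ p := by exact_mod_cast Nat.one_le_iff_ne_zero.2 hp
  have hx1 : (1 : ℝ) ≤ 2 ^ j := one_le_pow₀ (by norm_num)
  have h1 : (2 * ((p * 2 ^ (j + 1) : ℕ) : ℝ) + 1) ≤ 5 * p * 2 ^ j := by
    push_cast
    rw [pow_succ]
    nlinarith [mul_le_mul hp1 hx1 zero_le_one (zero_le_one.trans hp1)]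
  have hsum0 : 0 ≤ ∑ k ∈ modeShell j, ‖Y k‖ ^ 2 * k.length ^ (2 * m) :=
    Finset.sum_nonneg fun k _ => mul_nonneg (sq_nonneg _)
      (pow_nonneg (zero_le_one.trans k.one_le_length) _)
  refine (moment_arith hMC (by positivity) hsum0 h1 (sum_modeShell_le hδ hrs hYr j)
    (dyadic_arith hδp j)).trans_eq ?_
  rw [mul_pow (_ * τ), mul_pow _ τ, Real.rpow_inv_natCast_pow hA0 h2p]

theorem trigSum_sub_ae_eq (m : ℕ) (F : Finset Mode) (Y Z : Mode → Lp ℝ 2 μ) :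
    trigSum m F (fun k => Y k - Z k) =ᵐ[μ] fun ω => trigSum m F Y ω - trigSum m F Z ω := by
  have h : ∀ᵐ ω ∂μ, ∀ k ∈ F, (Y k - Z k : Lp ℝ 2 μ) ω = Y k ω - Z k ω :=
    (Finset.eventually_all _).2 fun k _ => Lp.coeFn_sub _ _
  filter_upwards [h] with ω hω
  unfold trigSum
  rw [← Finset.sum_sub_distrib]
  exact Finset.sum_congr rfl fun k hk => by rw [hω k hk, sub_smul]

theorem sum_smul_ae_eq_map_trigSum {m : ℕ} (F : Finset Mode) (Y : Mode → Lp ℝ 2 μ)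
    (l : Cm m →L[ℝ] ℝ) :
    (∑ k ∈ F, l (trig m k) • Y k : Lp ℝ 2 μ) =ᵐ[μ] fun ω => l (trigSum m F Y ω) := by
  have h1 : (∑ k ∈ F, l (trig m k) • Y k : Lp ℝ 2 μ) =ᵐ[μ]
      fun ω => ∑ k ∈ F, (l (trig m k) • Y k : Lp ℝ 2 μ) ω := Lp.coeFn_fun_finsetSum _ _
  have h2 : ∀ᵐ ω ∂μ, ∀ k ∈ F, (l (trig m k) • Y k : Lp ℝ 2 μ) ω = l (Y k ω • trig m k) :=
    (Finset.eventually_all _).2 fun k _ => by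
      filter_upwards [Lp.coeFn_smul (l (trig m k)) (Y k)] with ω h
      rw [h, Pi.smul_apply, map_smul, smul_eq_mul, smul_eq_mul, mul_comm]
  filter_upwards [h1, h2] with ω h h'
  rw [h, trigSum, map_sum]
  exact Finset.sum_congr rfl h'

/-- A continuous random field with uncorrelated Gaussian Fourier coefficients that are
Hölder continuous curves in `L²`. -/
theorem exists_field [IsProbabilityMeasure μ] {H : ℝ} {β : Mode → ℝ → S → ℂ}
    (hβ : IsNoise μ H β) (m : ℕ) {δ : ℝ} (hδ : 0 < δ) {U : Mode → ℝ → Lp ℝ 2 μ}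
    (hU : ∀ k t, U k t ∈ hβ.space)
    (hUo : ∀ k l, k ≠ l → ∀ t s, inner ℝ (U k t) (U l s) = 0) {r : Mode → ℝ}
    (hrs : Summable fun k : Mode => r k ^ 2 * k.length ^ (2 * (m : ℝ) + 2 * δ))
    (hU1 : ∀ k t, ‖U k t‖ ≤ r k) (hU2 : ∀ k t s, ‖U k t - U k s‖ ≤ r k * |t - s| ^ δ) :
    ∃ Ψ : S → PathSpace m, Measurable Ψ ∧ ∀ t, MemLp (fun ω => Ψ ω t) 2 μ ∧
      ∀ l : Cm m →L[ℝ] ℝ, ∃ w : Lp ℝ 2 μ,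
        Tendsto (fun J => ∑ k ∈ modeBall J, l (trig m k) • U k t) atTop (𝓝 w) ∧
        w =ᵐ[μ] fun ω => l (Ψ ω t) := by
  -- One choice of `p` serves twice: `2 ≤ δ * p` beats the Nikolskii loss, and `4 ≤ δ * (2 * p)` is
  -- the condition in `exists_continuous_version`.
  obtain ⟨p, hp⟩ := exists_nat_ge (2 / δ)
  have hδp : 2 ≤ δ * p := by rwa [div_le_iff₀' hδ] at hp
  have hp0 : p ≠ 0 := by rintro rfl; norm_num at hδp
  obtain ⟨D, hD0, hD⟩ := exists_eLpNorm_trigSum_le hβ m hδ hp0 hδp hrs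
  have hq2 : (2 : ENNReal) ≤ ((2 * p : ℕ) : ENNReal) := by
    have : 2 ≤ 2 * p := by omega
    exact_mod_cast this
  have : Fact ((1 : ENNReal) ≤ ((2 * p : ℕ) : ENNReal)) := ⟨le_trans (by norm_num) hq2⟩
  set ρ := (2 : ℝ) ^ (-(δ / 2)) with hρ
  have hρ0 : 0 ≤ ρ := by positivity
  have hρ1 : ρ < 1 := Real.rpow_lt_one_of_one_lt_of_neg (by norm_num) (by linarith)
  have hb1 : ∀ t j, eLpNorm (trigSum m (modeShell j) fun k => U k t) ((2 * p : ℕ) : ENNReal) μ ≤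
      ENNReal.ofReal (D * 1 * ρ ^ j) := fun t j =>
    hD 1 _ zero_le_one (fun k => hU k t) (fun k l hkl => hUo k l hkl t t)
      (fun k => by rw [one_mul]; exact hU1 k t) j
  have hb2 : ∀ t s j, eLpNorm (trigSum m (modeShell j) fun k => U k t - U k s)
      ((2 * p : ℕ) : ENNReal) μ ≤ ENNReal.ofReal (D * |t - s| ^ δ * ρ ^ j) := fun t s j =>
    hD _ _ (by positivity) (fun k => Submodule.sub_mem _ (hU k t) (hU k s))
      (fun k l hkl => by simp only [inner_sub_left, inner_sub_right, hUo k l hkl]; norm_num)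
      (fun k => (hU2 k t s).trans_eq (mul_comm _ _)) j
  have hmem : ∀ t j, MemLp (trigSum m (modeShell j) fun k => U k t) ((2 * p : ℕ) : ENNReal) μ :=
    fun t j => ⟨(measurable_trigSum _ _ _).aestronglyMeasurable,
      (hb1 t j).trans_lt ENNReal.ofReal_lt_top⟩
  set B : ℕ → ℝ → Lp (Cm m) ((2 * p : ℕ) : ENNReal) μ := fun j t => (hmem t j).toLp _ with hB
  have hB1 : ∀ t j, ‖B j t‖ ≤ D * 1 * ρ ^ j := fun t j => by
    rw [hB, Lp.norm_toLp]
    exact ENNReal.toReal_le_of_le_ofReal (by positivity) (hb1 t j)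
  have hB2 : ∀ t s j, ‖B j t - B j s‖ ≤ D * |t - s| ^ δ * ρ ^ j := fun t s j => by
    rw [hB, ← MemLp.toLp_sub, Lp.norm_toLp]
    refine ENNReal.toReal_le_of_le_ofReal (by positivity) ((hb2 t s j).trans' (le_of_eq ?_))
    exact eLpNorm_congr_ae (trigSum_sub_ae_eq m _ _ _).symm
  have hgeo : ∀ c : ℝ, HasSum (fun j => c * ρ ^ j) (c * (1 - ρ)⁻¹) := fun c =>
    (hasSum_geometric_of_lt_one hρ0 hρ1).mul_left c
  have hBs : ∀ t, Summable fun j => B j t := fun t =>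
    Summable.of_norm_bounded (hgeo (D * 1)).summable (hB1 t)
  set X : ℝ → Lp (Cm m) ((2 * p : ℕ) : ENNReal) μ := fun t => ∑' j, B j t with hX
  have hX2 : ∀ s t, ‖X t - X s‖ ≤ (D * (1 - ρ)⁻¹) * |t - s| ^ δ := fun s t => by
    rw [hX, ← (hBs t).tsum_sub (hBs s)]
    refine (tsum_of_norm_bounded (hgeo (D * |t - s| ^ δ)) (hB2 t s)).trans_eq ?_
    ring
  have h1ρ : 0 ≤ (1 - ρ)⁻¹ := inv_nonneg.2 (by linarith)
  obtain ⟨Ψ, hΨm, hΨX⟩ := exists_continuous_version (by omega) X (by positivity) hδ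
    (by push_cast; linarith) hX2
  refine ⟨Ψ, measurable_pathSpace_iff.2 hΨm, fun t => ?_⟩
  have hΨq : MemLp (fun ω => Ψ ω t) ((2 * p : ℕ) : ENNReal) μ :=
    MemLp.ae_eq (EventuallyEq.symm (hΨX t)) (Lp.memLp (X t))
  have hΨ2 : MemLp (fun ω => Ψ ω t) 2 μ := hΨq.mono_exponent hq2
  refine ⟨hΨ2, fun l => ?_⟩
  have hl2 : MemLp (fun ω => l (Ψ ω t)) 2 μ := l.comp_memLp' hΨ2
  refine ⟨hl2.toLp _, ?_, hl2.coeFn_toLp⟩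
  -- Convergence of the shells in `L^{2p}(μ; C^m)` passes through `l` and down to `L²`, which
  -- identifies `l (Ψ ω t)` with the limit of its Fourier sums over `modeBall`.
  have hlim : Tendsto (fun J => ‖l‖ * ‖∑ j ∈ Finset.range J, B j t - X t‖) atTop (𝓝 0) := by
    have h1 := (hBs t).hasSum.tendsto_sum_nat
    have h2 := (tendsto_iff_norm_sub_tendsto_zero.1 h1).const_mul ‖l‖
    rwa [mul_zero] at h2
  refine tendsto_iff_norm_sub_tendsto_zero.2 (squeeze_zero (fun _ => norm_nonneg _)
    (fun J => ?_) hlim)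
  have hsumB : (∑ j ∈ Finset.range J, B j t : Lp (Cm m) ((2 * p : ℕ) : ENNReal) μ) =ᵐ[μ]
      trigSum m (modeBall J) fun k => U k t := by
    have h1 : (∑ j ∈ Finset.range J, B j t : Lp (Cm m) ((2 * p : ℕ) : ENNReal) μ) =ᵐ[μ]
      fun ω => ∑ j ∈ Finset.range J, B j t ω := Lp.coeFn_fun_finsetSum _ _
    have h2 : ∀ᵐ ω ∂μ, ∀ j ∈ Finset.range J,
        B j t ω = trigSum m (modeShell j) (fun k => U k t) ω :=
      (Finset.eventually_all _).2 fun j _ => (hmem t j).coeFn_toLp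
    filter_upwards [h1, h2] with ω h h'
    rw [h, Finset.sum_congr rfl h']
    exact sum_range_modeShell _ J
  have hdom : ∀ᵐ ω ∂μ, ‖(∑ k ∈ modeBall J, l (trig m k) • U k t - hl2.toLp _ : Lp ℝ 2 μ) ω‖ ≤
      ‖l‖ * ‖(∑ j ∈ Finset.range J, B j t - X t :
        Lp (Cm m) ((2 * p : ℕ) : ENNReal) μ) ω‖ := by
    filter_upwards [Lp.coeFn_sub (∑ k ∈ modeBall J, l (trig m k) • U k t) (hl2.toLp _),
      Lp.coeFn_sub (∑ j ∈ Finset.range J, B j t) (X t), hsumB, hΨX t, hl2.coeFn_toLp,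
      sum_smul_ae_eq_map_trigSum (modeBall J) (fun k => U k t) l] with ω h1 h2 h3 h4 h5 h6
    rw [h1, h2, Pi.sub_apply, Pi.sub_apply, h3, ← h4, h5, h6, ← map_sub]
    exact l.le_opNorm _
  have h7 := eLpNorm_le_mul_eLpNorm_of_ae_le_mul hdom (2 : ENNReal)
  rw [Lp.norm_def, Lp.norm_def, ← toReal_enorm l, ← ENNReal.toReal_mul]
  refine ENNReal.toReal_mono (ENNReal.mul_ne_top enorm_ne_top (Lp.eLpNorm_ne_top _))
    (h7.trans ?_)
  rw [ofReal_norm]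
  gcongr
  exact eLpNorm_le_eLpNorm_of_exponent_le hq2 (Lp.aestronglyMeasurable _)

end Field

end FracField

end

noncomputable section

namespace FracField

/-! ### Mixing and ergodicity -/

section Mixing

/-- Pairing with `c • w` in the underlying real Hilbert space produces the constant `‖c‖²`, so the
real lemma applies. -/
theorem eq_zero_of_forall_complex_inner_eq {E : Type*} [NormedAddCommGroup E]
    [InnerProductSpace ℂ E] (w : E) (v : ℕ → E) {c : ℂ} {R : ℝ} (hw : ∀ n, inner ℂ w (v n) = c)
    (hR : ∀ n, ‖v n‖ ≤ R)
    (hv : ∀ ε > 0, ∃ K : ℕ, ∀ n m, n + K ≤ m → ‖inner ℂ (v n) (v m)‖ ≤ ε) : c = 0 := by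
  let : InnerProductSpace ℝ E := InnerProductSpace.rclikeToReal ℂ E
  have h : ‖c‖ ^ 2 = 0 := by
    refine eq_zero_of_forall_inner_eq (c • w) v (R := R) (fun n => ?_) hR fun ε hε => ?_
    · rw [real_inner_eq_re_inner ℂ, inner_smul_left, hw, RCLike.conj_mul]
      norm_cast
    · obtain ⟨K, hK⟩ := hv ε hε
      refine ⟨K, fun n m hnm => ?_⟩
      rw [real_inner_eq_re_inner ℂ]
      exact (RCLike.abs_re_le_norm _).trans (hK n m hnm)
  simpa using h

theorem preimage_iterate_eq {X : Type*} {T : X → X} {E : Set X} (hE : T ⁻¹' E = E) (n : ℕ) : T^[n] ⁻¹' E = E := by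
  induction n with
  | zero => rfl
  | succ n ih => rw [Function.iterate_succ, Set.preimage_comp, ih, hE]

variable {X : Type*} [MeasurableSpace X] {P : Measure X} {T : X → X}

theorem integral_comp_of_measurePreserving (hT : MeasurePreserving T P P) {f : X → ℂ}
    (hf : Measurable f) : ∫ x, f (T x) ∂P = ∫ x, f x ∂P := by
  rw [← integral_map hT.measurable.aemeasurable hf.aestronglyMeasurable, hT.map_eq]

/-- Decorrelation along the orbit makes an observable uncorrelated with every invariant set. -/
theorem setIntegral_eq_of_decorrelation [IsProbabilityMeasure P] (hT : MeasurePreserving T P P) {E : Set X}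
    (hEm : MeasurableSet E) (hE : T ⁻¹' E = E) {f : X → ℂ} (hf : Measurable f)
    (hf1 : ∀ x, ‖f x‖ ≤ 1)
    (hmix : ∀ ε > 0, ∃ K : ℕ, ∀ n m, n + K ≤ m →
      ‖∫ x, (starRingEnd ℂ) (f (T^[n] x)) * f (T^[m] x) ∂P -
        (starRingEnd ℂ) (∫ x, f x ∂P) * ∫ x, f x ∂P‖ ≤ ε) :
    ∫ x in E, f x ∂P = (P.real E : ℂ) * ∫ x, f x ∂P := by
  set κ := ∫ x, f x ∂P with hκ
  have hTn : ∀ n, MeasurePreserving T^[n] P P := fun n => hT.iterate n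
  have hfn : ∀ n, Measurable fun x => f (T^[n] x) := fun n => hf.comp (hTn n).measurable
  have hint : ∀ n, Integrable (fun x => f (T^[n] x)) P := fun n =>
    (integrable_const (1 : ℝ)).mono' (hfn n).aestronglyMeasurable
      (Eventually.of_forall fun x => hf1 _)
  have hintn : ∀ n, ∫ x, f (T^[n] x) ∂P = κ := fun n =>
    integral_comp_of_measurePreserving (hTn n) hf
  have hκ1 : ‖κ‖ ≤ 1 := by
    refine (norm_integral_le_of_norm_le_const (Eventually.of_forall hf1)).trans ?_
    simp
  have hmem : ∀ n, MemLp (fun x => f (T^[n] x) - κ) 2 P := fun n =>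
    MemLp.of_bound ((hfn n).sub_const κ).aestronglyMeasurable 2
      (Eventually.of_forall fun x => by
        refine (norm_sub_le _ _).trans ?_
        linarith [hf1 (T^[n] x)])
  -- By invariance of `E` and of `P`, the centered observables along the orbit all have the same
  -- inner product with the indicator of `E`, while their mutual inner products decay; such a
  -- constant must vanish.
  set v : ℕ → Lp ℂ 2 P := fun n => (hmem n).toLp _ with hv
  have h0 := eq_zero_of_forall_complex_inner_eq
    (indicatorConstLp 2 hEm (measure_ne_top P E) (1 : ℂ)) v (R := 2)
    (c := ∫ x in E, f x ∂P - (P.real E : ℂ) * κ) ?_ ?_ ?_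
  · exact sub_eq_zero.1 h0
  · intro n
    rw [L2.inner_indicatorConstLp_one]
    have h1 : ∫ x in E, v n x ∂P = ∫ x in E, (f (T^[n] x) - κ) ∂P :=
      integral_congr_ae (ae_restrict_of_ae (hmem n).coeFn_toLp)
    have h2 : ∫ x in E, f (T^[n] x) ∂P = ∫ x in E, f x ∂P := by
      have h3 := integral_comp_of_measurePreserving (hTn n)
        (hf.indicator hEm)
      rw [integral_indicator hEm] at h3
      rw [← h3, ← integral_indicator hEm]
      refine integral_congr_ae (Eventually.of_forall fun x => ?_)
      have h4 : x ∈ E ↔ T^[n] x ∈ E := by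
        conv_lhs => rw [← preimage_iterate_eq hE n]
        rfl
      by_cases hx : x ∈ E
      · simp [Set.indicator, hx, h4.1 hx]
      · rw [Set.indicator_of_notMem hx, eq_comm]
        exact Set.indicator_of_notMem (fun h => hx (h4.2 h)) f
    rw [h1, integral_sub (hint n).integrableOn (integrable_const κ).integrableOn, h2,
      setIntegral_const, Complex.real_smul]
  · intro n
    rw [hv, Lp.norm_toLp]
    refine ENNReal.toReal_le_of_le_ofReal (by norm_num) ?_
    refine (eLpNorm_le_of_ae_bound (C := 2) (Eventually.of_forall fun x => ?_)).trans (by simp)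
    refine (norm_sub_le _ _).trans ?_
    linarith [hf1 (T^[n] x)]
  · intro ε hε
    obtain ⟨K, hK⟩ := hmix ε hε
    refine ⟨K, fun n m hnm => ?_⟩
    convert hK n m hnm using 2
    rw [L2.inner_def]
    have h1 : ∫ x, inner ℂ (v n x) (v m x) ∂P = ∫ x, ((starRingEnd ℂ) (f (T^[n] x)) * f (T^[m] x) -
        (starRingEnd ℂ) (f (T^[n] x)) * κ - ((starRingEnd ℂ) κ * f (T^[m] x) -
          (starRingEnd ℂ) κ * κ)) ∂P := by
      refine integral_congr_ae ?_
      filter_upwards [(hmem n).coeFn_toLp, (hmem m).coeFn_toLp] with x hn hm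
      rw [hv, hn, hm, RCLike.inner_apply, map_sub]
      ring
    have hi1 : Integrable (fun x => (starRingEnd ℂ) (f (T^[n] x)) * f (T^[m] x)) P := by
      refine (integrable_const (1 : ℝ)).mono'
        ((Complex.continuous_conj.measurable.comp (hfn n)).mul (hfn m)).aestronglyMeasurable
        (Eventually.of_forall fun x => ?_)
      rw [norm_mul, RCLike.norm_conj]
      exact mul_le_one₀ (hf1 _) (norm_nonneg _) (hf1 _)
    have hi2 : Integrable (fun x => (starRingEnd ℂ) (f (T^[n] x))) P :=
      Complex.conjCLE.toContinuousLinearMap.integrable_comp (hint n)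
    have hconj : ∫ x, (starRingEnd ℂ) (f (T^[n] x)) ∂P = (starRingEnd ℂ) κ := by
      rw [integral_conj, hintn]
    have hi3 : Integrable (fun x => (starRingEnd ℂ) (f (T^[n] x)) * f (T^[m] x) -
        (starRingEnd ℂ) (f (T^[n] x)) * κ) P := hi1.sub (hi2.mul_const κ)
    have hi4 : Integrable (fun x => (starRingEnd ℂ) κ * f (T^[m] x)) P := (hint m).const_mul _
    have hi5 : Integrable (fun x => (starRingEnd ℂ) κ * f (T^[m] x) - (starRingEnd ℂ) κ * κ) P :=
      hi4.sub (integrable_const _)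
    rw [h1, integral_sub hi3 hi5, integral_sub hi1 (hi2.mul_const κ),
      integral_sub hi4 (integrable_const _), integral_mul_const,
      integral_const_mul, hconj, hintn]
    simp

end Mixing

/-! ### The shift on the path space -/

section Shift

variable {m : ℕ}

theorem shift_apply (t s : ℝ) (ψ : PathSpace m) : shift t ψ s = ψ (t + s) := rfl

theorem continuous_shift (t : ℝ) : Continuous (shift t : PathSpace m → PathSpace m) :=
  ContinuousMap.continuous_precomp _

theorem shift_zero : (shift 0 : PathSpace m → PathSpace m) = id :=
  funext fun ψ => ContinuousMap.ext fun s => by rw [shift_apply, zero_add, id]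

theorem shift_add (t s : ℝ) : (shift (t + s) : PathSpace m → PathSpace m) = shift t ∘ shift s :=
  funext fun ψ => ContinuousMap.ext fun r => by
    rw [Function.comp_apply, shift_apply, shift_apply, shift_apply]
    congr 1
    ring

theorem shift_one_iterate (n : ℕ) : (shift 1 : PathSpace m → PathSpace m)^[n] = shift n := by
  induction n with
  | zero => rw [Function.iterate_zero, Nat.cast_zero, shift_zero]
  | succ n ih => rw [Function.iterate_succ, ih, Nat.cast_succ, shift_add]

theorem measurable_shift_uncurry : Measurable fun p : PathSpace m × ℝ => shift p.2 p.1 := by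
  refine Continuous.measurable ?_
  refine ContinuousMap.continuous_of_continuous_uncurry _ ?_
  have h : Continuous fun q : (PathSpace m × ℝ) × ℝ => q.1.1 (q.1.2 + q.2) := by fun_prop
  exact h

end Shift

/-! ### Stationary Gaussian fields that decorrelate -/

section GaussianField

variable {S : Type*} [MeasurableSpace S] {μ : Measure S} {H : ℝ} {β : Mode → ℝ → S → ℂ} {m : ℕ}

/-- A stationary random field on the Gaussian space of the noise that decorrelates in time. -/
structure IsDecorrelatingField (hβ : IsNoise μ H β) (Ψ : S → PathSpace m)
    (W : ℝ → Torus → Lp ℝ 2 μ) : Prop where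
  measurable : Measurable Ψ
  mem : ∀ t x, W t x ∈ hβ.space
  coeFn : ∀ t x, W t x =ᵐ[μ] fun ω => Ψ ω t x
  stationary : ∀ r t s x y, inner ℝ (W (t + r) x) (W (s + r) y) = inner ℝ (W t x) (W s y)
  decorrelation : ∀ x y, Tendsto (fun t => inner ℝ (W t x) (W 0 y)) atTop (𝓝 0)

/-- The linear functional `∑ c_p ψ(t_p)(x_p)` over dense times and points. -/
def evalSum (F : Finset (ℕ × ℕ)) (c : ℕ × ℕ → ℝ) (ψ : PathSpace m) : ℝ :=
  ∑ p ∈ F, c p * denseEval ψ p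

theorem continuous_evalSum (F : Finset (ℕ × ℕ)) (c : ℕ × ℕ → ℝ) :
    Continuous (evalSum F c : PathSpace m → ℝ) :=
  continuous_finsetSum _ fun p _ => continuous_const.mul (continuous_pi_iff.1 continuous_denseEval p)

/-- The element of the Gaussian space that corresponds to `evalSum` at a shifted path. -/
def evalSumLp (W : ℝ → Torus → Lp ℝ 2 μ) (F : Finset (ℕ × ℕ)) (c : ℕ × ℕ → ℝ) (r : ℝ) :
    Lp ℝ 2 μ :=
  ∑ p ∈ F, c p • W (r + TopologicalSpace.denseSeq ℝ p.1) (TopologicalSpace.denseSeq Torus p.2)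

namespace IsDecorrelatingField

variable {hβ : IsNoise μ H β} {Ψ : S → PathSpace m} {W : ℝ → Torus → Lp ℝ 2 μ}

theorem evalSumLp_mem (h : IsDecorrelatingField hβ Ψ W) (F : Finset (ℕ × ℕ)) (c : ℕ × ℕ → ℝ)
    (r : ℝ) : evalSumLp W F c r ∈ hβ.space :=
  Submodule.sum_mem _ fun _ _ => Submodule.smul_mem _ _ (h.mem _ _)

theorem coeFn_evalSumLp (h : IsDecorrelatingField hβ Ψ W) (F : Finset (ℕ × ℕ)) (c : ℕ × ℕ → ℝ)
    (r : ℝ) : evalSumLp W F c r =ᵐ[μ] fun ω => evalSum F c (shift r (Ψ ω)) := by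
  have h1 : evalSumLp W F c r =ᵐ[μ] fun ω => ∑ p ∈ F, (c p • W (r + TopologicalSpace.denseSeq ℝ p.1)
      (TopologicalSpace.denseSeq Torus p.2) : Lp ℝ 2 μ) ω := Lp.coeFn_fun_finsetSum _ _
  have h2 : ∀ᵐ ω ∂μ, ∀ p ∈ F, (c p • W (r + TopologicalSpace.denseSeq ℝ p.1)
      (TopologicalSpace.denseSeq Torus p.2) : Lp ℝ 2 μ) ω = c p * denseEval (shift r (Ψ ω)) p :=
    (Finset.eventually_all _).2 fun p _ => by
      filter_upwards [Lp.coeFn_smul (c p) (W (r + TopologicalSpace.denseSeq ℝ p.1)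
        (TopologicalSpace.denseSeq Torus p.2)), h.coeFn (r + TopologicalSpace.denseSeq ℝ p.1)
        (TopologicalSpace.denseSeq Torus p.2)] with ω h1 h2
      rw [h1, Pi.smul_apply, h2, smul_eq_mul]
      rfl
  filter_upwards [h1, h2] with ω h3 h4
  rw [h3, evalSum]
  exact Finset.sum_congr rfl h4

theorem inner_evalSumLp (h : IsDecorrelatingField hβ Ψ W) (F : Finset (ℕ × ℕ)) (c : ℕ × ℕ → ℝ)
    (r t s : ℝ) : inner ℝ (evalSumLp W F c (t + r)) (evalSumLp W F c (s + r)) =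
      inner ℝ (evalSumLp W F c t) (evalSumLp W F c s) := by
  simp only [evalSumLp, sum_inner, inner_sum, real_inner_smul_left, real_inner_smul_right,
    add_right_comm _ r, h.stationary]

theorem tendsto_inner_evalSumLp (h : IsDecorrelatingField hβ Ψ W) (F : Finset (ℕ × ℕ))
    (c : ℕ × ℕ → ℝ) :
    Tendsto (fun t => inner ℝ (evalSumLp W F c t) (evalSumLp W F c 0)) atTop (𝓝 0) := by
  simp only [evalSumLp, sum_inner, inner_sum, real_inner_smul_left, real_inner_smul_right]
  have h0 : 𝓝 (0 : ℝ) = 𝓝 (∑ p ∈ F, ∑ q ∈ F, c p * (c q * 0)) := by simp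
  rw [h0]
  refine tendsto_finsetSum _ fun p _ => tendsto_finsetSum _ fun q _ =>
    (Tendsto.const_mul _ (Tendsto.const_mul _ ?_))
  set a := TopologicalSpace.denseSeq ℝ q.1
  set b := TopologicalSpace.denseSeq ℝ p.1
  have h1 : Tendsto (fun t => t + (a - b)) atTop atTop := tendsto_atTop_add_const_right _ _ tendsto_id
  refine ((h.decorrelation (TopologicalSpace.denseSeq Torus q.2)
    (TopologicalSpace.denseSeq Torus p.2)).comp h1).congr fun t => ?_
  rw [Function.comp_apply, ← h.stationary b]
  congr 2
  ring

variable [IsProbabilityMeasure μ]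

theorem integral_exp_comp (h : IsDecorrelatingField hβ Ψ W) {g : PathSpace m → ℝ}
    (hg : Measurable g) {w : Lp ℝ 2 μ} (hw : w ∈ hβ.space) (hgw : w =ᵐ[μ] fun ω => g (Ψ ω)) :
    ∫ ψ, Complex.exp ((g ψ : ℝ) * Complex.I) ∂(μ.map Ψ) = Real.exp (-(‖w‖ ^ 2 / 2)) := by
  have hm : Measurable fun ψ => Complex.exp ((g ψ : ℝ) * Complex.I) := by fun_prop
  rw [integral_map h.measurable.aemeasurable hm.aestronglyMeasurable]
  have h1 := hβ.integral_exp_eq hw 1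
  simp only [one_mul, one_pow] at h1
  rw [← h1]
  refine integral_congr_ae ?_
  filter_upwards [hgw] with ω hω
  rw [hω]

theorem isProbabilityMeasure_map (h : IsDecorrelatingField hβ Ψ W) :
    IsProbabilityMeasure (μ.map Ψ) :=
  Measure.isProbabilityMeasure_map h.measurable.aemeasurable

/-- A centered Gaussian law is fixed by variances, and the variances of all finite combinations of
evaluations are unchanged by the shift. -/
theorem measurePreserving_shift (h : IsDecorrelatingField hβ Ψ W) (r : ℝ) :
    MeasurePreserving (shift r) (μ.map Ψ) (μ.map Ψ) := by
  have := h.isProbabilityMeasure_map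
  have hm := (continuous_shift (m := m) r).measurable
  have : IsProbabilityMeasure ((μ.map Ψ).map (shift r)) :=
    Measure.isProbabilityMeasure_map hm.aemeasurable
  refine ⟨hm, measure_ext_of_charFun_eval fun F c => ?_⟩
  change ∫ ψ, Complex.exp ((evalSum F c ψ : ℝ) * Complex.I) ∂_ =
    ∫ ψ, Complex.exp ((evalSum F c ψ : ℝ) * Complex.I) ∂_
  have hc := (continuous_evalSum (m := m) F c).measurable
  have hm2 : Measurable fun ψ : PathSpace m => Complex.exp ((evalSum F c ψ : ℝ) * Complex.I) := by
    fun_prop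
  have h0 : evalSumLp W F c 0 =ᵐ[μ] fun ω => evalSum F c (Ψ ω) := by
    have := h.coeFn_evalSumLp F c 0
    simpa only [shift_zero, id] using this
  rw [integral_map hm.aemeasurable hm2.aestronglyMeasurable,
    h.integral_exp_comp hc (h.evalSumLp_mem F c 0) h0,
    h.integral_exp_comp (g := fun ψ => evalSum F c (shift r ψ)) (hc.comp hm)
      (h.evalSumLp_mem F c r) (h.coeFn_evalSumLp F c r)]
  have h2 := h.inner_evalSumLp F c r 0 0
  rw [zero_add, real_inner_self_eq_norm_sq, real_inner_self_eq_norm_sq] at h2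
  rw [h2]

/-- For an invariant `E`, the characteristic functions of `P` restricted to `E` and of `P E • P`
coincide by decorrelation, so the two measures are equal; evaluated at `E` this reads `P E = (P
E)²`. Invariance under the unit shift suffices, as needed for Birkhoff's theorem in discrete time.
-/
theorem measure_eq_zero_or_one (h : IsDecorrelatingField hβ Ψ W) {E : Set (PathSpace m)}
    (hEm : MeasurableSet E) (hE : shift 1 ⁻¹' E = E) : μ.map Ψ E = 0 ∨ μ.map Ψ E = 1 := by
  set P := μ.map Ψ with hP
  have := h.isProbabilityMeasure_map
  rw [← hP] at this
  have key : P.restrict E = P E • P := by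
    have hfin : IsFiniteMeasure (P E • P) := Measure.smul_finite _ (measure_ne_top _ _)
    refine measure_ext_of_charFun_eval fun F c => ?_
    change ∫ ψ in E, Complex.exp ((evalSum F c ψ : ℝ) * Complex.I) ∂P =
      ∫ ψ, Complex.exp ((evalSum F c ψ : ℝ) * Complex.I) ∂(P E • P)
    have hc := (continuous_evalSum (m := m) F c).measurable
    have hm2 : Measurable fun ψ : PathSpace m => Complex.exp ((evalSum F c ψ : ℝ) * Complex.I) := by
      fun_prop
    have h0 : evalSumLp W F c 0 =ᵐ[μ] fun ω => evalSum F c (Ψ ω) := by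
      have := h.coeFn_evalSumLp F c 0
      simpa only [shift_zero, id] using this
    have hκ := h.integral_exp_comp hc (h.evalSumLp_mem F c 0) h0
    rw [← hP] at hκ
    set w0 := evalSumLp W F c 0 with hw0
    rw [integral_smul_measure, setIntegral_eq_of_decorrelation (h.measurePreserving_shift 1) hEm hE
      hm2 (fun ψ => (Complex.norm_exp_ofReal_mul_I _).le) ?_]
    · rw [Complex.real_smul]
      rfl
    -- The correlation of the two exponentials is the characteristic function of a difference of
    -- Gaussians. Its exponent `-(‖w0‖² - cov)` tends to `-‖w0‖²`, which corresponds to the product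
    -- of the separate means.
    have hlim : Tendsto (fun t => Real.exp (-(‖w0‖ ^ 2 - inner ℝ (evalSumLp W F c t) w0)))
        atTop (𝓝 (Real.exp (-(‖w0‖ ^ 2 - 0)))) :=
      (Real.continuous_exp.tendsto _).comp ((h.tendsto_inner_evalSumLp F c).const_sub _).neg
    intro ε hε
    obtain ⟨A, hA⟩ := eventually_atTop.1 (Metric.tendsto_nhds.1 hlim ε hε)
    obtain ⟨K, hK⟩ := exists_nat_ge A
    refine ⟨K, fun n k hnk => ?_⟩
    have h1 : ∀ ψ : PathSpace m, (starRingEnd ℂ)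
        (Complex.exp ((evalSum F c ((shift 1)^[n] ψ) : ℝ) * Complex.I)) *
        Complex.exp ((evalSum F c ((shift 1)^[k] ψ) : ℝ) * Complex.I) =
        Complex.exp ((evalSum F c (shift k ψ) - evalSum F c (shift n ψ) : ℝ) * Complex.I) := by
      intro ψ
      rw [shift_one_iterate, shift_one_iterate, ← Complex.exp_conj, ← Complex.exp_add, map_mul,
        Complex.conj_I, Complex.conj_ofReal]
      congr 1
      push_cast
      ring
    have h2 : (evalSumLp W F c k - evalSumLp W F c n : Lp ℝ 2 μ) =ᵐ[μ]
        fun ω => evalSum F c (shift k (Ψ ω)) - evalSum F c (shift n (Ψ ω)) := by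
      filter_upwards [Lp.coeFn_sub (evalSumLp W F c k) (evalSumLp W F c n),
        h.coeFn_evalSumLp F c k, h.coeFn_evalSumLp F c n] with ω h3 h4 h5
      rw [h3, Pi.sub_apply, h4, h5]
    have h3 := h.integral_exp_comp (g := fun ψ => evalSum F c (shift k ψ) - evalSum F c (shift n ψ))
      ((hc.comp (continuous_shift _).measurable).sub (hc.comp (continuous_shift _).measurable))
      (Submodule.sub_mem _ (h.evalSumLp_mem F c k) (h.evalSumLp_mem F c n)) h2
    have h4 : ‖evalSumLp W F c k - evalSumLp W F c n‖ ^ 2 / 2 =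
        ‖w0‖ ^ 2 - inner ℝ (evalSumLp W F c ((k : ℝ) - n)) w0 := by
      have e1 := h.inner_evalSumLp F c k 0 0
      have e2 := h.inner_evalSumLp F c n 0 0
      have e3 := h.inner_evalSumLp F c n (k - n) 0
      rw [zero_add, real_inner_self_eq_norm_sq, real_inner_self_eq_norm_sq] at e1 e2
      rw [sub_add_cancel, zero_add] at e3
      rw [norm_sub_sq_real, e1, e2, e3, ← hw0]
      ring
    simp only [h1]
    rw [h3, hκ, h4, Complex.conj_ofReal, ← Complex.ofReal_mul, ← Real.exp_add, ← Complex.ofReal_sub,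
      Complex.norm_real]
    have h5 := hA ((k : ℝ) - n) (by
      have : (n : ℝ) + K ≤ k := by exact_mod_cast hnk
      linarith)
    rw [Real.dist_eq] at h5
    rw [Real.norm_eq_abs]
    have h6 : -(‖w0‖ ^ 2 / 2) + -(‖w0‖ ^ 2 / 2) = -(‖w0‖ ^ 2 - 0) := by ring
    rw [h6]
    exact h5.le
  have h1 := congrArg (fun Q : Measure (PathSpace m) => Q E) key
  simp only [Measure.restrict_apply_self, Measure.smul_apply, smul_eq_mul] at h1
  by_cases h0 : P E = 0
  · exact Or.inl h0
  · refine Or.inr ?_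
    have h2 : P E * 1 = P E * P E := by rw [mul_one]; exact h1
    exact ((ENNReal.mul_right_inj h0 (measure_ne_top _ _)).1 h2).symm

theorem isErgodicMDS (h : IsDecorrelatingField hβ Ψ W) : IsErgodicMDS (μ.map Ψ) shift where
  prob := h.isProbabilityMeasure_map
  measurable := measurable_shift_uncurry
  zero := shift_zero
  flow s t := shift_add t s
  invariant t _ hA := (h.measurePreserving_shift t).measure_preimage hA.nullMeasurableSet
  ergodic _ hA hE := h.measure_eq_zero_or_one hA (hE 1)

end IsDecorrelatingField

end GaussianField

end FracField

end

noncomputable section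

namespace FracField

/-! ### The stationary field -/

/-- The assumptions on the parameters of the equation. -/
structure IsAdmissible (H ν : ℝ) (α lam : Mode → ℝ) : Prop where
  H_pos : 0 < H
  H_lt_one : H < 1
  ν_pos : 0 < ν
  exists_le : ∃ c : ℝ, 0 < c ∧ ∀ k, c ≤ α k
  α_neg : ∀ k, α k.neg = α k
  lam_nonneg : ∀ k, 0 ≤ lam k
  lam_neg : ∀ k, lam k.neg = lam k

section Parameters

variable {H ν : ℝ} {α lam : Mode → ℝ}

theorem IsAdmissible.α_pos (hp : IsAdmissible H ν α lam) (k : Mode) : 0 < α k := by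
  obtain ⟨c, hc, h⟩ := hp.exists_le
  exact hc.trans_le (h k)

theorem IsAdmissible.rate_pos (hp : IsAdmissible H ν α lam) (k : Mode) : 0 < ν * α k :=
  mul_pos hp.ν_pos (hp.α_pos k)

/-- The amplitude of the `k`-th real mode. -/
def amp (H ν : ℝ) (lam : Mode → ℝ) (k : Mode) : ℝ := Real.sqrt 2 * (Real.sqrt (lam k) * ν ^ H)

theorem IsAdmissible.amp_nonneg (hp : IsAdmissible H ν α lam) (k : Mode) : 0 ≤ amp H ν lam k := by
  have := hp.ν_pos
  unfold amp
  positivity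

theorem IsAdmissible.amp_sq (hp : IsAdmissible H ν α lam) (k : Mode) :
    amp H ν lam k ^ 2 = 2 * ν ^ (2 * H) * lam k := by
  unfold amp
  rw [mul_pow, mul_pow, Real.sq_sqrt (by norm_num), Real.sq_sqrt (hp.lam_nonneg k),
    ← Real.rpow_natCast, ← Real.rpow_mul hp.ν_pos.le]
  push_cast
  ring_nf

/-- The mixed weight obeys `α^(2δ) |k|^(2δ) ≤ α^(4δ) + |k|^(4δ)`. Because `4δ ≤ 2γ`, the lower
bounds `α ≥ c` and `|k| ≥ 1` raise the exponents to `2γ`, the former at the cost of `c ^ (4δ - 2γ)`;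
the two terms are the two given series. -/
theorem IsAdmissible.summable_interpolated (hp : IsAdmissible H ν α lam) {m : ℕ} {γ δ : ℝ}
    (hδ : 2 * δ ≤ γ)
    (hsum1 : Summable fun k => lam k * α k ^ (2 * γ - 2 * H) * k.length ^ (2 * m))
    (hsum2 : Summable fun k =>
      lam k * α k ^ (-(2 * H)) * k.length ^ (2 * (m : ℝ) + 2 * γ)) :
    Summable fun k => lam k * α k ^ (2 * δ - 2 * H) * k.length ^ (2 * (m : ℝ) + 2 * δ) := by
  obtain ⟨c, hc, hcα⟩ := hp.exists_le
  refine Summable.of_nonneg_of_le (fun k => ?_) (fun k => ?_)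
    ((hsum1.mul_left (c ^ (4 * δ - 2 * γ))).add hsum2)
  · have := hp.lam_nonneg k
    have := (hp.α_pos k).le
    have := zero_le_one.trans k.one_le_length
    positivity
  · have hα := hp.α_pos k
    have hl := zero_lt_one.trans_le k.one_le_length
    have e1 : α k ^ (2 * δ - 2 * H) = α k ^ (-(2 * H)) * α k ^ (2 * δ) := by
      rw [← Real.rpow_add hα]; ring_nf
    have e2 : k.length ^ (2 * (m : ℝ) + 2 * δ) = k.length ^ (2 * m) * k.length ^ (2 * δ) := by
      rw [Real.rpow_add hl, ← Real.rpow_natCast]; push_cast; rfl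
    have e3 : α k ^ (2 * γ - 2 * H) = α k ^ (-(2 * H)) * α k ^ (2 * γ) := by
      rw [← Real.rpow_add hα]; ring_nf
    have e4 : k.length ^ (2 * (m : ℝ) + 2 * γ) = k.length ^ (2 * m) * k.length ^ (2 * γ) := by
      rw [Real.rpow_add hl, ← Real.rpow_natCast]; push_cast; rfl
    have f1 : α k ^ (2 * δ) * α k ^ (2 * δ) ≤ c ^ (4 * δ - 2 * γ) * α k ^ (2 * γ) := by
      rw [← Real.rpow_add hα, show 2 * δ + 2 * δ = (4 * δ - 2 * γ) + 2 * γ by ring,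
        Real.rpow_add hα]
      gcongr ?_ * _
      exact Real.rpow_le_rpow_of_nonpos hc (hcα k) (by linarith)
    have f2 : k.length ^ (2 * δ) * k.length ^ (2 * δ) ≤ k.length ^ (2 * γ) := by
      rw [← Real.rpow_add hl]
      exact Real.rpow_le_rpow_of_exponent_le k.one_le_length (by linarith)
    have f3 : α k ^ (2 * δ) * k.length ^ (2 * δ) ≤
        c ^ (4 * δ - 2 * γ) * α k ^ (2 * γ) + k.length ^ (2 * γ) := by
      nlinarith [sq_nonneg (α k ^ (2 * δ) - k.length ^ (2 * δ)),
        sq_nonneg (α k ^ (2 * δ) + k.length ^ (2 * δ))]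
    have f4 : 0 ≤ lam k * α k ^ (-(2 * H)) * k.length ^ (2 * m) := by
      have := hp.lam_nonneg k
      positivity
    rw [e1, e2, e3, e4]
    calc _ = lam k * α k ^ (-(2 * H)) * k.length ^ (2 * m) *
          (α k ^ (2 * δ) * k.length ^ (2 * δ)) := by ring
      _ ≤ lam k * α k ^ (-(2 * H)) * k.length ^ (2 * m) *
          (c ^ (4 * δ - 2 * γ) * α k ^ (2 * γ) + k.length ^ (2 * γ)) := by gcongr
      _ = _ := by ring

variable {S : Type*} [MeasurableSpace S] {μ : Measure S} {β : Mode → ℝ → S → ℂ}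

/-- The stationary Ornstein-Uhlenbeck curve of the `k`-th real mode. -/
def modeCurve (hβ : IsNoise μ H β) (ν : ℝ) (α : Mode → ℝ) (k : Mode) (t : ℝ) : Lp ℝ 2 μ :=
  fou (hβ.curve k) (ν * α k) t

variable (hβ : IsNoise μ H β)

theorem IsAdmissible.modeCurve_mem (hp : IsAdmissible H ν α lam) (k : Mode) (t : ℝ) :
    modeCurve hβ ν α k t ∈ hβ.space :=
  fou_mem (hβ.isFBMCurve k) hp.H_pos (hp.rate_pos k) hβ.isClosed_space (hβ.curve_mem_space k) t

theorem IsAdmissible.inner_modeCurve (hp : IsAdmissible H ν α lam) {k l : Mode} (hkl : k ≠ l)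
    (t s : ℝ) : inner ℝ (modeCurve hβ ν α k t) (modeCurve hβ ν α l s) = 0 :=
  inner_fou_eq_zero (hβ.isFBMCurve k) hp.H_pos (hp.rate_pos k) (hβ.isFBMCurve l) hp.H_pos
    (hp.rate_pos l) (fun s t => hβ.inner_curve_eq_zero hkl t s) s t

theorem IsAdmissible.exists_modeCurve_bound (hp : IsAdmissible H ν α lam) {m : ℕ} {γ : ℝ}
    (hγ : 0 < γ) (hsum1 : Summable fun k => lam k * α k ^ (2 * γ - 2 * H) * k.length ^ (2 * m))
    (hsum2 : Summable fun k =>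
      lam k * α k ^ (-(2 * H)) * k.length ^ (2 * (m : ℝ) + 2 * γ)) :
    ∃ δ : ℝ, 0 < δ ∧ ∃ r : Mode → ℝ,
      (Summable fun k : Mode => r k ^ 2 * k.length ^ (2 * (m : ℝ) + 2 * δ)) ∧
      (∀ k t, ‖amp H ν lam k • modeCurve hβ ν α k t‖ ≤ r k) ∧
      ∀ k t s, ‖amp H ν lam k • modeCurve hβ ν α k t - amp H ν lam k • modeCurve hβ ν α k s‖ ≤
        r k * |t - s| ^ δ := by
  have hH := hp.H_pos
  have hν := hp.ν_pos
  obtain ⟨c, hc, hcα⟩ := hp.exists_le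
  -- Half of `γ` is what the interpolation of the two series permits, and `δ ≤ H` is needed for the
  -- Hölder bound of `fou`.
  set δ := min γ H / 2 with hδ
  have hmin : 0 < min γ H := lt_min hγ hH
  have hδ0 : 0 < δ := by positivity
  have hδγ : 2 * δ ≤ γ := by rw [hδ]; linarith [min_le_left γ H]
  have hδH : δ ≤ H := by rw [hδ]; linarith [min_le_right γ H]
  -- The first summand bounds increments. The second bounds values, where `(να)^(-H)` is traded for
  -- `(νc)^(-δ) (να)^(δ-H)` so that one sequence `r` controls both.
  set C := 2 * Real.Gamma (H - δ + 1) + Real.Gamma (H + 1) * (ν * c) ^ (-δ) with hC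
  have hΓ1 : 0 < Real.Gamma (H - δ + 1) := Real.Gamma_pos_of_pos (by linarith)
  have hΓ2 : 0 < Real.Gamma (H + 1) := Real.Gamma_pos_of_pos (by linarith)
  refine ⟨δ, hδ0, fun k => amp H ν lam k * (C * (ν * α k) ^ (δ - H)), ?_, fun k t => ?_,
    fun k t s => ?_⟩
  · refine ((hp.summable_interpolated hδγ hsum1 hsum2).mul_left
      (2 * ν ^ (2 * H) * C ^ 2 * ν ^ (2 * δ - 2 * H))).congr fun k => ?_
    rw [mul_pow, mul_pow, hp.amp_sq, ← Real.rpow_natCast _ 2,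
      ← Real.rpow_natCast ((ν * α k) ^ (δ - H)) 2, ← Real.rpow_mul (hp.rate_pos k).le,
      show (δ - H) * ((2 : ℕ) : ℝ) = 2 * δ - 2 * H by push_cast; ring,
      Real.mul_rpow hν.le (hp.α_pos k).le]
    ring
  · rw [norm_smul, Real.norm_of_nonneg (hp.amp_nonneg k)]
    have h1 := (hβ.isFBMCurve k).norm_fou_le hH (hp.rate_pos k) t
    have h2 : (ν * α k) ^ (-H) ≤ (ν * c) ^ (-δ) * (ν * α k) ^ (δ - H) := by
      rw [show -H = -δ + (δ - H) by ring, Real.rpow_add (hp.rate_pos k)]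
      gcongr ?_ * _
      · exact Real.rpow_nonneg (hp.rate_pos k).le _
      · exact Real.rpow_le_rpow_of_nonpos (by positivity) (by gcongr; exact hcα k) (by linarith)
    have h3 := Real.rpow_nonneg (hp.rate_pos k).le (δ - H)
    refine mul_le_mul_of_nonneg_left (h1.trans ?_) (hp.amp_nonneg k)
    calc _ ≤ Real.Gamma (H + 1) * ((ν * c) ^ (-δ) * (ν * α k) ^ (δ - H)) := by gcongr
      _ ≤ _ := by
        rw [hC, ← mul_assoc]
        gcongr
        linarith
  · rw [← smul_sub, norm_smul, Real.norm_of_nonneg (hp.amp_nonneg k), mul_assoc]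
    have h1 := (hβ.isFBMCurve k).norm_fou_sub_le hH (hp.rate_pos k) hδ0.le hδH s t
    have h3 := Real.rpow_nonneg (hp.rate_pos k).le (δ - H)
    refine mul_le_mul_of_nonneg_left (h1.trans ?_) (hp.amp_nonneg k)
    gcongr
    rw [hC]
    have : 0 ≤ Real.Gamma (H + 1) * (ν * c) ^ (-δ) := by positivity
    linarith

/-- `Ψ` is the random field with Fourier coefficients given by the stationary Ornstein-Uhlenbeck
curves. -/
structure IsStationaryField {m : ℕ} (ν : ℝ) (α lam : Mode → ℝ) (Ψ : S → PathSpace m) :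
    Prop where
  measurable : Measurable Ψ
  memLp : ∀ t, MemLp (fun ω => Ψ ω t) 2 μ
  tendsto : ∀ t (l : Cm m →L[ℝ] ℝ), ∃ w : Lp ℝ 2 μ,
    Tendsto (fun J => ∑ k ∈ modeBall J, l (trig m k) • (amp H ν lam k • modeCurve hβ ν α k t))
      atTop (𝓝 w) ∧ w =ᵐ[μ] fun ω => l (Ψ ω t)

theorem IsAdmissible.exists_isStationaryField [IsProbabilityMeasure μ]
    (hp : IsAdmissible H ν α lam) {m : ℕ} {γ : ℝ} (hγ : 0 < γ)
    (hsum1 : Summable fun k => lam k * α k ^ (2 * γ - 2 * H) * k.length ^ (2 * m))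
    (hsum2 : Summable fun k =>
      lam k * α k ^ (-(2 * H)) * k.length ^ (2 * (m : ℝ) + 2 * γ)) :
    ∃ Ψ : S → PathSpace m, IsStationaryField hβ ν α lam Ψ := by
  obtain ⟨δ, hδ, r, hr, h1, h2⟩ := hp.exists_modeCurve_bound hβ hγ hsum1 hsum2
  obtain ⟨Ψ, hm, h⟩ := exists_field hβ m hδ
    (fun k t => Submodule.smul_mem _ _ (hp.modeCurve_mem hβ k t))
    (fun k l hkl t s => by
      rw [real_inner_smul_left, real_inner_smul_right, hp.inner_modeCurve hβ hkl, mul_zero,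
        mul_zero]) hr h1 h2
  exact ⟨Ψ, hm, fun t => (h t).1, fun t => (h t).2⟩

theorem IsAdmissible.inner_sum_modeCurve (hp : IsAdmissible H ν α lam) (F : Finset Mode)
    (a b : Mode → ℝ) (t s : ℝ) :
    inner ℝ (∑ k ∈ F, a k • (amp H ν lam k • modeCurve hβ ν α k t))
      (∑ k ∈ F, b k • (amp H ν lam k • modeCurve hβ ν α k s)) =
    ∑ k ∈ F, a k * b k * inner ℝ (amp H ν lam k • modeCurve hβ ν α k t)
      (amp H ν lam k • modeCurve hβ ν α k s) := by
  rw [sum_inner]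
  refine Finset.sum_congr rfl fun k hk => ?_
  rw [inner_sum, Finset.sum_eq_single_of_mem k hk fun l _ hl => by
    simp only [real_inner_smul_left, real_inner_smul_right, hp.inner_modeCurve hβ hl.symm,
      mul_zero], real_inner_smul_left, real_inner_smul_right]
  ring

/-- Orthogonality of the modes makes every covariance of the field a single sum over modes,
dominated by `∑ r_k²` uniformly in times and points. Stationarity and decay are then inherited from
each mode, the latter by dominated convergence. -/
theorem IsAdmissible.exists_isDecorrelatingField (hp : IsAdmissible H ν α lam) {m : ℕ} {γ : ℝ}
    (hγ : 0 < γ) (hsum1 : Summable fun k => lam k * α k ^ (2 * γ - 2 * H) * k.length ^ (2 * m))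
    (hsum2 : Summable fun k =>
      lam k * α k ^ (-(2 * H)) * k.length ^ (2 * (m : ℝ) + 2 * γ))
    {Ψ : S → PathSpace m} (hΨ : IsStationaryField hβ ν α lam Ψ) :
    ∃ W : ℝ → Torus → Lp ℝ 2 μ, IsDecorrelatingField hβ Ψ W := by
  obtain ⟨δ, hδ, r, hr, h1, -⟩ := hp.exists_modeCurve_bound hβ hγ hsum1 hsum2
  have hW := fun (t : ℝ) (x : Torus) => hΨ.tendsto t (Cm.evalCLM x)
  choose W hW1 hW2 using hW
  have hinner : ∀ t s x y, Tendsto (fun J => ∑ k ∈ modeBall J, trig m k x * trig m k y *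
      inner ℝ (amp H ν lam k • modeCurve hβ ν α k t) (amp H ν lam k • modeCurve hβ ν α k s))
      atTop (𝓝 (inner ℝ (W t x) (W s y))) := fun t s x y => by
    refine ((hW1 t x).inner (hW1 s y)).congr fun J => ?_
    exact hp.inner_sum_modeCurve hβ _ _ _ t s
  have htrig : ∀ (k : Mode) (x : Torus), |trig m k x| ≤ 1 := fun k x => by
    have := abs_trigFun_le k.unit k x
    rwa [k.norm_unit] at this
  have hr2 : Summable fun k => r k ^ 2 := by
    refine hr.of_nonneg_of_le (fun k => sq_nonneg _) fun k => ?_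
    exact le_mul_of_one_le_right (sq_nonneg _)
      (Real.one_le_rpow k.one_le_length (by positivity))
  have hbound : ∀ (t s : ℝ) (x y : Torus) (k : Mode), ‖trig m k x * trig m k y *
      inner ℝ (amp H ν lam k • modeCurve hβ ν α k t) (amp H ν lam k • modeCurve hβ ν α k s)‖ ≤
      r k ^ 2 := by
    intro t s x y k
    rw [norm_mul, norm_mul, sq, Real.norm_eq_abs (trig m k x), Real.norm_eq_abs (trig m k y)]
    have h2 := (norm_inner_le_norm (𝕜 := ℝ) (amp H ν lam k • modeCurve hβ ν α k t)
      (amp H ν lam k • modeCurve hβ ν α k s)).trans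
      (mul_le_mul (h1 k t) (h1 k s) (norm_nonneg _) ((norm_nonneg _).trans (h1 k t)))
    have h3 : |trig m k x| * |trig m k y| ≤ 1 :=
      mul_le_one₀ (htrig k x) (abs_nonneg _) (htrig k y)
    exact (mul_le_of_le_one_left (norm_nonneg _) h3).trans h2
  refine ⟨W, hΨ.measurable, fun t x => ?_, fun t x => hW2 t x, fun q t s x y => ?_, fun x y => ?_⟩
  · refine hβ.isClosed_space.mem_of_tendsto (hW1 t x) (Eventually.of_forall fun J => ?_)
    exact Submodule.sum_mem _ fun k _ => Submodule.smul_mem _ _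
      (Submodule.smul_mem _ _ (hp.modeCurve_mem hβ k t))
  · refine tendsto_nhds_unique (hinner (t + q) (s + q) x y) ((hinner t s x y).congr fun J => ?_)
    refine Finset.sum_congr rfl fun k _ => ?_
    simp only [real_inner_smul_left, real_inner_smul_right]
    unfold modeCurve
    rw [(hβ.isFBMCurve k).inner_fou_stationary hp.H_pos (hp.rate_pos k)]
  · have htsum : ∀ t, inner ℝ (W t x) (W 0 y) = ∑' k, trig m k x * trig m k y *
        inner ℝ (amp H ν lam k • modeCurve hβ ν α k t)
          (amp H ν lam k • modeCurve hβ ν α k 0) := fun t => by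
      refine tendsto_nhds_unique (hinner t 0 x y) ?_
      exact (Summable.of_norm_bounded hr2 (hbound t 0 x y)).hasSum.comp tendsto_modeBall
    simp only [htsum]
    have h0 : 𝓝 (0 : ℝ) = 𝓝 (∑' _ : Mode, (0 : ℝ)) := by rw [tsum_zero]
    rw [h0]
    refine tendsto_tsum_of_dominated_convergence hr2 (fun k => ?_)
      (Eventually.of_forall fun t k => hbound t 0 x y k)
    have h2 := (hβ.isFBMCurve k).tendsto_inner_fou hp.H_pos hp.H_lt_one (hp.rate_pos k)
    have h3 := h2.const_mul (trig m k x * trig m k y * (amp H ν lam k * amp H ν lam k))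
    rw [mul_zero] at h3
    refine h3.congr fun t => ?_
    rw [real_inner_smul_left, real_inner_smul_right]
    unfold modeCurve
    ring

end Parameters

end FracField

end

noncomputable section

namespace FracField

/-! ### The Hilbert space `V` -/

section HilbertSpace

theorem dense_span_mono : (Submodule.span ℂ (Set.range mono)).topologicalClosure = ⊤ :=
  UnitAddTorus.span_mFourierLp_closure_eq_top (d := Fin 2) (p := 2) (by simp)

theorem inner_mono_zero (f : Lp ℂ 2 torusMeasure) :
    inner ℂ (mono 0) f = ∫ x, f x ∂torusMeasure := by
  rw [L2.inner_def]
  refine integral_congr_ae ?_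
  filter_upwards [ContinuousMap.coeFn_toLp (p := 2) (𝕜 := ℂ) torusMeasure
    (UnitAddTorus.mFourier (0 : Fin 2 → ℤ))] with x hx
  have : mono 0 x = 1 := by
    refine hx.trans ?_
    rw [UnitAddTorus.mFourier_zero, ContinuousMap.one_apply]
  rw [this, RCLike.inner_apply]
  simp

theorem mem_V_iff (f : Lp ℂ 2 torusMeasure) : f ∈ V ↔ inner ℂ (mono 0) f = 0 := by
  rw [inner_mono_zero]
  rfl

theorem isClosed_V : IsClosed (V : Set (Lp ℂ 2 torusMeasure)) := by
  have h : (V : Set (Lp ℂ 2 torusMeasure)) = {f | inner ℂ (mono 0) f = 0} :=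
    Set.ext fun f => mem_V_iff f
  rw [h]
  exact isClosed_eq (by fun_prop) continuous_const

instance : CompleteSpace V := isClosed_V.completeSpace_coe

theorem coe_e (k : Mode) : (e k : Lp ℂ 2 torusMeasure) = mono k.1 := rfl

theorem inner_e (k : Mode) (f : V) :
    inner ℂ (e k) f = inner ℂ (mono k.1) (f : Lp ℂ 2 torusMeasure) := rfl

theorem orthonormal_e : Orthonormal ℂ e := by
  classical
  rw [orthonormal_iff_ite]
  intro k l
  rw [inner_e, coe_e, orthonormal_iff_ite.1 orthonormal_mono]
  exact if_congr Subtype.ext_iff.symm rfl rfl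

/-- The exponentials are complete in `L²`, and the one exponential absent from `V`, the constant, is
orthogonal to `V` by the mean zero condition. -/
theorem eq_zero_of_forall_inner_e {f : V} (h : ∀ k, inner ℂ (e k) f = 0) : f = 0 := by
  have h1 : ∀ n, inner ℂ (mono n) (f : Lp ℂ 2 torusMeasure) = 0 := by
    intro n
    by_cases hn : n = 0
    · rw [hn]
      exact (mem_V_iff _).1 f.2
    · exact h ⟨n, hn⟩
  have h2 : (f : Lp ℂ 2 torusMeasure) ∈ (Submodule.span ℂ (Set.range mono))ᗮ := by
    rw [Submodule.mem_orthogonal]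
    intro u hu
    induction hu using Submodule.span_induction with
    | mem u hu => obtain ⟨n, rfl⟩ := hu; exact h1 n
    | zero => exact inner_zero_left _
    | add u v _ _ hu hv => rw [inner_add_left, hu, hv, add_zero]
    | smul c u _ hu => rw [inner_smul_left, hu, mul_zero]
  rw [(Submodule.topologicalClosure_eq_top_iff).1 dense_span_mono] at h2
  exact Subtype.ext ((Submodule.mem_bot ℂ).1 h2)

/-- The exponentials `e_k`, as a Hilbert basis of `V`. -/
def basisV : HilbertBasis Mode ℂ V :=
  HilbertBasis.mkOfOrthogonalEqBot orthonormal_e <| by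
    rw [Submodule.eq_bot_iff]
    intro f hf
    refine eq_zero_of_forall_inner_e fun k => ?_
    exact (Submodule.mem_orthogonal _ _).1 hf _ (Submodule.subset_span ⟨k, rfl⟩)

theorem basisV_apply (k : Mode) : basisV k = e k := by
  unfold basisV
  rw [HilbertBasis.coe_mkOfOrthogonalEqBot]

theorem ext_inner_e {f g : V} (h : ∀ k, inner ℂ (e k) f = inner ℂ (e k) g) : f = g := by
  refine sub_eq_zero.1 (eq_zero_of_forall_inner_e fun k => ?_)
  rw [inner_sub_right, h k, sub_self]

theorem hasSum_inner_e_smul (f : V) : HasSum (fun k => inner ℂ (e k) f • e k) f := by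
  have h := basisV.hasSum_repr f
  simpa only [HilbertBasis.repr_apply_apply, basisV_apply] using h

theorem hasSum_norm_inner_e_sq (f : V) : HasSum (fun k => ‖inner ℂ (e k) f‖ ^ 2) (‖f‖ ^ 2) := by
  have h := basisV.hasSum_inner_mul_inner f f
  simp only [basisV_apply] at h
  have h2 := Complex.hasSum_re h
  rw [inner_self_eq_norm_sq_to_K] at h2
  convert h2 using 1
  · funext k
    rw [← inner_conj_symm f (e k), RCLike.conj_mul]
    norm_cast
  · norm_cast

theorem inner_e_smul_e [DecidableEq Mode] (k l : Mode) (c : ℂ) :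
    inner ℂ (e k) (c • e l) = if k = l then c else 0 := by
  refine (inner_smul_right (e k) (e l) c).trans ?_
  rw [orthonormal_iff_ite.1 orthonormal_e, mul_ite, mul_one, mul_zero]

theorem norm_sub_sum_inner_e_le (f : V) (F : Finset Mode) :
    ‖∑ k ∈ F, inner ℂ (e k) f • e k - f‖ ≤ ‖f‖ := by
  refine le_of_sq_le_sq ?_ (norm_nonneg _)
  rw [← (hasSum_norm_inner_e_sq f).tsum_eq, ← (hasSum_norm_inner_e_sq _).tsum_eq]
  refine (hasSum_norm_inner_e_sq _).summable.tsum_le_tsum (fun k => ?_)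
    (hasSum_norm_inner_e_sq f).summable
  classical
  have h1 : inner ℂ (e k) (∑ l ∈ F, inner ℂ (e l) f • e l - f) =
      if k ∈ F then 0 else -inner ℂ (e k) f := by
    rw [inner_sub_right, inner_sum]
    simp only [inner_e_smul_e, Finset.sum_ite_eq]
    split_ifs <;> simp
  rw [h1]
  split_ifs
  · rw [norm_zero, sq, zero_mul]
    exact sq_nonneg _
  · rw [norm_neg]

/-! ### The semigroup in Fourier coordinates -/

section Semigroup

variable {ν c : ℝ} {α : Mode → ℝ}

theorem exp_rate_le (hν : 0 < ν) (hα : ∀ k, c ≤ α k) {t : ℝ} (ht : 0 ≤ t) (k : Mode) :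
    Real.exp (-(t * ν * α k)) ≤ Real.exp (-(t * ν * c)) := by
  refine Real.exp_le_exp.2 (neg_le_neg ?_)
  have := hα k
  gcongr

theorem summable_semigroup (hν : 0 < ν) (hc : 0 < c) (hα : ∀ k, c ≤ α k)
    {t : ℝ} (ht : 0 ≤ t) (f : V) :
    Summable fun k => ((Real.exp (-(t * ν * α k)) : ℂ) * inner ℂ (e k) f) • e k := by
  refine (orthonormal_e.orthogonalFamily.summable_iff_norm_sq_summable
    (fun k => (Real.exp (-(t * ν * α k)) : ℂ) * inner ℂ (e k) f)).2 ?_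
  refine (hasSum_norm_inner_e_sq f).summable.of_nonneg_of_le (fun k => sq_nonneg _) fun k => ?_
  rw [norm_mul]
  have h1 : ‖(Real.exp (-(t * ν * α k)) : ℂ)‖ ≤ 1 := by
    rw [Complex.norm_real, Real.norm_of_nonneg (Real.exp_nonneg _)]
    refine Real.exp_le_one_iff.2 (neg_nonpos.2 ?_)
    have := hc.le.trans (hα k)
    positivity
  exact pow_le_pow_left₀ (by positivity) (mul_le_of_le_one_left (norm_nonneg _) h1) 2

theorem inner_e_semigroup (hν : 0 < ν) (hc : 0 < c) (hα : ∀ k, c ≤ α k)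
    {t : ℝ} (ht : 0 ≤ t) (f : V) (k : Mode) :
    inner ℂ (e k) (semigroup ν α t f) = (Real.exp (-(t * ν * α k)) : ℂ) * inner ℂ (e k) f := by
  classical
  have h := (innerSL ℂ (e k)).hasSum (summable_semigroup hν hc hα ht f).hasSum
  have h2 : ∀ l, innerSL ℂ (e k) (((Real.exp (-(t * ν * α l)) : ℂ) * inner ℂ (e l) f) • e l) =
      if l = k then (Real.exp (-(t * ν * α k)) : ℂ) * inner ℂ (e k) f else 0 := by
    intro l
    rw [innerSL_apply_apply, inner_e_smul_e]
    by_cases hkl : k = l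
    · subst hkl
      rw [if_pos rfl]
    · rw [if_neg hkl, if_neg (Ne.symm hkl)]
  simp only [h2] at h
  exact h.unique (hasSum_ite_eq k _)

theorem semigroup_sub (hν : 0 < ν) (hc : 0 < c) (hα : ∀ k, c ≤ α k)
    {t : ℝ} (ht : 0 ≤ t) (f g : V) :
    semigroup ν α t (f - g) = semigroup ν α t f - semigroup ν α t g :=
  ext_inner_e fun k => by
    simp only [inner_sub_right, inner_e_semigroup hν hc hα ht, mul_sub]

theorem norm_semigroup_le (hν : 0 < ν) (hc : 0 < c) (hα : ∀ k, c ≤ α k)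
    {t : ℝ} (ht : 0 ≤ t) (f : V) :
    ‖semigroup ν α t f‖ ≤ Real.exp (-(t * ν * c)) * ‖f‖ := by
  refine le_of_sq_le_sq ?_ (by positivity)
  rw [mul_pow, ← (hasSum_norm_inner_e_sq f).tsum_eq, ← (hasSum_norm_inner_e_sq _).tsum_eq,
    ← tsum_mul_left]
  refine (hasSum_norm_inner_e_sq _).summable.tsum_le_tsum (fun k => ?_)
    ((hasSum_norm_inner_e_sq f).summable.mul_left _)
  rw [inner_e_semigroup hν hc hα ht, norm_mul, mul_pow, Complex.norm_real,
    Real.norm_of_nonneg (Real.exp_nonneg _)]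
  refine mul_le_mul_of_nonneg_right (pow_le_pow_left₀ (Real.exp_nonneg _) ?_ 2) (sq_nonneg _)
  exact exp_rate_le hν hα ht k

theorem continuous_semigroup (hν : 0 < ν) (hc : 0 < c) (hα : ∀ k, c ≤ α k)
    {t : ℝ} (ht : 0 ≤ t) : Continuous (semigroup ν α t) := by
  refine (LipschitzWith.of_dist_le_mul (K := 1) fun f g => ?_).continuous
  rw [dist_eq_norm, dist_eq_norm, ← semigroup_sub hν hc hα ht]
  refine (norm_semigroup_le hν hc hα ht _).trans ?_
  refine mul_le_mul_of_nonneg_right ?_ (norm_nonneg _)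
  exact Real.exp_le_one_iff.2 (neg_nonpos.2 (by positivity))

end Semigroup

/-- A `C^m` function as a complex continuous function. -/
def toComplexMap (m : ℕ) : Cm m →L[ℝ] C(Torus, ℂ) :=
  LinearMap.mkContinuous
    { toFun := fun f => ⟨fun x => (f x : ℂ), Complex.continuous_ofReal.comp (Cm.continuous_coe f)⟩
      map_add' := fun f g => ContinuousMap.ext fun x => by simp
      map_smul' := fun c f => ContinuousMap.ext fun x => by simp } 1 fun f => by
    rw [one_mul, ContinuousMap.norm_le _ (norm_nonneg _)]
    intro x
    simpa using f.norm_apply_le x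

theorem toComplexMap_apply {m : ℕ} (f : Cm m) (x : Torus) : toComplexMap m f x = (f x : ℂ) := rfl

/-- The inclusion of `C^m` in `L²`. -/
def toL2 (m : ℕ) : Cm m →L[ℝ] Lp ℂ 2 torusMeasure :=
  ((ContinuousMap.toLp 2 torusMeasure ℂ).restrictScalars ℝ).comp (toComplexMap m)

theorem coeFn_toL2 {m : ℕ} (f : Cm m) : toL2 m f =ᵐ[torusMeasure] fun x => ((f x : ℝ) : ℂ) :=
  ContinuousMap.coeFn_toLp torusMeasure _

/-- The map from `C^m` to `V` that subtracts the mean. -/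
def embed (m : ℕ) : Cm m →L[ℝ] V :=
  (V.orthogonalProjectionOnto.restrictScalars ℝ).comp (toL2 m)

theorem inner_e_embed {m : ℕ} (k : Mode) (f : Cm m) :
    inner ℂ (e k) (embed m f) = inner ℂ (mono k.1) (toL2 m f) :=
  Submodule.inner_orthogonalProjectionOnto_eq_of_mem_left _ _

theorem coe_embed {m : ℕ} {f : Cm m} (h : inner ℂ (mono 0) (toL2 m f) = 0) :
    (embed m f : Lp ℂ 2 torusMeasure) = toL2 m f :=
  congrArg Subtype.val (Submodule.orthogonalProjectionOnto_mem_subspace_eq_self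
    (K := V) ⟨toL2 m f, (mem_V_iff _).2 h⟩)

theorem eq_of_ae_eq {m : ℕ} {f g : Cm m}
    (h : (fun x => ((f x : ℝ) : ℂ)) =ᵐ[torusMeasure] fun x => ((g x : ℝ) : ℂ)) : f = g := by
  have h1 := (Continuous.ae_eq_iff_eq torusMeasure
    (Complex.continuous_ofReal.comp (Cm.continuous_coe f))
    (Complex.continuous_ofReal.comp (Cm.continuous_coe g))).1 h
  ext x
  exact Complex.ofReal_injective (congrFun h1 x)

end HilbertSpace

end FracField

end

noncomputable section

namespace FracField

/-! ### Fourier coefficients of the stationary field -/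

section Coefficients

theorem toL2_trig (m : ℕ) (k : Mode) :
    toL2 m (trig m k) = (k.unit / 2) • mono k.1 + ((starRingEnd ℂ) k.unit / 2) • mono k.neg.1 := by
  have h : toComplexMap m (trig m k) = (k.unit / 2) • UnitAddTorus.mFourier k.1 +
      ((starRingEnd ℂ) k.unit / 2) • UnitAddTorus.mFourier k.neg.1 := by
    ext x
    rw [toComplexMap_apply, trig_apply, trigFun, Complex.re_eq_add_conj, map_mul]
    simp only [ContinuousMap.add_apply, ContinuousMap.smul_apply, smul_eq_mul, Mode.neg,
      UnitAddTorus.mFourier_neg]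
    ring
  change ContinuousMap.toLp 2 torusMeasure ℂ (toComplexMap m (trig m k)) = _
  rw [h, map_add, map_smul, map_smul]
  rfl

theorem inner_mono_toL2_trig (m : ℕ) (n : Fin 2 → ℤ) (k : Mode) :
    inner ℂ (mono n) (toL2 m (trig m k)) = (if n = k.1 then k.unit / 2 else 0) +
      if n = k.neg.1 then (starRingEnd ℂ) k.unit / 2 else 0 := by
  rw [toL2_trig, inner_add_right, inner_smul_right, inner_smul_right,
    orthonormal_iff_ite.1 orthonormal_mono, orthonormal_iff_ite.1 orthonormal_mono]
  simp only [mul_ite, mul_one, mul_zero]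

/-- The Fourier coefficient as a real-linear functional. -/
def fourierFunctional (m : ℕ) (n : Fin 2 → ℤ) : Cm m →L[ℝ] ℂ :=
  ((innerSL ℂ (mono n)).restrictScalars ℝ).comp (toL2 m)

theorem fourierFunctional_apply {m : ℕ} (n : Fin 2 → ℤ) (f : Cm m) :
    fourierFunctional m n f = inner ℂ (mono n) (toL2 m f) := rfl

variable {S : Type*} [MeasurableSpace S] {μ : Measure S} {H ν : ℝ} {α lam : Mode → ℝ}
  {β : Mode → ℝ → S → ℂ} {hβ : IsNoise μ H β} {m : ℕ} {Ψ : S → PathSpace m}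

/-- When `l` sees only finitely many trigonometric functions, the sums over `modeBall` become
constant and equal their limit. This is how a Fourier coefficient of the field is read off. -/
theorem IsStationaryField.ae_eq_sum (hΨ : IsStationaryField hβ ν α lam Ψ) (t : ℝ)
    (l : Cm m →L[ℝ] ℝ) (G : Finset Mode) (hG : ∀ k ∉ G, l (trig m k) = 0) :
    ∀ᵐ ω ∂μ, l (Ψ ω t) = ∑ k ∈ G, l (trig m k) * (amp H ν lam k * modeCurve hβ ν α k t ω) := by
  obtain ⟨w, hw1, hw2⟩ := hΨ.tendsto t l
  have h1 : ∀ᶠ J in atTop, ∑ k ∈ modeBall J, l (trig m k) • (amp H ν lam k • modeCurve hβ ν α k t) =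
      ∑ k ∈ G, l (trig m k) • (amp H ν lam k • modeCurve hβ ν α k t) := by
    filter_upwards [tendsto_modeBall.eventually_ge_atTop G] with J hJ
    refine (Finset.sum_subset hJ fun k _ hk => ?_).symm
    rw [hG k hk, zero_smul]
  have h2 : w = ∑ k ∈ G, l (trig m k) • (amp H ν lam k • modeCurve hβ ν α k t) :=
    tendsto_nhds_unique hw1 (tendsto_const_nhds.congr' (h1.mono fun J hJ => hJ.symm))
  have h3 : w =ᵐ[μ] fun ω => ∑ k ∈ G,
      (l (trig m k) • (amp H ν lam k • modeCurve hβ ν α k t) : Lp ℝ 2 μ) ω := by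
    rw [h2]
    exact Lp.coeFn_fun_finsetSum _ _
  have h4 : ∀ᵐ ω ∂μ, ∀ k ∈ G,
      (l (trig m k) • (amp H ν lam k • modeCurve hβ ν α k t) : Lp ℝ 2 μ) ω =
        l (trig m k) * (amp H ν lam k * modeCurve hβ ν α k t ω) :=
    (Finset.eventually_all _).2 fun k _ => by
      filter_upwards [Lp.coeFn_smul (l (trig m k)) (amp H ν lam k • modeCurve hβ ν α k t),
        Lp.coeFn_smul (amp H ν lam k) (modeCurve hβ ν α k t)] with ω h5 h6
      rw [h5, Pi.smul_apply, h6, Pi.smul_apply, smul_eq_mul, smul_eq_mul]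
  filter_upwards [hw2, h3, h4] with ω h5 h6 h7
  rw [← h5, h6]
  exact Finset.sum_congr rfl h7

theorem IsStationaryField.ae_fourier_eq_sum (hΨ : IsStationaryField hβ ν α lam Ψ) (t : ℝ)
    (n : Fin 2 → ℤ) (G : Finset Mode) (hG : ∀ k ∉ G, n ≠ k.1 ∧ n ≠ k.neg.1) :
    ∀ᵐ ω ∂μ, inner ℂ (mono n) (toL2 m (Ψ ω t)) = ∑ k ∈ G,
      inner ℂ (mono n) (toL2 m (trig m k)) *
        ((amp H ν lam k * modeCurve hβ ν α k t ω : ℝ) : ℂ) := by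
  have h0 : ∀ k ∉ G, fourierFunctional m n (trig m k) = 0 := fun k hk => by
    rw [fourierFunctional_apply, inner_mono_toL2_trig, if_neg (hG k hk).1, if_neg (hG k hk).2,
      add_zero]
  have h1 := hΨ.ae_eq_sum t (Complex.reCLM.comp (fourierFunctional m n)) G fun k hk => by
    rw [ContinuousLinearMap.comp_apply, h0 k hk, map_zero]
  have h2 := hΨ.ae_eq_sum t (Complex.imCLM.comp (fourierFunctional m n)) G fun k hk => by
    rw [ContinuousLinearMap.comp_apply, h0 k hk, map_zero]
  filter_upwards [h1, h2] with ω h3 h4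
  simp only [ContinuousLinearMap.comp_apply, fourierFunctional_apply, Complex.reCLM_apply,
    Complex.imCLM_apply] at h3 h4
  refine Complex.ext ?_ ?_
  · rw [h3, Complex.re_sum]
    exact Finset.sum_congr rfl fun k _ => (Complex.re_mul_ofReal _ _).symm
  · rw [h4, Complex.im_sum]
    exact Finset.sum_congr rfl fun k _ => (Complex.im_mul_ofReal _ _).symm

theorem IsStationaryField.ae_inner_mono_zero (hΨ : IsStationaryField hβ ν α lam Ψ) (t : ℝ) :
    ∀ᵐ ω ∂μ, inner ℂ (mono 0) (toL2 m (Ψ ω t)) = 0 := by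
  have h := hΨ.ae_fourier_eq_sum t 0 ∅ fun k _ => ⟨k.2.symm, k.neg.2.symm⟩
  simpa only [Finset.sum_empty] using h

theorem Mode.ne_neg (k : Mode) : k ≠ k.neg := fun h => by
  have h1 := k.pos_neg_iff
  rw [← h] at h1
  tauto

theorem IsAdmissible.amp_neg (hp : IsAdmissible H ν α lam) (k : Mode) :
    amp H ν lam k.neg = amp H ν lam k := by
  unfold amp
  rw [hp.lam_neg]

/-- The coefficient at `e_k` receives contributions from `trig_k` and `trig_{-k}`, each with a
factor `1/2` from taking real parts. The `√2` in `amp` converts this `1/2` into the `1/√2` in the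
definition of `β_k`. -/
theorem IsStationaryField.ae_inner_e (hp : IsAdmissible H ν α lam)
    (hΨ : IsStationaryField hβ ν α lam Ψ) (t : ℝ) (k : Mode) :
    ∀ᵐ ω ∂μ, inner ℂ (e k) (embed m (Ψ ω t)) = (amp H ν lam k / 2 : ℝ) *
      (k.unit * (modeCurve hβ ν α k t ω : ℝ) +
        (starRingEnd ℂ) k.neg.unit * (modeCurve hβ ν α k.neg t ω : ℝ)) := by
  classical
  have h := hΨ.ae_fourier_eq_sum t k.1 {k, k.neg} fun l hl => by
    simp only [Finset.mem_insert, Finset.mem_singleton, not_or] at hl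
    refine ⟨fun h => hl.1 (Subtype.ext h.symm), fun h => hl.2 ?_⟩
    rw [← l.neg_neg, show l.neg = k from Subtype.ext h.symm]
  filter_upwards [h] with ω hω
  have h1 : k.1 ≠ k.neg.1 := fun h => k.ne_neg (Subtype.ext h)
  rw [inner_e_embed, hω, Finset.sum_pair k.ne_neg, inner_mono_toL2_trig, inner_mono_toL2_trig,
    if_pos rfl, if_neg h1, if_neg h1, k.neg_neg, if_pos rfl, hp.amp_neg]
  push_cast
  ring

end Coefficients

/-! ### The mild formulation -/

section Mild

theorem wienerIntegral_exp_eq (ν a : ℝ) (b : ℝ → ℂ) (s t : ℝ) :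
    wienerIntegral (fun u => Real.exp (-((t - u) * ν * a))) b s t =
      b t - (Real.exp (-(ν * a * (t - s))) : ℂ) * b s -
        ∫ u in s..t, ((expWeight (ν * a) (t - u) : ℝ) : ℂ) * b u := by
  have h1 : _root_.deriv (fun u => Real.exp (-((t - u) * ν * a))) =
      fun u => expWeight (ν * a) (t - u) := by
    funext u
    have h2 : HasDerivAt (fun u => -((t - u) * ν * a)) (-(-1 * ν * a)) u :=
      ((((hasDerivAt_id u).const_sub t).mul_const ν).mul_const a).neg
    rw [h2.exp.deriv, expWeight]
    rw [show (t - u) * ν * a = ν * a * (t - u) by ring]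
    ring
  unfold wienerIntegral
  rw [h1]
  beta_reduce
  rw [sub_self, zero_mul, zero_mul, neg_zero, Real.exp_zero, Complex.ofReal_one, one_mul,
    show (t - s) * ν * a = ν * a * (t - s) by ring]

/-- The pathwise integral `∫_s^t exp(-a(t-u)) dx(u)` of a real path. -/
def pathConv (a : ℝ) (x : ℝ → ℝ) (s t : ℝ) : ℝ :=
  x t - Real.exp (-(a * (t - s))) * x s - ∫ u in s..t, expWeight a (t - u) * x u

theorem wienerIntegral_combination {ν a : ℝ} {x y : ℝ → ℝ} (hx : Continuous x) (hy : Continuous y)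
    (p q : ℂ) (s t : ℝ) :
    wienerIntegral (fun u => Real.exp (-((t - u) * ν * a)))
      (fun u => (p * (x u : ℝ) + q * (y u : ℝ)) / (Real.sqrt 2 : ℝ)) s t =
      (p * (pathConv (ν * a) x s t : ℝ) + q * (pathConv (ν * a) y s t : ℝ)) /
        (Real.sqrt 2 : ℝ) := by
  have hE : Continuous fun u => expWeight (ν * a) (t - u) :=
    (continuous_expWeight _).comp (by fun_prop)
  have hi : ∀ z : ℝ → ℝ, Continuous z → ∀ p : ℂ, IntervalIntegrable
      (fun u => p * ((expWeight (ν * a) (t - u) * z u : ℝ) : ℂ)) volume s t := fun z hz p =>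
    (continuous_const.mul (Complex.continuous_ofReal.comp (hE.mul hz))).intervalIntegrable s t
  have h1 : ∫ u in s..t, ((expWeight (ν * a) (t - u) : ℝ) : ℂ) *
      ((p * (x u : ℝ) + q * (y u : ℝ)) / (Real.sqrt 2 : ℝ)) =
      (p * ((∫ u in s..t, expWeight (ν * a) (t - u) * x u : ℝ) : ℂ) +
        q * ((∫ u in s..t, expWeight (ν * a) (t - u) * y u : ℝ) : ℂ)) / (Real.sqrt 2 : ℝ) := by
    rw [← intervalIntegral.integral_ofReal, ← intervalIntegral.integral_ofReal,
      ← intervalIntegral.integral_const_mul, ← intervalIntegral.integral_const_mul,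
      ← intervalIntegral.integral_add (hi x hx p) (hi y hy q), ← intervalIntegral.integral_div]
    refine intervalIntegral.integral_congr fun u _ => ?_
    push_cast
    ring
  rw [wienerIntegral_exp_eq, h1]
  unfold pathConv
  push_cast
  ring

variable {S : Type*} [MeasurableSpace S] {μ : Measure S} {H ν : ℝ} {α lam : Mode → ℝ}
  {β : Mode → ℝ → S → ℂ} {hβ : IsNoise μ H β} {m : ℕ} {Ψ : S → PathSpace m}

theorem IsNoise.ae_eq_combination (hβ : IsNoise μ H β) (k : Mode) (u : ℝ) :
    ∀ᵐ ω ∂μ, β k u ω = (k.unit * (realNoise β k u ω : ℝ) +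
      (starRingEnd ℂ) k.neg.unit * (realNoise β k.neg u ω : ℝ)) / (Real.sqrt 2 : ℝ) := by
  filter_upwards [hβ.conj k u] with ω hω
  have h2 : ((Real.sqrt 2 : ℝ) : ℂ) ≠ 0 := by
    exact_mod_cast (by positivity : Real.sqrt 2 ≠ 0)
  rw [eq_div_iff h2]
  have hneg := k.pos_neg_iff
  conv_lhs => rw [← Complex.re_add_im (β k u ω)]
  by_cases hk : k.Pos
  · have hk' : ¬ k.neg.Pos := fun h => hneg.1 h hk
    simp only [realNoise, Mode.unit, hk, hk', if_true, if_false, hω, Complex.conj_I,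
      Complex.conj_im]
    push_cast
    ring
  · have hk' : k.neg.Pos := hneg.2 hk
    simp only [realNoise, Mode.unit, hk, hk', if_true, if_false, hω, map_one, Complex.conj_re]
    push_cast
    ring

theorem IsNoise.ae_continuous (hβ : IsNoise μ H β) (k : Mode) :
    ∀ᵐ ω ∂μ, Continuous fun u => β k u ω := by
  filter_upwards [(hβ.fbm_re k).continuous, (hβ.fbm_im k).continuous] with ω h1 h2
  have hs : Real.sqrt 2 ≠ 0 := by positivity
  have h3 : Continuous fun u => (β k u ω).re := by
    simpa [hs] using h1.div_const (Real.sqrt 2)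
  have h4 : Continuous fun u => (β k u ω).im := by
    simpa [hs] using h2.div_const (Real.sqrt 2)
  have h5 : (fun u => β k u ω) = fun u => ((β k u ω).re : ℂ) + ((β k u ω).im : ℂ) * Complex.I :=
    funext fun u => (Complex.re_add_im _).symm
  rw [h5]
  exact (Complex.continuous_ofReal.comp h3).add
    ((Complex.continuous_ofReal.comp h4).mul continuous_const)

/-- The conjugation rule holds almost surely for each single time; rational times and continuity of
paths give one null set for all times, as the pathwise integral requires. -/
theorem IsNoise.ae_forall_eq_combination (hβ : IsNoise μ H β) (k : Mode) :
    ∀ᵐ ω ∂μ, (fun u => β k u ω) = fun u => (k.unit * (realNoise β k u ω : ℝ) +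
      (starRingEnd ℂ) k.neg.unit * (realNoise β k.neg u ω : ℝ)) / (Real.sqrt 2 : ℝ) := by
  have h1 : ∀ᵐ ω ∂μ, ∀ u : ℚ, β k u ω = (k.unit * (realNoise β k u ω : ℝ) +
      (starRingEnd ℂ) k.neg.unit * (realNoise β k.neg u ω : ℝ)) / (Real.sqrt 2 : ℝ) :=
    ae_all_iff.2 fun u => hβ.ae_eq_combination k u
  filter_upwards [h1, hβ.ae_continuous k, (hβ.isFBM k).continuous, (hβ.isFBM k.neg).continuous]
    with ω h2 h3 h4 h5
  refine (Rat.denseRange_cast (𝕜 := ℝ)).equalizer h3 ?_ (funext h2)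
  exact ((continuous_const.mul (Complex.continuous_ofReal.comp h4)).add
    (continuous_const.mul (Complex.continuous_ofReal.comp h5))).div_const _

/-- The variation of constants formula holds in `L²`; `coeFn_intervalIntegral_ae_eq` replaces its
Bochner integral by the pathwise one. -/
theorem IsAdmissible.ae_modeCurve_eq [IsProbabilityMeasure μ] (hp : IsAdmissible H ν α lam)
    (hβ : IsNoise μ H β) (k : Mode) {s t : ℝ} (hst : s ≤ t) :
    ∀ᵐ ω ∂μ, modeCurve hβ ν α k t ω = Real.exp (-(ν * α k * (t - s))) * modeCurve hβ ν α k s ω +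
      pathConv (ν * α k) (fun u => realNoise β k u ω) s t := by
  have h := (hβ.isFBMCurve k).fou_eq_add hp.H_pos (hp.rate_pos k) hst
  have hη := (hβ.isFBMCurve k).continuous hp.H_pos
  have hφ : Continuous fun u => expWeight (ν * α k) (t - u) :=
    (continuous_expWeight _).comp (by fun_prop)
  have hint := coeFn_intervalIntegral_ae_eq (hβ.isFBM k).measurable (hβ.isFBM k).continuous
    (hβ.coeFn_curve k) hη hφ hst
  set E := Real.exp (-(ν * α k * (t - s))) with hE
  have h1 : modeCurve hβ ν α k t =ᵐ[μ] (E • fou (hβ.curve k) (ν * α k) s : Lp ℝ 2 μ) +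
      (hβ.curve k t - E • hβ.curve k s -
        ∫ u in s..t, expWeight (ν * α k) (t - u) • hβ.curve k u : Lp ℝ 2 μ) := by
    rw [modeCurve, h]
    exact Lp.coeFn_add _ _
  filter_upwards [h1, hint, Lp.coeFn_smul E (fou (hβ.curve k) (ν * α k) s),
    Lp.coeFn_sub (hβ.curve k t - E • hβ.curve k s)
      (∫ u in s..t, expWeight (ν * α k) (t - u) • hβ.curve k u),
    Lp.coeFn_sub (hβ.curve k t) (E • hβ.curve k s), Lp.coeFn_smul E (hβ.curve k s),
    hβ.coeFn_curve k t, hβ.coeFn_curve k s] with ω g1 g2 g3 g4 g5 g6 g7 g8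
  rw [g1, Pi.add_apply, g3, g4, Pi.sub_apply, g5, Pi.sub_apply, g6, g2, g7, Pi.smul_apply,
    Pi.smul_apply, g8, smul_eq_mul, smul_eq_mul]
  rfl

/-- The mild equation, mode by mode. The variation of constants formulas for `k` and `-k` share the
rate `ν α_k` and combine into the complex integral against `β_k`. -/
theorem IsStationaryField.ae_inner_e_mild [IsProbabilityMeasure μ] (hp : IsAdmissible H ν α lam)
    (hΨ : IsStationaryField hβ ν α lam Ψ) {s t : ℝ} (hst : s ≤ t) (k : Mode) :
    ∀ᵐ ω ∂μ, ((Real.sqrt (lam k) * ν ^ H : ℝ) : ℂ) *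
        wienerIntegral (fun u => Real.exp (-((t - u) * ν * α k))) (fun u => β k u ω) s t =
      inner ℂ (e k) (embed m (Ψ ω t) - semigroup ν α (t - s) (embed m (Ψ ω s))) := by
  obtain ⟨c, hc, hcα⟩ := hp.exists_le
  filter_upwards [hΨ.ae_inner_e hp t k, hΨ.ae_inner_e hp s k, hβ.ae_forall_eq_combination k,
    hp.ae_modeCurve_eq hβ k hst, hp.ae_modeCurve_eq hβ k.neg hst, (hβ.isFBM k).continuous,
    (hβ.isFBM k.neg).continuous] with ω h1 h2 h3 h4 h5 h6 h7
  rw [inner_sub_right, inner_e_semigroup hp.ν_pos hc hcα (sub_nonneg.2 hst), h1, h2, h3,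
    wienerIntegral_combination h6 h7, h4, h5, hp.α_neg,
    show (t - s) * ν * α k = ν * α k * (t - s) by ring]
  have h8 : ((amp H ν lam k / 2 : ℝ) : ℂ) = ((Real.sqrt (lam k) * ν ^ H : ℝ) : ℂ) /
      ((Real.sqrt 2 : ℝ) : ℂ) := by
    rw [← Complex.ofReal_div]
    congr 1
    have h9 : Real.sqrt 2 * Real.sqrt 2 = 2 := Real.mul_self_sqrt (by norm_num)
    unfold amp
    rw [eq_div_iff (by positivity)]
    linear_combination (Real.sqrt (lam k) * ν ^ H / 2) * h9
  rw [h8]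
  push_cast
  ring

end Mild

end FracField

end

noncomputable section

namespace FracField

/-! ### Time averages along an ergodic flow -/

section Flow

theorem birkhoffSum_flow_eq {X : Type*} {θ : ℝ → X → X} {f : X → ℝ}
    (hflow : ∀ s t, θ (t + s) = θ t ∘ θ s) (hzero : θ 0 = id)
    {x : X} (hx : ∀ T : ℝ, IntegrableOn (fun t => f (θ t x)) (Set.Ioc 0 T)) (n : ℕ) :
    birkhoffSum (θ 1) (fun x => ∫ t in (0 : ℝ)..1, f (θ t x)) n x =
      ∫ t in (0 : ℝ)..n, f (θ t x) := by
  have hiter : ∀ i : ℕ, (θ 1)^[i] = θ i := by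
    intro i
    induction i with
    | zero => rw [Function.iterate_zero, Nat.cast_zero, hzero]
    | succ i ih => rw [Function.iterate_succ, ih, Nat.cast_succ, hflow]
  have hint : ∀ k : ℕ, IntervalIntegrable (fun t => f (θ t x)) volume k (k + 1 : ℕ) := fun k => by
    rw [intervalIntegrable_iff_integrableOn_Ioc_of_le (by exact_mod_cast Nat.le_succ k)]
    exact (hx _).mono_set (Set.Ioc_subset_Ioc_left (Nat.cast_nonneg k))
  have h1 := intervalIntegral.sum_integral_adjacent_intervals (a := fun k : ℕ => (k : ℝ)) (n := n)
    fun k _ => hint k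
  rw [Nat.cast_zero] at h1
  rw [← h1, birkhoffSum]
  refine Finset.sum_congr rfl fun i _ => ?_
  have h2 : ∀ t, θ t ((θ 1)^[i] x) = θ (t + i) x := fun t => by
    rw [hiter, hflow]
    rfl
  simp only [h2]
  rw [intervalIntegral.integral_comp_add_right (fun t => f (θ t x)), zero_add, Nat.cast_succ,
    add_comm]

variable {X : Type*} [MeasurableSpace X] {P : Measure X} [IsProbabilityMeasure P]
  {θ : ℝ → X → X} {f : X → ℝ}

theorem integrable_flow_prod (hθm : Measurable fun p : X × ℝ => θ p.2 p.1)
    (hθ : ∀ t, MeasurePreserving (θ t) P P) (hfm : Measurable f) (hf : Integrable f P) (T : ℝ) :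
    Integrable (fun p : X × ℝ => f (θ p.2 p.1)) (P.prod (volume.restrict (Set.Ioc 0 T))) := by
  refine ⟨(hfm.comp hθm).aestronglyMeasurable, ?_⟩
  have hm : Measurable fun p : X × ℝ => ‖f (θ p.2 p.1)‖ₑ := (hfm.comp hθm).enorm
  rw [hasFiniteIntegral_iff_enorm, lintegral_prod_symm _ hm.aemeasurable]
  have h1 : ∀ t, ∫⁻ x, ‖f (θ t x)‖ₑ ∂P = ∫⁻ x, ‖f x‖ₑ ∂P := fun t =>
    (hθ t).lintegral_comp hfm.enorm
  simp only [h1, lintegral_const]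
  exact ENNReal.mul_lt_top hf.2 (measure_lt_top _ _)

theorem ae_forall_integrableOn_flow (hθm : Measurable fun p : X × ℝ => θ p.2 p.1)
    (hθ : ∀ t, MeasurePreserving (θ t) P P) (hfm : Measurable f) (hf : Integrable f P) :
    ∀ᵐ x ∂P, ∀ T : ℝ, IntegrableOn (fun t => f (θ t x)) (Set.Ioc 0 T) := by
  have h : ∀ᵐ x ∂P, ∀ n : ℕ, IntegrableOn (fun t => f (θ t x)) (Set.Ioc 0 n) :=
    ae_all_iff.2 fun n => (integrable_flow_prod hθm hθ hfm hf n).prod_right_ae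
  filter_upwards [h] with x hx T
  obtain ⟨n, hn⟩ := exists_nat_ge T
  exact (hx n).mono_set (Set.Ioc_subset_Ioc_right hn)

/-- Birkhoff's theorem is applied to the integral of `f` over one unit of the orbit, whose orbit
sums are the integrals over `[0, n]` and whose mean is that of `f` by Fubini and invariance. -/
theorem ae_tendsto_flow_average_nat (hθm : Measurable fun p : X × ℝ => θ p.2 p.1)
    (hθ : ∀ t, MeasurePreserving (θ t) P P) (hflow : ∀ s t, θ (t + s) = θ t ∘ θ s)
    (hzero : θ 0 = id) (herg : ∀ E, MeasurableSet E → θ 1 ⁻¹' E = E → P E = 0 ∨ P E = 1)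
    (hfm : Measurable f) (hf : Integrable f P) :
    ∀ᵐ x ∂P, Tendsto (fun n : ℕ => (∫ t in (0 : ℝ)..n, f (θ t x)) / n) atTop
      (𝓝 (∫ x, f x ∂P)) := by
  have hprod := integrable_flow_prod hθm hθ hfm hf 1
  have hgm : Measurable fun x => ∫ t in (0 : ℝ)..1, f (θ t x) := by
    simp only [intervalIntegral.integral_of_le zero_le_one]
    exact ((hfm.comp hθm).stronglyMeasurable.integral_prod_right'
      (ν := volume.restrict (Set.Ioc (0 : ℝ) 1))).measurable
  have hg : Integrable (fun x => ∫ t in (0 : ℝ)..1, f (θ t x)) P := by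
    simp only [intervalIntegral.integral_of_le zero_le_one]
    exact hprod.integral_prod_left
  have hint : ∫ x, (∫ t in (0 : ℝ)..1, f (θ t x)) ∂P = ∫ x, f x ∂P := by
    simp only [intervalIntegral.integral_of_le zero_le_one]
    rw [integral_integral_swap hprod]
    have h1 : ∀ t, ∫ x, f (θ t x) ∂P = ∫ x, f x ∂P := fun t => by
      rw [← integral_map (hθ t).measurable.aemeasurable hfm.aestronglyMeasurable, (hθ t).map_eq]
    simp only [h1, integral_const]
    simp
  have h := ae_tendsto_birkhoffSum_div (hθ 1) herg hgm hg
  rw [hint] at h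
  filter_upwards [h, ae_forall_integrableOn_flow hθm hθ hfm hf] with x h1 h2
  simpa only [birkhoffSum_flow_eq hflow hzero h2] using h1

theorem ae_tendsto_flow_average (hθm : Measurable fun p : X × ℝ => θ p.2 p.1)
    (hθ : ∀ t, MeasurePreserving (θ t) P P) (hflow : ∀ s t, θ (t + s) = θ t ∘ θ s)
    (hzero : θ 0 = id) (herg : ∀ E, MeasurableSet E → θ 1 ⁻¹' E = E → P E = 0 ∨ P E = 1)
    (hfm : Measurable f) (hf : Integrable f P) :
    ∀ᵐ x ∂P, (∀ T, 0 ≤ T → IntervalIntegrable (fun t => f (θ t x)) volume 0 T) ∧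
      Tendsto (fun T : ℝ => 1 / T * ∫ t in (0 : ℝ)..T, f (θ t x)) atTop (𝓝 (∫ x, f x ∂P)) := by
  filter_upwards [ae_forall_integrableOn_flow hθm hθ hfm hf,
    ae_tendsto_flow_average_nat hθm hθ hflow hzero herg hfm hf,
    ae_tendsto_flow_average_nat hθm hθ hflow hzero herg hfm.abs hf.abs] with x h1 h2 h3
  have h4 : ∀ T, 0 ≤ T → IntervalIntegrable (fun t => f (θ t x)) volume 0 T := fun T hT =>
    (intervalIntegrable_iff_integrableOn_Ioc_of_le hT).2 (h1 T)
  exact ⟨h4, tendsto_timeAverage h4 h2 h3⟩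

end Flow

/-! ### The stationary field solves the equation -/

section Solution

variable {S : Type*} [MeasurableSpace S] {μ : Measure S} {H ν : ℝ} {α lam : Mode → ℝ}
  {β : Mode → ℝ → S → ℂ} {m : ℕ} {Ψ : S → PathSpace m}

theorem measurable_embed (m : ℕ) : Measurable (embed m) := (embed m).continuous.measurable

theorem measurable_eval (m : ℕ) : Measurable fun p : PathSpace m × ℝ => p.1 p.2 :=
  Continuous.measurable continuous_eval

theorem measurable_process (hΨ : Measurable Ψ) : Measurable fun p : ℝ × S => Ψ p.2 p.1 :=
  (measurable_eval m).comp ((hΨ.comp measurable_snd).prodMk measurable_fst)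

theorem measurable_embed_process (hΨ : Measurable Ψ) :
    Measurable fun p : ℝ × S => embed m (Ψ p.2 p.1) :=
  (measurable_embed m).comp (measurable_process hΨ)

theorem measurable_embed_eval (hΨ : Measurable Ψ) (t : ℝ) :
    Measurable fun ω => embed m (Ψ ω t) :=
  (measurable_embed m).comp (measurable_pathSpace_iff.1 hΨ t)

theorem continuous_partial_sum (F : Finset Mode) :
    Continuous fun f : V => ∑ k ∈ F, inner ℂ (e k) f • e k :=
  continuous_finsetSum _ fun k _ => ((innerSL ℂ (e k)).continuous).smul continuous_const

/-- The Fourier series of `Z ω` converges for every `ω` and its remainder never exceeds `‖Z ω‖`, so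
dominated convergence applies. -/
theorem tendsto_eLpNorm_partial_sum {Z : S → V} (hZ : MemLp Z 2 μ) :
    Tendsto (fun F : Finset Mode => eLpNorm (fun ω => ∑ k ∈ F, inner ℂ (e k) (Z ω) • e k - Z ω) 2 μ)
      atTop (𝓝 0) := by
  have h2 : (2 : ENNReal) ≠ 0 := by norm_num
  simp only [eLpNorm_eq_lintegral_rpow_enorm_toReal h2 ENNReal.ofNat_ne_top]
  have h0 : 𝓝 (0 : ENNReal) = 𝓝 ((∫⁻ _, (0 : ENNReal) ∂μ) ^ (1 / (2 : ENNReal).toReal)) := by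
    simp
  rw [h0]
  refine (ENNReal.continuous_rpow_const.tendsto _).comp ?_
  have hfin : ∫⁻ ω, ‖Z ω‖ₑ ^ (2 : ENNReal).toReal ∂μ ≠ ⊤ :=
    ((eLpNorm_lt_top_iff_lintegral_rpow_enorm_lt_top h2 ENNReal.ofNat_ne_top).1 hZ.2).ne
  refine tendsto_lintegral_filter_of_dominated_convergence' (fun ω => ‖Z ω‖ₑ ^ (2 : ENNReal).toReal)
    (Eventually.of_forall fun F => ?_) (Eventually.of_forall fun F => ?_) hfin ?_
  · have hZm := hZ.1
    have : AEStronglyMeasurable (fun ω => ∑ k ∈ F, inner ℂ (e k) (Z ω) • e k - Z ω) μ := by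
      refine AEStronglyMeasurable.sub ?_ hZm
      exact (continuous_partial_sum F).comp_aestronglyMeasurable hZm
    exact this.enorm.pow_const _
  · refine Eventually.of_forall fun ω => ?_
    refine ENNReal.rpow_le_rpow ?_ ENNReal.toReal_nonneg
    rw [← ofReal_norm, ← ofReal_norm]
    exact ENNReal.ofReal_le_ofReal (norm_sub_sum_inner_e_le _ F)
  · refine Eventually.of_forall fun ω => ?_
    have h1 : Tendsto (fun F : Finset Mode => ∑ k ∈ F, inner ℂ (e k) (Z ω) • e k - Z ω) atTop
        (𝓝 (Z ω - Z ω)) := (hasSum_inner_e_smul (Z ω)).sub_const _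
    rw [sub_self] at h1
    have h3 := ((ENNReal.continuous_rpow_const (y := (2 : ENNReal).toReal)).tendsto _).comp
      ((continuous_enorm.tendsto _).comp h1)
    have h4 : ‖(0 : V)‖ₑ ^ (2 : ENNReal).toReal = 0 := by
      rw [← ofReal_norm, norm_zero, ENNReal.ofReal_zero, ENNReal.zero_rpow_of_pos (by norm_num)]
    have h5 : 𝓝 (0 : ENNReal) = 𝓝 (‖(0 : V)‖ₑ ^ (2 : ENNReal).toReal) := by rw [h4]
    rw [h5]
    exact h3

variable {hβ : IsNoise μ H β}

/-- The stochastic convolution over `[s, t]`, read off from the stationary field. -/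
def fieldConv (ν : ℝ) (α : Mode → ℝ) (Ψ : S → PathSpace m) (s t : ℝ) (ω : S) : V :=
  embed m (Ψ ω t) - semigroup ν α (t - s) (embed m (Ψ ω s))

theorem IsStationaryField.memLp_fieldConv (hp : IsAdmissible H ν α lam)
    (hΨ : IsStationaryField hβ ν α lam Ψ) {s t : ℝ} (hst : s ≤ t) :
    MemLp (fieldConv ν α Ψ s t) 2 μ := by
  obtain ⟨c, hc, hcα⟩ := hp.exists_le
  have h1 : ∀ t, MemLp (fun ω => embed m (Ψ ω t)) 2 μ := fun t =>
    (embed m).comp_memLp' (hΨ.memLp t)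
  refine (h1 t).sub ?_
  refine (h1 s).of_le ?_ (Eventually.of_forall fun ω => ?_)
  · exact (continuous_semigroup hp.ν_pos hc hcα (sub_nonneg.2 hst)).comp_aestronglyMeasurable (h1 s).1
  · refine (norm_semigroup_le hp.ν_pos hc hcα (sub_nonneg.2 hst) _).trans
      (mul_le_of_le_one_left (norm_nonneg _) ?_)
    refine Real.exp_le_one_iff.2 (neg_nonpos.2 ?_)
    have := hp.ν_pos
    have := sub_nonneg.2 hst
    positivity

variable [IsProbabilityMeasure μ]

theorem IsStationaryField.ae_sum_eq (hp : IsAdmissible H ν α lam)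
    (hΨ : IsStationaryField hβ ν α lam Ψ) {s t : ℝ} (hst : s ≤ t) (F : Finset Mode) :
    (fun ω => ∑ k ∈ F, (((Real.sqrt (lam k) * ν ^ H : ℝ) : ℂ) *
        wienerIntegral (fun u => Real.exp (-((t - u) * ν * α k))) (fun u => β k u ω) s t) • e k)
      =ᵐ[μ] fun ω => ∑ k ∈ F, inner ℂ (e k) (fieldConv ν α Ψ s t ω) • e k := by
  have h : ∀ᵐ ω ∂μ, ∀ k ∈ F, ((Real.sqrt (lam k) * ν ^ H : ℝ) : ℂ) *
      wienerIntegral (fun u => Real.exp (-((t - u) * ν * α k))) (fun u => β k u ω) s t =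
      inner ℂ (e k) (fieldConv ν α Ψ s t ω) :=
    (Finset.eventually_all _).2 fun k _ => hΨ.ae_inner_e_mild hp hst k
  filter_upwards [h] with ω hω
  exact Finset.sum_congr rfl fun k hk => by rw [hω k hk]

/-- With `fieldConv` defined as a difference the mild equation holds for every `ω`; the content is
that the defining series is almost surely the Fourier series of this difference. -/
theorem IsStationaryField.isStochConv (hp : IsAdmissible H ν α lam)
    (hΨ : IsStationaryField hβ ν α lam Ψ) {s t : ℝ} (hst : s ≤ t) :
    IsStochConv μ H ν α lam β s t (fieldConv ν α Ψ s t) := by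
  have hZ := hΨ.memLp_fieldConv hp hst
  refine ⟨hZ, (tendsto_eLpNorm_partial_sum hZ).congr fun F => eLpNorm_congr_ae ?_⟩
  filter_upwards [hΨ.ae_sum_eq hp hst F] with ω hω
  rw [hω]

/-- Uniqueness of limits in `L²`: any other solution is driven by the same stochastic convolution,
so the noise cancels in differences. -/
theorem IsStationaryField.ae_eq_of_isStochConv (hp : IsAdmissible H ν α lam)
    (hΨ : IsStationaryField hβ ν α lam Ψ) {s t : ℝ} (hst : s ≤ t) {Z : S → V}
    (hZ : IsStochConv μ H ν α lam β s t Z) : Z =ᵐ[μ] fieldConv ν α Ψ s t := by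
  set W := fieldConv ν α Ψ s t with hW
  have hWm : MemLp W 2 μ := hΨ.memLp_fieldConv hp hst
  set G : Finset Mode → S → V := fun F ω => ∑ k ∈ F, inner ℂ (e k) (W ω) • e k with hG
  have hGm : ∀ F, AEStronglyMeasurable (G F) μ := fun F =>
    (continuous_partial_sum F).comp_aestronglyMeasurable hWm.1
  have h1 : Tendsto (fun F => eLpNorm (fun ω => G F ω - W ω) 2 μ) atTop (𝓝 0) :=
    tendsto_eLpNorm_partial_sum hWm
  have h2 : Tendsto (fun F => eLpNorm (fun ω => G F ω - Z ω) 2 μ) atTop (𝓝 0) := by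
    refine hZ.2.congr fun F => eLpNorm_congr_ae ?_
    filter_upwards [hΨ.ae_sum_eq hp hst F] with ω hω
    rw [hω]
  have h3 : ∀ F, eLpNorm (Z - W) 2 μ ≤ eLpNorm (fun ω => G F ω - W ω) 2 μ +
      eLpNorm (fun ω => G F ω - Z ω) 2 μ := fun F => by
    have h4 : Z - W = (fun ω => G F ω - W ω) - fun ω => G F ω - Z ω := by
      funext ω
      simp
    rw [h4]
    exact eLpNorm_sub_le ((hGm F).sub hWm.1) ((hGm F).sub hZ.1.1) (by norm_num)
  have h5 : eLpNorm (Z - W) 2 μ ≤ 0 := by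
    have h6 := h1.add h2
    rw [add_zero] at h6
    exact ge_of_tendsto' h6 h3
  have h7 := (eLpNorm_eq_zero_iff (hZ.1.1.sub hWm.1) (by norm_num)).1 (nonpos_iff_eq_zero.1 h5)
  filter_upwards [h7] with ω hω
  exact sub_eq_zero.1 hω

theorem IsStationaryField.isMildSolution (hp : IsAdmissible H ν α lam)
    (hΨ : IsStationaryField hβ ν α lam Ψ) :
    IsMildSolution μ H ν α lam β fun t ω => embed m (Ψ ω t) where
  measurable := measurable_embed_process hΨ.measurable
  mild s t hst := ⟨fieldConv ν α Ψ s t, hΨ.isStochConv hp hst, Eventually.of_forall fun ω => by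
    rw [fieldConv, add_sub_cancel]⟩

variable {W : ℝ → Torus → Lp ℝ 2 μ}

theorem IsDecorrelatingField.isStrictlyStationary (h : IsDecorrelatingField hβ Ψ W) :
    IsStrictlyStationary μ fun t ω => embed m (Ψ ω t) := by
  intro n t r
  have hG : Measurable fun (ψ : PathSpace m) (i : Fin n) => embed m (ψ (t i)) :=
    measurable_pi_lambda _ fun i => measurable_embed_eval measurable_id (t i)
  have hs := (continuous_shift (m := m) r).measurable
  have h1 : (fun ω (i : Fin n) => embed m (Ψ ω (t i + r))) =
      (fun (ψ : PathSpace m) (i : Fin n) => embed m (ψ (t i))) ∘ shift r ∘ Ψ := by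
    funext ω i
    simp only [Function.comp_apply, shift_apply, add_comm r]
  have h2 : (fun ω (i : Fin n) => embed m (Ψ ω (t i))) =
      (fun (ψ : PathSpace m) (i : Fin n) => embed m (ψ (t i))) ∘ Ψ := rfl
  rw [h1, h2, ← Measure.map_map hG (hs.comp h.measurable), ← Measure.map_map hs h.measurable,
    (h.measurePreserving_shift r).map_eq, Measure.map_map hG h.measurable]

theorem IsDecorrelatingField.isErgodic_embed (h : IsDecorrelatingField hβ Ψ W) :
    IsErgodicProcess μ fun t ω => embed m (Ψ ω t) := by
  intro ρ hρ hint
  have := h.isProbabilityMeasure_map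
  set f : PathSpace m → ℝ := fun ψ => ρ (embed m (ψ 0)) with hf
  have hfm : Measurable f := hρ.comp (measurable_embed_eval measurable_id 0)
  have hfi : Integrable f (μ.map Ψ) :=
    (integrable_map_measure hfm.aestronglyMeasurable h.measurable.aemeasurable).2 hint
  have h1 := ae_tendsto_flow_average measurable_shift_uncurry h.measurePreserving_shift
    (fun s t => shift_add t s) shift_zero (fun E hE hE' => h.measure_eq_zero_or_one hE hE')
    hfm hfi
  have h2 := ae_of_ae_map h.measurable.aemeasurable h1
  have h3 : ∀ t (ψ : PathSpace m), f (shift t ψ) = ρ (embed m (ψ t)) := fun t ψ => by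
    rw [hf]
    simp only [shift_apply, add_zero]
  rw [integral_map h.measurable.aemeasurable hfm.aestronglyMeasurable] at h2
  simpa only [h3] using h2

theorem isErgodicMildSolution (hp : IsAdmissible H ν α lam)
    (hΨ : IsStationaryField hβ ν α lam Ψ) (h : IsDecorrelatingField hβ Ψ W) :
    IsErgodicMildSolution μ H ν α lam β fun t ω => embed m (Ψ ω t) where
  toIsMildSolution := hΨ.isMildSolution hp
  stationary := h.isStrictlyStationary
  ergodic := h.isErgodic_embed

end Solution

end FracField

end

noncomputable section

namespace FracField

/-! ### Uniqueness of the stationary solution -/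

section Uniqueness

variable {S : Type*} [MeasurableSpace S] {μ : Measure S} {H ν : ℝ}
  {α lam : Mode → ℝ} {β : Mode → ℝ → S → ℂ} {m : ℕ} {Ψ : S → PathSpace m}
  {hβ : IsNoise μ H β} {ψ : ℝ → S → V}

theorem measurable_of_process (h : Measurable fun p : ℝ × S => ψ p.1 p.2) (t : ℝ) :
    Measurable (ψ t) :=
  h.comp (measurable_const.prodMk measurable_id)

theorem IsStrictlyStationary.map_eq (h : IsStrictlyStationary μ ψ)
    (hψ : Measurable fun p : ℝ × S => ψ p.1 p.2) (t r : ℝ) : μ.map (ψ (t + r)) = μ.map (ψ t) := by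
  have h1 := congrArg (Measure.map fun f : Fin 1 → V => f 0) (h 1 (fun _ => t) r)
  have h2 : Measurable fun f : Fin 1 → V => f 0 := measurable_pi_apply 0
  have h3 : ∀ t, Measurable fun ω (_ : Fin 1) => ψ t ω := fun t =>
    measurable_pi_lambda _ fun _ => measurable_of_process hψ t
  rwa [Measure.map_map h2 (h3 _), Measure.map_map h2 (h3 _)] at h1

theorem IsStrictlyStationary.measure_lt_norm (h : IsStrictlyStationary μ ψ)
    (hψ : Measurable fun p : ℝ × S => ψ p.1 p.2) (t r R : ℝ) :
    μ {ω | R < ‖ψ (t + r) ω‖} = μ {ω | R < ‖ψ t ω‖} := by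
  have h1 : MeasurableSet {v : V | R < ‖v‖} := (isOpen_lt continuous_const continuous_norm).measurableSet
  have h2 := congrArg (fun ρ : Measure V => ρ {v | R < ‖v‖}) (h.map_eq hψ t r)
  simp only [Measure.map_apply (measurable_of_process hψ _) h1] at h2
  exact h2

/-- If a difference is still visible after contraction by `exp(-x)`, one of the two starting points
was of size `exp x`. -/
theorem lt_or_lt_of_contraction {E : Type*} [NormedAddCommGroup E] {u v w : E} {x ε : ℝ}
    (h : ‖w‖ ≤ Real.exp (-x) * ‖u - v‖) (hw : ε < ‖w‖) :
    ε * Real.exp x / 2 < ‖u‖ ∨ ε * Real.exp x / 2 < ‖v‖ := by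
  by_contra! hcon
  have h1 : ‖u - v‖ ≤ ε * Real.exp x := (norm_sub_le u v).trans (by linarith [hcon.1, hcon.2])
  have h2 : Real.exp (-x) * ‖u - v‖ ≤ Real.exp (-x) * (ε * Real.exp x) :=
    mul_le_mul_of_nonneg_left h1 (Real.exp_nonneg _)
  have h3 : Real.exp (-x) * (ε * Real.exp x) = ε := by
    rw [mul_left_comm, ← Real.exp_add, neg_add_cancel, Real.exp_zero, mul_one]
  linarith

theorem IsPathVersion.ae_eq {Ψ' : S → PathSpace m} (h : IsPathVersion μ ψ Ψ)
    (h' : IsPathVersion μ ψ Ψ') : Ψ =ᵐ[μ] Ψ' := by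
  have h1 : ∀ᵐ ω ∂μ, ∀ q : ℚ, Ψ ω q = Ψ' ω q := ae_all_iff.2 fun q => by
    filter_upwards [h.version q, h'.version q] with ω h2 h3
    exact eq_of_ae_eq ((EventuallyEq.symm h2).trans h3)
  filter_upwards [h1] with ω hω
  exact ContinuousMap.ext fun t => congrFun (Rat.denseRange_cast.equalizer (Ψ ω).continuous
    (Ψ' ω).continuous (funext hω)) t

variable [IsProbabilityMeasure μ]

theorem tendsto_measure_lt_norm {E : Type*} [NormedAddCommGroup E] [MeasurableSpace E]
    [OpensMeasurableSpace E] {f : S → E} (hf : Measurable f) {R : ℕ → ℝ}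
    (hR : Tendsto R atTop atTop) : Tendsto (fun n => μ {ω | R n < ‖f ω‖}) atTop (𝓝 0) := by
  have h1 : Tendsto (fun x : ℝ => μ {ω | x < ‖f ω‖}) atTop (𝓝 (μ (⋂ x : ℝ, {ω | x < ‖f ω‖}))) := by
    refine tendsto_measure_iInter_atTop (fun x => ?_) (fun x y hxy ω hω => hxy.trans_lt hω)
      ⟨0, measure_ne_top _ _⟩
    exact (measurableSet_lt measurable_const hf.norm).nullMeasurableSet
  have h2 : (⋂ x : ℝ, {ω | x < ‖f ω‖}) = ∅ :=
    Set.eq_empty_of_forall_notMem fun ω hω =>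
      lt_irrefl ‖f ω‖ (Set.mem_iInter.1 hω ‖f ω‖)
  rw [h2, measure_empty] at h1
  exact h1.comp hR

theorem IsStationaryField.ae_sub_eq (hp : IsAdmissible H ν α lam)
    (hΨ : IsStationaryField hβ ν α lam Ψ) (h : IsMildSolution μ H ν α lam β ψ) {s t : ℝ}
    (hst : s ≤ t) : ∀ᵐ ω ∂μ, ψ t ω - embed m (Ψ ω t) =
      semigroup ν α (t - s) (ψ s ω - embed m (Ψ ω s)) := by
  obtain ⟨c, hc, hcα⟩ := hp.exists_le
  obtain ⟨Z, hZ, hmild⟩ := h.mild s t hst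
  filter_upwards [hmild, hΨ.ae_eq_of_isStochConv hp hst hZ] with ω h1 h2
  rw [h1, h2, fieldConv, semigroup_sub hp.ν_pos hc hcα (sub_nonneg.2 hst)]
  abel

/-- Start at `t - n`. A difference larger than `ε` at time `t` forces one of the two processes at `t
- n` to exceed `ε exp(n ν c) / 2`. By stationarity these probabilities may be computed at the fixed
time `t`, and there they tend to zero as `n → ∞`. -/
theorem IsStationaryField.ae_eq (hp : IsAdmissible H ν α lam)
    (hΨ : IsStationaryField hβ ν α lam Ψ)
    (hs : IsStrictlyStationary μ fun t ω => embed m (Ψ ω t))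
    (h : IsMildSolution μ H ν α lam β ψ) (hψ : IsStrictlyStationary μ ψ) (t : ℝ) :
    ∀ᵐ ω ∂μ, ψ t ω = embed m (Ψ ω t) := by
  obtain ⟨c, hc, hcα⟩ := hp.exists_le
  have hΨm := measurable_embed_process hΨ.measurable
  have key : ∀ ε : ℝ, 0 < ε → μ {ω | ε < ‖ψ t ω - embed m (Ψ ω t)‖} = 0 := by
    intro ε hε
    have hrate : Tendsto (fun n : ℕ => (n : ℝ) * ν * c) atTop atTop :=
      (tendsto_natCast_atTop_atTop.atTop_mul_const hp.ν_pos).atTop_mul_const hc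
    have hR : Tendsto (fun n : ℕ => ε * Real.exp (n * ν * c) / 2) atTop atTop :=
      ((Real.tendsto_exp_atTop.comp hrate).const_mul_atTop hε).atTop_div_const two_pos
    have h1 := (tendsto_measure_lt_norm (μ := μ) (measurable_of_process h.measurable t) hR).add
      (tendsto_measure_lt_norm (μ := μ) (measurable_embed_eval hΨ.measurable t) hR)
    rw [add_zero] at h1
    refine nonpos_iff_eq_zero.1 (ge_of_tendsto' h1 fun n => ?_)
    have hn : t - n ≤ t := sub_le_self _ (Nat.cast_nonneg n)
    have h2 := hψ.measure_lt_norm h.measurable t (-n) (ε * Real.exp (n * ν * c) / 2)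
    have h3 := hs.measure_lt_norm hΨm t (-n) (ε * Real.exp (n * ν * c) / 2)
    rw [← sub_eq_add_neg] at h2 h3
    rw [← h2, ← h3]
    refine (measure_mono_ae ?_).trans (measure_union_le _ _)
    filter_upwards [hΨ.ae_sub_eq hp h hn] with ω hω hmem
    refine lt_or_lt_of_contraction ?_ hmem
    rw [hω]
    have h4 := norm_semigroup_le hp.ν_pos hc hcα (sub_nonneg.2 hn) (ψ (t - n) ω - embed m (Ψ ω (t - n)))
    rwa [sub_sub_cancel] at h4 ⊢
  have h5 : ∀ᵐ ω ∂μ, ∀ n : ℕ, ‖ψ t ω - embed m (Ψ ω t)‖ ≤ 1 / ((n : ℝ) + 1) :=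
    ae_all_iff.2 fun n => by
      rw [ae_iff]
      simpa only [not_le] using key _ Nat.one_div_pos_of_nat
  filter_upwards [h5] with ω hω
  have h6 := ge_of_tendsto' tendsto_one_div_add_atTop_nhds_zero_nat hω
  exact sub_eq_zero.1 (norm_le_zero_iff.1 h6)

theorem IsStationaryField.isPathVersion (hp : IsAdmissible H ν α lam)
    (hΨ : IsStationaryField hβ ν α lam Ψ)
    (hs : IsStrictlyStationary μ fun t ω => embed m (Ψ ω t))
    (h : IsMildSolution μ H ν α lam β ψ) (hψ : IsStrictlyStationary μ ψ) :
    IsPathVersion μ ψ Ψ where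
  measurable := hΨ.measurable
  version t := by
    filter_upwards [hΨ.ae_eq hp hs h hψ t, hΨ.ae_inner_mono_zero t] with ω h1 h2
    rw [h1, coe_embed h2]
    exact coeFn_toL2 _

end Uniqueness

end FracField

end

/-! ### Assembly of the theorem -/

theorem mainTheorem8 {S : Type*} [MeasurableSpace S] (μ : MeasureTheory.Measure S)
    [MeasureTheory.IsProbabilityMeasure μ]
    (H ν : ℝ) (hH0 : 0 < H) (hH1 : H < 1) (hν : 0 < ν)
    (α lam : FracField.Mode → ℝ)
    (hα : ∃ c : ℝ, 0 < c ∧ ∀ k, c ≤ α k)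
    (hα_neg : ∀ k, α k.neg = α k)
    (hα_top : Filter.Tendsto α (Filter.comap FracField.Mode.length Filter.atTop) Filter.atTop)
    (hlam : ∀ k, 0 ≤ lam k)
    (hlam_neg : ∀ k, lam k.neg = lam k)
    (hlam_bdd : BddAbove (Set.range lam))
    (β : FracField.Mode → ℝ → S → ℂ) (hβ : FracField.IsNoise μ H β)
    (m : ℕ) (γ : ℝ) (hγ0 : 0 < γ) (hγ1 : γ < 1)
    (hsum1 : Summable fun k => lam k * α k ^ (2 * γ - 2 * H) * k.length ^ (2 * m))
    (hsum2 : Summable fun k =>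
      lam k * α k ^ (-(2 * H)) * k.length ^ (2 * (m : ℝ) + 2 * γ)) :
    (∃ M : MetricSpace (FracField.PathSpace m),
      (∀ ψ φ, M.dist ψ φ = FracField.pathDist ψ φ) ∧
      M.toUniformSpace.toTopologicalSpace =
        (ContinuousMap.compactOpen : TopologicalSpace (FracField.PathSpace m)) ∧
      @CompleteSpace (FracField.PathSpace m) M.toUniformSpace) ∧
    borel (FracField.PathSpace m) =
      MeasurableSpace.comap (fun (ψ : FracField.PathSpace m) (t : ℝ) => ψ t)
        MeasurableSpace.pi ∧
    ∃ P : MeasureTheory.Measure (FracField.PathSpace m),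
      FracField.IsLawOfErgodicMildSolution μ H ν α lam β P ∧
      FracField.IsErgodicMDS P FracField.shift := by
  have hp : FracField.IsAdmissible H ν α lam := ⟨hH0, hH1, hν, hα, hα_neg, hlam, hlam_neg⟩
  obtain ⟨Ψ, hΨ⟩ := hp.exists_isStationaryField hβ hγ0 hsum1 hsum2
  obtain ⟨W, hW⟩ := hp.exists_isDecorrelatingField hβ hγ0 hsum1 hsum2 hΨ
  have hs := hW.isStrictlyStationary
  refine ⟨FracField.exists_metricSpace_pathDist m, FracField.borel_pathSpace_eq_comap m,
    μ.map Ψ, ⟨⟨_, FracField.isErgodicMildSolution hp hΨ hW⟩, fun ψ hψ => ⟨Ψ, ?_⟩,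
      fun ψ hψ Ψ' hΨ' => ?_⟩, hW.isErgodicMDS⟩
  · exact hΨ.isPathVersion hp hs hψ.toIsMildSolution hψ.stationary
  · exact MeasureTheory.Measure.map_congr
      (hΨ'.ae_eq (hΨ.isPathVersion hp hs hψ.toIsMildSolution hψ.stationary))
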